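/- Let $U\subseteq\mathbb R^n$ and $V\subseteq\mathbb R^d$ be open, let $f:U\times V\to\mathbb R^n$ and $\Gamma:\mathbb R\to V$ be $C^1$, and suppose $\Gamma(t)\to\Gamma^{\pm}\in V$ as $t\to\pm\infty$. Let $g:\mathbb R\to(-1,1)$ be $C^2$ with $\dot g>0$ everywhere, $g(t)\to\pm1$ and $\dot g(t)\to0$ as $t\to\pm\infty$. The compactified system of $\dot x=f(x,\Gamma(t))$ is the autonomous system $$\dot x=f(x,\hat\Gamma(s)),\qquad \dot s=\gamma(s)$$ on the extended phase space $P=U\times[-1,1]$, where $\hat\Gamma(s)=\Gamma(g^{-1}(s))$ and $\gamma(s)=\dot g(g^{-1}(s))$ for $s\in(-1,1)$, $\hat\Gamma(\pm1)=\Gamma^\pm$ and $\gamma(\pm1)=0$. Assume that its vector field is $C^1$ on $P$. Let $\eta^+\in U$ be a hyperbolic saddle equilibrium of the future limit system $\dot x=f(x,\Gamma^+)$ (no eigenvalue of the linearisation has zero real part, and there are eigenvalues with negative and with positive real part), and suppose that $\tilde\eta^+=(\eta^+,1)$ is a non-hyperbolic saddle of the compactified system (its linearisation has, in addition, an eigenvalue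 with zero real part). Let $E^s,E^c,E^u\subseteq\mathbb R^{n+1}$ be the real subspaces spanned by the generalised eigenvectors of the linearisation of the compactified system at $\tilde\eta^+$ that belong to eigenvalues with negative, zero and positive real part, respectively. For a relatively open neighbourhood $N\subseteq P$ of $\tilde\eta^+$: * A local centre-stable manifold $W^{cs}_{loc}(\tilde\eta^+)$ relative to $N$ is a set $W\subseteq N$ of the form $W=\{\tilde\eta^++w+h(w): w\in D\}$, where $D=\{w\in E^c\oplus E^s:\tilde\eta^++w\in N\}$ and $h:D\to E^u$ is Lipschitz, such that $W$ passes through $\tilde\eta^+$ and is tangent to $E^c\oplus E^s$ there ($h(0)=0$ and $h(w)=o(\|w\|)$ as $w\to0$ in $D$), and $W$ is flow-invariant relative to $N$ (an orbit through a point of $W$ stays in $W$, forward and backward in time, for as long as it stays in $N$). * The local stable set $w^s_{loc}(\tilde\eta^+)$ relative to $N$ is the set of all $y$ whose solution $\psi(t,y)$ exists and lies in $N$ for all $t\ge0$ and has its $\omega$-limit set contained in $\{\tilde\eta^+\}$. Then inside every neighbourhood of $\tilde\eta^+$ there is a relatively open neighbourhood $N\subseteq P$ of $\tilde\eta^+$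 such that there is exactly one local centre-stable manifold $W^{cs}_{loc}(\tilde\eta^+)$ relative to $N$, and $$W^{cs}_{loc}(\tilde\eta^+)=w^s_{loc}(\tilde\eta^+).$$ -/

import Mathlib

open Set Filter Topology

open scoped TensorProduct

noncomputable section

namespace AsympAuto

/-! ### Linear algebra: eigenvalues and spectral subspaces of a real endomorphism -/

section Linear

variable {X : Type*} [NormedAddCommGroup X] [NormedSpace ℝ X]

/-- The complexification of a real linear map. -/
def complexify (A : X →L[ℝ] X) : Module.End ℂ (ℂ ⊗[ℝ] X) :=
  LinearMap.baseChange ℂ (A : X →ₗ[ℝ] X)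

/-- `μ` is a (complex) eigenvalue of the real linear map `A`. -/
def IsEigenvalue (A : X →L[ℝ] X) (μ : ℂ) : Prop :=
  (complexify A).HasEigenvalue μ

/-- The real vectors in the span of all (generalised, complex) eigenvectors of `A` that belong
to eigenvalues in the set `Λ`. -/
def spectralSubspace (A : X →L[ℝ] X) (Λ : Set ℂ) : Submodule ℝ X :=
  Submodule.comap (TensorProduct.mk ℝ ℂ X 1)
    (Submodule.restrictScalars ℝ (⨆ μ ∈ Λ, (complexify A).maxGenEigenspace μ))

/-- The stable eigenspace `E^s`. -/
def stableSpace (A : X →L[ℝ] X) : Submodule ℝ X := spectralSubspace A {μ | μ.re < 0}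

/-- The centre eigenspace `E^c`. -/
def centreSpace (A : X →L[ℝ] X) : Submodule ℝ X := spectralSubspace A {μ | μ.re = 0}

/-- The unstable eigenspace `E^u`. -/
def unstableSpace (A : X →L[ℝ] X) : Submodule ℝ X := spectralSubspace A {μ | 0 < μ.re}

/-- The sum `E^c ⊕ E^s`. -/
def centreStableSpace (A : X →L[ℝ] X) : Submodule ℝ X := centreSpace A ⊔ stableSpace A

/-- `A` has both stable and unstable eigenvalues. -/
def IsSaddleMap (A : X →L[ℝ] X) : Prop :=
  (∃ μ, IsEigenvalue A μ ∧ μ.re < 0) ∧ (∃ μ, IsEigenvalue A μ ∧ 0 < μ.re)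

/-- `A` has no eigenvalue on the imaginary axis. -/
def IsHyperbolicMap (A : X →L[ℝ] X) : Prop := ∀ μ, IsEigenvalue A μ → μ.re ≠ 0

end Linear

/-! ### Autonomous systems `ẏ = F y` on a phase space `P ⊆ X` -/

section Systems

variable {X : Type*} [NormedAddCommGroup X] [NormedSpace ℝ X]

/-- `p` is a hyperbolic saddle equilibrium of `ẏ = F y` on `P`. The derivative is taken within
`P`, since `P` may have a boundary. -/
def IsHyperbolicSaddle (F : X → X) (P : Set X) (p : X) : Prop :=
  p ∈ P ∧ F p = 0 ∧ IsSaddleMap (fderivWithin ℝ F P p) ∧ IsHyperbolicMap (fderivWithin ℝ F P p)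

/-- `p` is a saddle equilibrium of `ẏ = F y` on `P` that is not hyperbolic. -/
def IsNonhyperbolicSaddle (F : X → X) (P : Set X) (p : X) : Prop :=
  p ∈ P ∧ F p = 0 ∧ IsSaddleMap (fderivWithin ℝ F P p) ∧ ¬ IsHyperbolicMap (fderivWithin ℝ F P p)

/-- `c` restricted to `I` is a solution of `ẏ = F y` with values in `P`. -/
def IsSolutionOn (F : X → X) (P : Set X) (I : Set ℝ) (c : ℝ → X) : Prop :=
  ∀ t ∈ I, c t ∈ P ∧ HasDerivWithinAt c (F (c t)) I t

/-- The `ω`-limit set of a curve. -/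
def omegaSet (c : ℝ → X) : Set X := ⋂ T : {T : ℝ // 0 < T}, closure (c '' Ioi T.1)

/-- The local stable set of `A` relative to `N`: all `y` whose forward orbit exists for all time,
stays in `N`, and has its `ω`-limit set in `A`. -/
def localStableSet (F : X → X) (P A N : Set X) : Set X :=
  {y | ∃ c : ℝ → X, IsSolutionOn F P (Ici 0) c ∧ c 0 = y ∧ omegaSet c ⊆ A ∧ ∀ t, 0 ≤ t → c t ∈ N}

/-- `W ⊆ N` is flow-invariant relative to `N`: an orbit through a point of `W` stays in `W`, in
both time directions, for as long as it stays in `N`. -/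
def IsInvariantRel (F : X → X) (P N W : Set X) : Prop :=
  W ⊆ N ∧ ∀ (I : Set ℝ) (c : ℝ → X), I.OrdConnected → IsSolutionOn F P I c →
    (∀ t ∈ I, c t ∈ N) → ∀ t₀ ∈ I, c t₀ ∈ W → ∀ t ∈ I, c t ∈ W

/-- `N` is a (relatively) open neighbourhood of `p` in the phase space `P`. -/
def IsOpenNhdIn (P : Set X) (p : X) (N : Set X) : Prop :=
  p ∈ N ∧ ∃ O : Set X, IsOpen O ∧ N = O ∩ P

/-- `W` is the graph, over the part of the affine subspace `p + S` in `N`, of a Lipschitz function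
`h` with values in `T`, and this graph passes through `p` and is tangent to `S` there. -/
def IsTangentLipschitzGraph (p : X) (S T : Submodule ℝ X) (N W : Set X) : Prop :=
  ∃ h : S → T,
    (∃ K, LipschitzOnWith K h {w : S | p + (w : X) ∈ N}) ∧
    h 0 = 0 ∧ HasFDerivWithinAt h (0 : S →L[ℝ] T) {w : S | p + (w : X) ∈ N} 0 ∧
    W = (fun w : S => p + (w : X) + (h w : X)) '' {w : S | p + (w : X) ∈ N}

/-- `W` is a local centre-stable manifold of the equilibrium `p` relative to `N`: a Lipschitz graph
over `E^c ⊕ E^s` with values in `E^u`, tangent to `E^c ⊕ E^s` at `p`, and flow-invariant relative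
to `N`. -/
def IsLocalCentreStableManifold (F : X → X) (P : Set X) (p : X) (N W : Set X) : Prop :=
  IsTangentLipschitzGraph p (centreStableSpace (fderivWithin ℝ F P p))
    (unstableSpace (fderivWithin ℝ F P p)) N W ∧
  IsInvariantRel F P N W

end Systems

/-! ### The compactified system -/

section Compactified

variable {E G : Type*} [NormedAddCommGroup E] [NormedSpace ℝ E]
  [NormedAddCommGroup G] [NormedSpace ℝ G]

/-- `s = g t` is a coordinate transformation of the real line onto `(-1, 1)`. -/
structure IsCoordTransformation (g : ℝ → ℝ) : Prop where
  mapsTo : ∀ t, g t ∈ Ioo (-1 : ℝ) 1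
  contDiff : ContDiff ℝ 2 g
  tendsto_atTop : Tendsto g atTop (𝓝 1)
  tendsto_atBot : Tendsto g atBot (𝓝 (-1))
  deriv_pos : ∀ t, 0 < deriv g t
  deriv_atTop : Tendsto (deriv g) atTop (𝓝 0)
  deriv_atBot : Tendsto (deriv g) atBot (𝓝 0)

/-- The nonautonomous term as a function of `s ∈ [-1, 1]`: it is `Γ (g⁻¹ s)` on `(-1, 1)`, extended
by the past limit `Γm` and the future limit `Γp`. Values outside `[-1, 1]` are never used. -/
def extTerm (Γ : ℝ → G) (Γm Γp : G) (g : ℝ → ℝ) (s : ℝ) : G :=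
  open Classical in
  if s = 1 then Γp else if s = -1 then Γm else Γ (Function.invFun g s)

/-- The augmented component `γ` of the vector field: `γ s = ġ (g⁻¹ s)` on `(-1, 1)`, and
`γ (±1) = 0`. Values outside `[-1, 1]` are never used. -/
def augField (g : ℝ → ℝ) (s : ℝ) : ℝ :=
  open Classical in
  if s = 1 ∨ s = -1 then 0 else deriv g (Function.invFun g s)

/-- The extended vector field `(x, s) ↦ (f (x, Γ (g⁻¹ s)), γ s)` of the compactified system. -/
def compactField (f : E × G → E) (Γ : ℝ → G) (Γm Γp : G) (g : ℝ → ℝ) (q : E × ℝ) : E × ℝ :=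
  (f (q.1, extTerm Γ Γm Γp g q.2), augField g q.2)

/-- The extended phase space `U × [-1, 1]`. -/
def extPhaseSpace (U : Set E) : Set (E × ℝ) := U ×ˢ Icc (-1 : ℝ) 1

end Compactified

end AsympAuto

end

/-! Write `(η, 1)` for the equilibrium of the compactified system. The slice `s = 1` is invariant and
carries the future limit system, and the equation `ṡ = γ s` does not involve `x`. Hence the
linearisation is block triangular: the future limit system contributes its hyperbolic block, and the
only remaining eigenvalue is the diagonal entry in the `s` direction. As the equilibrium is not
hyperbolic that eigenvalue is zero, so the centre space is one-dimensional and projects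
isomorphically to the `s` axis (`eq_zero_of_not_isHyperbolicMap`). In linear coordinates `(y, z, σ)` adapted to
the stable, unstable and centre spaces, with `σ = s - 1` (`exists_splitting_coordinates`), the system is near the
equilibrium of the form `ẏ = A y + ρ₁`, `ż = B z + ρ₂`, `σ̇ = γ σ`, where `A` contracts and `B` expands
in Euclidean norms, the remainder `ρ` has a small Lipschitz constant, and the phase space is the
half-space `σ ≤ 0`, on which `γ > 0` except at `σ = 0` (`exists_isBoxChart`). This is the reason for
the result: in the phase space even the centre direction is attracting.

The neighbourhood `N` is a small box in these coordinates, and the claim is that both sides of the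
equality are the set of all points whose forward orbit stays in the box.

* An orbit that stays in the box has bounded `z`. Along the difference of two orbits the form
  `‖Δz‖² - κ² (‖Δy‖² + Δσ²)` grows exponentially (`IsSaddleModel.exp_mul_coneForm_le`), so it cannot
  be positive if both orbits stay in the box. Comparison with the equilibrium bounds `z` by `y` and
  `σ`; since `σ` increases to `0`, all components tend to zero (`IsSaddleModel.tendsto_zero`).
  Comparison of two such orbits shows that trapped points form a Lipschitz graph over a subset of the
  centre-stable coordinates, and `κ → 0` as the box shrinks, which gives tangency.
* There is a trapped point over every centre-stable coordinate of the box: insert the solution `σ`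
  and find a bounded solution of the rest by the Lyapunov–Perron method
  (`IsSaddleModel.exists_mem_trappedSet`). So the local stable set is a local centre-stable manifold.
* Conversely an orbit that starts on a centre-stable manifold can leave the box only through the
  faces `‖z‖ = δ` (`IsSaddleModel.forall_mem_halfBox_or_exit`). It is on the graph until it does, so
  the exit point would be a point of the graph over the interior of the box, and these lie in the
  box, a contradiction. Thus every centre-stable manifold is contained in the local stable set, and
  both being graphs over the same domain they are equal (`IsBoxChart.eq_localStableSet`). -/

namespace AsympAuto

/-! ### Adapted Euclidean norms for contracting linear maps -/

section Lyapunov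

open Module Module.End

/-- A real matrix whose complex eigenvalues lie in the open unit disc has a power that is a strict
contraction of the Euclidean norm: by Gelfand's formula its powers tend to `0`. -/
theorem exists_pow_norm_le_half {k : ℕ} (M : Matrix (Fin k) (Fin k) ℝ)
    (hM : ∀ ν ∈ spectrum ℂ (M.map (algebraMap ℝ ℂ)), ‖ν‖ < 1) :
    ∃ m : ℕ, 1 ≤ m ∧ ‖Matrix.toEuclideanCLM (𝕜 := ℝ) (M ^ m)‖ ≤ 1 / 2 := by
  let _ := Matrix.linftyOpNormedRing (n := Fin k) (α := ℂ)
  let _ := Matrix.linftyOpNormedAlgebra (n := Fin k) (R := ℂ) (α := ℂ)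
  let _ := Matrix.linftyOpNormedRing (n := Fin k) (α := ℝ)
  let _ := Matrix.linftyOpNormedAlgebra (n := Fin k) (R := ℝ) (α := ℝ)
  set C : Matrix (Fin k) (Fin k) ℂ := M.map (algebraMap ℝ ℂ) with hC
  have hnorm : ∀ m : ℕ, ‖M ^ m‖ = ‖C ^ m‖ := by
    intro m
    have h1 : C ^ m = (M ^ m).map (algebraMap ℝ ℂ) := by
      rw [hC, ← RingHom.mapMatrix_apply, ← RingHom.mapMatrix_apply, map_pow]
    rw [h1, Matrix.linfty_opNorm_def, Matrix.linfty_opNorm_def]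
    simp
  have hrad : spectralRadius ℂ C < 1 := by
    rcases isEmpty_or_nonempty (Fin k) with h | h
    · have : Subsingleton (Matrix (Fin k) (Fin k) ℂ) := inferInstance
      rw [Subsingleton.elim C 0, spectrum.spectralRadius_zero]
      exact zero_lt_one
    · exact_mod_cast spectrum.spectralRadius_lt_of_forall_lt C (r := 1)
        (fun z hz => by exact_mod_cast hM z hz)
  obtain ⟨r, hr1, hr2⟩ := ENNReal.lt_iff_exists_nnreal_btwn.1 hrad
  have hr2' : r < 1 := by exact_mod_cast hr2
  have hev : ∀ᶠ m : ℕ in atTop, ‖M ^ m‖ ≤ (r : ℝ) ^ m := by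
    filter_upwards [(spectrum.pow_nnnorm_pow_one_div_tendsto_nhds_spectralRadius C).eventually
      (gt_mem_nhds hr1), eventually_ge_atTop 1] with m hm hm1
    have hm0 : (0 : ℝ) < m := by exact_mod_cast hm1
    rw [one_div, ENNReal.rpow_inv_lt_iff hm0, ENNReal.rpow_natCast] at hm
    rw [hnorm]
    exact_mod_cast hm.le
  have hlim : Tendsto (fun m : ℕ => M ^ m) atTop (𝓝 0) :=
    squeeze_zero_norm' hev (tendsto_pow_atTop_nhds_zero_of_lt_one r.2 (by exact_mod_cast hr2'))
  let T : Matrix (Fin k) (Fin k) ℝ →ₗ[ℝ] (EuclideanSpace ℝ (Fin k) →L[ℝ] EuclideanSpace ℝ (Fin k)) :=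
    (Matrix.toEuclideanCLM (n := Fin k) (𝕜 := ℝ)).toAlgEquiv.toLinearEquiv.toLinearMap
  have hT : Continuous T := LinearMap.continuous_of_finiteDimensional T
  have h0 : Tendsto (fun m : ℕ => ‖T (M ^ m)‖) atTop (𝓝 0) := by
    have := ((hT.tendsto 0).comp hlim).norm
    simpa using this
  obtain ⟨m, hm1, hm2⟩ := ((h0.eventually (ge_mem_nhds (by norm_num : (0:ℝ) < 1/2))).and
    (eventually_ge_atTop 1)).exists
  exact ⟨m, hm2, hm1⟩

variable {V : Type*} [AddCommGroup V] [Module ℝ V]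

theorem tmul_one_injective : Function.Injective (fun x : V => (1 : ℂ) ⊗ₜ[ℝ] x) :=
  Module.FaithfullyFlat.tensorProduct_mk_injective (A := ℝ) (B := ℂ) V

theorem baseChange_injective_of_injective {W : Type*} [AddCommGroup W] [Module ℝ W]
    (φ : V →ₗ[ℝ] W) (hφ : Function.Injective φ) : Function.Injective (φ.baseChange ℂ) :=
  Module.Flat.lTensor_preserves_injective_linearMap (M := ℂ) φ hφ

/-- The Cayley transform `B = (1 + A) (1 - A)⁻¹` moves eigenvalues from the open left half plane
into the open unit disc. -/
theorem norm_lt_one_of_cayley {A B D : End ℝ V} (hD : Function.Surjective D)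
    (hDA : D = 1 - A) (hB : B * D = 1 + A)
    (hA : ∀ μ : ℂ, HasEigenvalue (A.baseChange ℂ) μ → μ.re < 0)
    {ν : ℂ} (hν : HasEigenvalue (B.baseChange ℂ) ν) : ‖ν‖ < 1 := by
  obtain ⟨w, hw⟩ := hν.exists_hasEigenvector
  have hsurj : Function.Surjective (D.baseChange ℂ) :=
    LinearMap.lTensor_surjective ℂ hD
  obtain ⟨y, rfl⟩ := hsurj w
  have hBD : (B.baseChange ℂ) ((D.baseChange ℂ) y) = y + (A.baseChange ℂ) y := by
    rw [← Module.End.mul_apply, ← LinearMap.baseChange_mul, hB, LinearMap.baseChange_add]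
    simp [LinearMap.baseChange_one]
  have hDy : (D.baseChange ℂ) y = y - (A.baseChange ℂ) y := by
    rw [hDA, LinearMap.baseChange_sub]
    simp [LinearMap.baseChange_one]
  have hy : y ≠ 0 := by
    rintro rfl
    exact hw.2 (by simp)
  have heq := hw.apply_eq_smul
  rw [hBD, hDy] at heq
  set a := (A.baseChange ℂ) y with ha
  have h1 : (1 + ν) • a = (ν - 1) • y := by
    rw [smul_sub] at heq
    rw [add_smul, sub_smul, one_smul, one_smul]
    linear_combination (norm := module) heq
  have hne : 1 + ν ≠ 0 := by
    intro h0
    have : ν = -1 := by linear_combination h0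
    rw [this] at h1
    norm_num at h1
    exact hy h1
  have hev : HasEigenvalue (A.baseChange ℂ) ((ν - 1) / (1 + ν)) := by
    refine hasEigenvalue_of_hasEigenvector (x := y) ⟨mem_eigenspace_iff.2 ?_, hy⟩
    rw [← ha, div_eq_inv_mul, mul_smul, ← h1, smul_smul, inv_mul_cancel₀ hne, one_smul]
  have hre := hA _ hev
  have hpos : 0 < Complex.normSq (1 + ν) := Complex.normSq_pos.2 hne
  have hre' : ((ν - 1) / (1 + ν)).re = (Complex.normSq ν - 1) / Complex.normSq (1 + ν) := by
    rw [Complex.div_re, ← add_div]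
    congr 1
    simp [Complex.normSq_apply]
    ring
  rw [hre', div_lt_iff₀ hpos, zero_mul, Complex.normSq_eq_norm_sq] at hre
  have := norm_nonneg ν
  nlinarith

/-- If all eigenvalues of `A` have negative real part, then there are Euclidean coordinates in which
`A` contracts. With `B` the Cayley transform of `A` and `‖B ^ m‖ < 1`, the adapted norm is
`|x| ^ 2 = ∑ i < m, ‖B ^ i x‖ ^ 2`: for `w = x - A x` one has `B w = x + A x`, so that `|B w| < |w|`
says that the inner product of `x` and `A x` is negative. -/
theorem exists_adapted_coordinates [FiniteDimensional ℝ V] (A : End ℝ V)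
    (hA : ∀ μ : ℂ, HasEigenvalue (A.baseChange ℂ) μ → μ.re < 0) :
    ∃ (k : ℕ) (e : V ≃ₗ[ℝ] EuclideanSpace ℝ (Fin k)) (l : ℝ), 0 < l ∧
      ∀ x, inner ℝ (e (A x)) (e x) ≤ -l * ‖e x‖ ^ 2 := by
  -- `1` is not an eigenvalue, so the Cayley transform `B` of `A` exists
  have hinj : Function.Injective (1 - A : End ℝ V) := by
    rw [← LinearMap.ker_eq_bot, LinearMap.ker_eq_bot']
    intro x hx
    by_contra hx0
    have : HasEigenvalue (A.baseChange ℂ) 1 := by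
      refine hasEigenvalue_of_hasEigenvector (x := (1 : ℂ) ⊗ₜ[ℝ] x) ⟨mem_eigenspace_iff.2 ?_, ?_⟩
      · have : A x = x := by
          simp only [LinearMap.sub_apply, Module.End.one_apply] at hx
          exact (sub_eq_zero.1 hx).symm
        rw [LinearMap.baseChange_tmul, this, one_smul]
      · intro h
        exact hx0 (tmul_one_injective (by simpa using h))
    have := hA _ this
    norm_num at this
  let D : V ≃ₗ[ℝ] V := LinearEquiv.ofInjectiveEndo (1 - A) hinj
  have hDA : (D : End ℝ V) = 1 - A := by ext x; rfl
  let B : End ℝ V := (1 + A) * (D.symm : End ℝ V)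
  have hB : B * (D : End ℝ V) = 1 + A := by
    ext x; simp [B]
  let b := finBasis ℝ V
  let M := LinearMap.toMatrix b b B
  obtain ⟨m, hm1, hm⟩ := exists_pow_norm_le_half M (by
    intro ν hν
    rw [← LinearMap.toMatrix_baseChange, LinearMap.spectrum_toMatrix,
      ← hasEigenvalue_iff_mem_spectrum] at hν
    exact norm_lt_one_of_cayley D.surjective hDA hB hA hν)
  let e₀ : V ≃ₗ[ℝ] EuclideanSpace ℝ (Fin (finrank ℝ V)) :=
    b.equivFun ≪≫ₗ (WithLp.linearEquiv 2 ℝ (Fin (finrank ℝ V) → ℝ)).symm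
  have hpow : ∀ x, ‖e₀ ((B ^ m) x)‖ ≤ 1 / 2 * ‖e₀ x‖ := by
    intro x
    have : e₀ ((B ^ m) x) = Matrix.toEuclideanCLM (𝕜 := ℝ) (M ^ m) (e₀ x) := by
      have h1 : M ^ m = LinearMap.toMatrix b b (B ^ m) := by
        exact (map_pow (LinearMap.toMatrixAlgEquiv b) B m).symm
      have h2 := LinearMap.toMatrix_mulVec_repr b b (B ^ m) x
      have h3 : ∀ y, e₀ y = WithLp.toLp 2 (⇑(b.repr y)) := fun y => rfl
      rw [h1, h3, h3, ← h2, Matrix.toEuclideanCLM_toLp]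
    rw [this]
    exact ContinuousLinearMap.le_of_opNorm_le _ hm _
  -- the adapted norm is the Euclidean norm of the tuple of all `B ^ i x`, `i < m`
  let Φ : V →ₗ[ℝ] PiLp 2 (fun _ : Fin m => EuclideanSpace ℝ (Fin (finrank ℝ V))) :=
    (WithLp.linearEquiv 2 ℝ (Fin m → EuclideanSpace ℝ (Fin (finrank ℝ V)))).symm.toLinearMap ∘ₗ
      LinearMap.pi (fun i : Fin m => e₀.toLinearMap ∘ₗ (B ^ (i : ℕ)))
  have hΦ : ∀ x, ‖Φ x‖ ^ 2 = ∑ i ∈ Finset.range m, ‖e₀ ((B ^ i) x)‖ ^ 2 := by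
    intro x
    rw [PiLp.norm_sq_eq_of_L2, Finset.sum_range]
    rfl
  have hΦB : ∀ w, ‖Φ (B w)‖ ^ 2 ≤ ‖Φ w‖ ^ 2 - 1 / 2 * ‖e₀ w‖ ^ 2 := by
    intro w
    have h1 : ‖Φ (B w)‖ ^ 2 = ∑ i ∈ Finset.range m, ‖e₀ ((B ^ (i + 1)) w)‖ ^ 2 := by
      rw [hΦ]
      simp [pow_succ]
    have h2 := Finset.sum_range_succ (fun i => ‖e₀ ((B ^ i) w)‖ ^ 2) m
    rw [Finset.sum_range_succ', ← h1, ← hΦ] at h2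
    simp only [pow_zero, Module.End.one_apply] at h2
    have h3 := hpow w
    have h4 : ‖e₀ ((B ^ m) w)‖ ^ 2 ≤ (1 / 2 * ‖e₀ w‖) ^ 2 := by gcongr
    nlinarith [sq_nonneg ‖e₀ w‖]
  have hΦinj : Function.Injective Φ := by
    rw [← LinearMap.ker_eq_bot, LinearMap.ker_eq_bot']
    intro x hx
    have h1 := hΦ x
    rw [hx, norm_zero] at h1
    have h2 : ‖e₀ ((B ^ 0) x)‖ ^ 2 ≤ ∑ i ∈ Finset.range m, ‖e₀ ((B ^ i) x)‖ ^ 2 :=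
      Finset.single_le_sum (f := fun i => ‖e₀ ((B ^ i) x)‖ ^ 2) (fun i _ => sq_nonneg _)
        (Finset.mem_range.2 hm1)
    rw [← h1] at h2
    have h3 : ‖e₀ x‖ = 0 := by
      simp only [pow_zero, Module.End.one_apply] at h2
      nlinarith [norm_nonneg (e₀ x)]
    simpa using h3
  let R := LinearMap.range Φ
  let e₁ : V ≃ₗ[ℝ] R := LinearEquiv.ofInjective Φ hΦinj
  let e : V ≃ₗ[ℝ] EuclideanSpace ℝ (Fin (finrank ℝ R)) :=
    e₁ ≪≫ₗ (stdOrthonormalBasis ℝ R).repr.toLinearEquiv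
  have heinner : ∀ x y, inner ℝ (e x) (e y) = inner ℝ (Φ x) (Φ y) := by
    intro x y
    exact (stdOrthonormalBasis ℝ R).repr.inner_map_map (e₁ x) (e₁ y)
  have henorm : ∀ x, ‖e x‖ = ‖Φ x‖ := by
    intro x
    exact (stdOrthonormalBasis ℝ R).repr.norm_map (e₁ x)
  let T : EuclideanSpace ℝ (Fin (finrank ℝ V)) →L[ℝ] EuclideanSpace ℝ (Fin (finrank ℝ R)) :=
    LinearMap.toContinuousLinearMap (e.toLinearMap ∘ₗ D.symm.toLinearMap ∘ₗ e₀.symm.toLinearMap)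
  have hT : ∀ x, ‖e x‖ ≤ (‖T‖ + 1) * ‖e₀ (D x)‖ := by
    intro x
    have h1 : T (e₀ (D x)) = e x := by simp [T]
    have h2 := T.le_opNorm (e₀ (D x))
    rw [h1] at h2
    nlinarith [norm_nonneg (e₀ (D x))]
  have hTpos : 0 < ‖T‖ + 1 := by positivity
  refine ⟨_, e, 1 / 8 / (‖T‖ + 1) ^ 2, by positivity, fun x => ?_⟩
  have h1 := hΦB (D x)
  have h2 : B (D x) = x + A x := by
    have := LinearMap.congr_fun hB x
    simpa using this
  have h3 : D x = x - A x := by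
    have := LinearMap.congr_fun hDA x
    simpa using this
  -- with `w = D x`, polarisation turns the decrease of the norm from `w` to `B w` into the claim
  have h7 : Φ (D x) = Φ x - Φ (A x) := by rw [h3, map_sub]
  rw [h2, h7, map_add, norm_add_sq_real, norm_sub_sq_real] at h1
  rw [heinner, real_inner_comm]
  have h4 := hT x
  have h5 : ‖e x‖ ^ 2 ≤ (‖T‖ + 1) ^ 2 * ‖e₀ (D x)‖ ^ 2 := by
    rw [← mul_pow]
    gcongr
  have h6 : 1 / 8 / (‖T‖ + 1) ^ 2 * ‖e x‖ ^ 2 ≤ 1 / 8 * ‖e₀ (D x)‖ ^ 2 := by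
    rw [div_mul_eq_mul_div, div_le_iff₀ (by positivity)]
    nlinarith
  linarith

end Lyapunov

/-! ### Real spectral subspaces -/

section Spectral

open Module Module.End

variable {X : Type*} [NormedAddCommGroup X] [NormedSpace ℝ X]

/-- The sum of the generalised eigenspaces of the complexification that belong to `Λ`. -/
noncomputable def complexSpectralSubspace (A : X →L[ℝ] X) (Λ : Set ℂ) : Submodule ℂ (ℂ ⊗[ℝ] X) :=
  ⨆ μ ∈ Λ, (complexify A).maxGenEigenspace μ

theorem mem_spectralSubspace {A : X →L[ℝ] X} {Λ : Set ℂ} {x : X} :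
    x ∈ spectralSubspace A Λ ↔ (1 : ℂ) ⊗ₜ[ℝ] x ∈ complexSpectralSubspace A Λ := Iff.rfl

theorem spectralSubspace_mono (A : X →L[ℝ] X) {Λ Λ' : Set ℂ} (h : Λ ⊆ Λ') :
    spectralSubspace A Λ ≤ spectralSubspace A Λ' :=
  fun _ hx => biSup_mono (f := fun μ => (complexify A).maxGenEigenspace μ) h hx

theorem maxGenEigenspace_le {A : X →L[ℝ] X} {Λ : Set ℂ} {μ : ℂ} (hμ : μ ∈ Λ) :
    (complexify A).maxGenEigenspace μ ≤ complexSpectralSubspace A Λ :=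
  le_iSup₂ (f := fun μ (_ : μ ∈ Λ) => (complexify A).maxGenEigenspace μ) μ hμ

theorem disjoint_complexSpectralSubspace (A : X →L[ℝ] X) {Λ Λ' : Set ℂ} (h : Disjoint Λ Λ') :
    Disjoint (complexSpectralSubspace A Λ) (complexSpectralSubspace A Λ') := by
  have hind : iSupIndep (complexify A).maxGenEigenspace := independent_maxGenEigenspace _
  exact hind.disjoint_biSup_biSup h

theorem disjoint_spectralSubspace (A : X →L[ℝ] X) {Λ Λ' : Set ℂ} (h : Disjoint Λ Λ') :
    Disjoint (spectralSubspace A Λ) (spectralSubspace A Λ') := by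
  rw [Submodule.disjoint_def]
  intro x hx hx'
  have := Submodule.disjoint_def.1 (disjoint_complexSpectralSubspace A h) _ hx hx'
  exact tmul_one_injective (by simpa using this)

theorem map_mem_spectralSubspace (A : X →L[ℝ] X) {Λ : Set ℂ} {x : X}
    (hx : x ∈ spectralSubspace A Λ) : A x ∈ spectralSubspace A Λ := by
  have h : complexSpectralSubspace A Λ ≤ (complexSpectralSubspace A Λ).comap (complexify A) :=
    iSup₂_le fun μ hμ w hw =>
      maxGenEigenspace_le hμ (mapsTo_maxGenEigenspace_of_comm (Commute.refl _) μ hw)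
  exact h hx

theorem baseChange_intertwine {K Y : Type*} [AddCommGroup K] [Module ℝ K] [AddCommGroup Y]
    [Module ℝ Y] {f : K →ₗ[ℝ] Y} {a : End ℝ K} {b : End ℝ Y} (h : ∀ x, f (a x) = b (f x))
    (w : ℂ ⊗[ℝ] K) :
    f.baseChange ℂ (a.baseChange ℂ w) = b.baseChange ℂ (f.baseChange ℂ w) := by
  have : f ∘ₗ a = b ∘ₗ f := LinearMap.ext h
  rw [← LinearMap.comp_apply, ← LinearMap.comp_apply, ← LinearMap.baseChange_comp,
    ← LinearMap.baseChange_comp, this]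

theorem baseChange_hasEigenvector {K Y : Type*} [AddCommGroup K] [Module ℝ K] [AddCommGroup Y]
    [Module ℝ Y] {f : K →ₗ[ℝ] Y} (hf : Function.Injective f) {a : End ℝ K} {b : End ℝ Y}
    (h : ∀ x, f (a x) = b (f x)) {μ : ℂ} {w : ℂ ⊗[ℝ] K}
    (hw : HasEigenvector (a.baseChange ℂ) μ w) :
    HasEigenvector (b.baseChange ℂ) μ (f.baseChange ℂ w) := by
  refine ⟨mem_eigenspace_iff.2 ?_, fun h0 => hw.2 ?_⟩
  · rw [← baseChange_intertwine h, hw.apply_eq_smul, map_smul]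
  · exact baseChange_injective_of_injective f hf (by rw [h0, map_zero])

/-- Eigenvalues of the restriction of `A` to an invariant subspace of `spectralSubspace A Λ`
belong to `Λ`. -/
theorem mem_of_hasEigenvalue_restrict (A : X →L[ℝ] X) {Λ : Set ℂ} {K : Submodule ℝ X}
    (hK : K ≤ spectralSubspace A Λ) {a : End ℝ K} (ha : ∀ x, (a x : X) = A x) {μ : ℂ}
    (hμ : HasEigenvalue (a.baseChange ℂ) μ) : μ ∈ Λ := by
  obtain ⟨w, hw⟩ := hμ.exists_hasEigenvector
  have hw' : HasEigenvector (complexify A) μ (K.subtype.baseChange ℂ w) :=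
    baseChange_hasEigenvector (f := K.subtype) K.injective_subtype ha hw
  have hmem : ∀ v : ℂ ⊗[ℝ] K, K.subtype.baseChange ℂ v ∈ complexSpectralSubspace A Λ := by
    intro v
    induction v with
    | zero => simp
    | add x y hx hy => rw [map_add]; exact add_mem hx hy
    | tmul z x =>
      have h1 := (complexSpectralSubspace A Λ).smul_mem z (mem_spectralSubspace.1 (hK x.2))
      rw [TensorProduct.smul_tmul', smul_eq_mul, mul_one] at h1
      exact h1
  by_contra hμΛ
  refine hw'.2 (Submodule.disjoint_def.1
    (disjoint_complexSpectralSubspace A (Set.disjoint_singleton_left.2 hμΛ)) _ ?_ (hmem w))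
  exact maxGenEigenspace_le (mem_singleton μ) (eigenspace_le_maxGenEigenspace hw'.1)

/-- Complex conjugation on the complexification. -/
def tensorConj (X : Type*) [AddCommGroup X] [Module ℝ X] :
    (ℂ ⊗[ℝ] X) →ₛₗ[starRingEnd ℂ] (ℂ ⊗[ℝ] X) where
  toFun := LinearMap.rTensor X Complex.conjAe.toLinearMap
  map_add' := map_add _
  map_smul' z w := by
    induction w with
    | zero => simp
    | add x y hx hy => simp only [smul_add, map_add, hx, hy]
    | tmul c x => simp [TensorProduct.smul_tmul']

theorem tensorConj_tmul (z : ℂ) (x : X) :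
    tensorConj X (z ⊗ₜ[ℝ] x) = (starRingEnd ℂ z) ⊗ₜ[ℝ] x := rfl

theorem tensorConj_complexify (A : X →L[ℝ] X) (w : ℂ ⊗[ℝ] X) :
    tensorConj X (complexify A w) = complexify A (tensorConj X w) := by
  induction w with
  | zero => simp
  | add x y hx hy => simp only [map_add, hx, hy]
  | tmul c x => rfl

theorem tensorConj_mem (A : X →L[ℝ] X) {Λ : Set ℂ}
    (hΛ : ∀ μ ∈ Λ, (starRingEnd ℂ) μ ∈ Λ) {w : ℂ ⊗[ℝ] X}
    (hw : w ∈ complexSpectralSubspace A Λ) : tensorConj X w ∈ complexSpectralSubspace A Λ := by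
  have h : complexSpectralSubspace A Λ ≤ (complexSpectralSubspace A Λ).comap (tensorConj X) := by
    refine iSup₂_le fun μ hμ w hw => ?_
    refine maxGenEigenspace_le (hΛ μ hμ) ?_
    rw [mem_maxGenEigenspace] at hw ⊢
    obtain ⟨k, hk⟩ := hw
    refine ⟨k, ?_⟩
    have hcomm : ∀ (j : ℕ) (v : ℂ ⊗[ℝ] X), tensorConj X (((complexify A - μ • 1) ^ j) v) =
        ((complexify A - (starRingEnd ℂ) μ • 1) ^ j) (tensorConj X v) := by
      intro j
      induction j with
      | zero => intro v; simp
      | succ j ih =>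
        intro v
        rw [pow_succ, pow_succ, Module.End.mul_apply, Module.End.mul_apply, ih]
        simp [tensorConj_complexify]
    rw [← hcomm, hk, map_zero]
  exact h hw

/-- The real part of an element of the complexification. -/
noncomputable def tensorRe (X : Type*) [AddCommGroup X] [Module ℝ X] : (ℂ ⊗[ℝ] X) →ₗ[ℝ] X :=
  (TensorProduct.lid ℝ X).toLinearMap ∘ₗ LinearMap.rTensor X Complex.reLm

theorem tensorRe_tmul (z : ℂ) (x : X) : tensorRe X (z ⊗ₜ[ℝ] x) = z.re • x := by
  simp [tensorRe]

theorem one_tmul_tensorRe (w : ℂ ⊗[ℝ] X) :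
    (1 : ℂ) ⊗ₜ[ℝ] tensorRe X w = (2⁻¹ : ℂ) • (w + tensorConj X w) := by
  induction w with
  | zero => simp
  | add x y hx hy =>
    simp only [map_add, TensorProduct.tmul_add, hx, hy]
    module
  | tmul z x =>
    rw [tensorRe_tmul, tensorConj_tmul, ← TensorProduct.add_tmul, TensorProduct.smul_tmul',
      TensorProduct.tmul_smul, TensorProduct.smul_tmul']
    congr 1
    apply Complex.ext <;> simp
    ring

theorem tensorRe_mem (A : X →L[ℝ] X) {Λ : Set ℂ}
    (hΛ : ∀ μ ∈ Λ, (starRingEnd ℂ) μ ∈ Λ) {w : ℂ ⊗[ℝ] X}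
    (hw : w ∈ complexSpectralSubspace A Λ) : tensorRe X w ∈ spectralSubspace A Λ := by
  rw [mem_spectralSubspace, one_tmul_tensorRe]
  exact Submodule.smul_mem _ _ (add_mem hw (tensorConj_mem A hΛ hw))

/-- The stable, centre and unstable spaces span. The complex generalised eigenspaces span the
complexification, and the real part of a vector in the span of those over a conjugation-invariant
set of eigenvalues stays in that span. -/
theorem exists_add_spectral [FiniteDimensional ℝ X] (A : X →L[ℝ] X) (x : X) :
    ∃ s ∈ stableSpace A, ∃ c ∈ centreSpace A, ∃ u ∈ unstableSpace A, x = s + c + u := by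
  have htop : complexSpectralSubspace A {μ | μ.re < 0} ⊔ complexSpectralSubspace A {μ | μ.re = 0} ⊔
      complexSpectralSubspace A {μ | 0 < μ.re} = ⊤ := by
    rw [eq_top_iff, ← iSup_maxGenEigenspace_eq_top (complexify A)]
    refine iSup_le fun μ => ?_
    rcases lt_trichotomy μ.re 0 with h | h | h
    · exact (maxGenEigenspace_le (Λ := {μ | μ.re < 0}) h).trans (le_sup_left.trans le_sup_left)
    · exact (maxGenEigenspace_le (Λ := {μ | μ.re = 0}) h).trans (le_sup_right.trans le_sup_left)
    · exact (maxGenEigenspace_le (Λ := {μ | 0 < μ.re}) h).trans le_sup_right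
  have hx : (1 : ℂ) ⊗ₜ[ℝ] x ∈ (⊤ : Submodule ℂ (ℂ ⊗[ℝ] X)) := Submodule.mem_top
  rw [← htop, Submodule.mem_sup] at hx
  obtain ⟨v, hv, wu, hwu, hx⟩ := hx
  obtain ⟨ws, hws, wc, hwc, rfl⟩ := Submodule.mem_sup.1 hv
  refine ⟨tensorRe X ws, tensorRe_mem A (by simp) hws, tensorRe X wc, tensorRe_mem A (by simp) hwc,
    tensorRe X wu, tensorRe_mem A (by simp) hwu, ?_⟩
  rw [← map_add, ← map_add, hx, tensorRe_tmul]
  simp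

end Spectral

/-! ### The splitting at the equilibrium -/

section Coordinates

open Module Module.End

variable {E : Type*} [NormedAddCommGroup E] [NormedSpace ℝ E]

/-- If `A` is block triangular with a hyperbolic block on `E × {0}` and `A` is not hyperbolic, then
its remaining diagonal entry vanishes. -/
theorem eq_zero_of_not_isHyperbolicMap {A : E × ℝ →L[ℝ] E × ℝ} {A₀ : E →L[ℝ] E} {c : ℝ}
    (hA₀ : ∀ v, A (v, 0) = (A₀ v, 0)) (hc : ∀ q, (A q).2 = c * q.2) (h₀ : IsHyperbolicMap A₀)
    (h : ¬ IsHyperbolicMap A) : c = 0 := by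
  unfold IsHyperbolicMap at h
  push Not at h
  obtain ⟨μ, hμ, hre⟩ := h
  obtain ⟨w, hw⟩ := hμ.exists_hasEigenvector
  by_contra hc0
  set s := (LinearMap.snd ℝ E ℝ).baseChange ℂ with hs
  set i := (LinearMap.inl ℝ E ℝ).baseChange ℂ with hi
  set p := (LinearMap.fst ℝ E ℝ).baseChange ℂ with hp
  have h1 : s (complexify A w) = (c : ℂ) • s w := by
    have := baseChange_intertwine (f := LinearMap.snd ℝ E ℝ) (a := (A : E × ℝ →ₗ[ℝ] E × ℝ))
      (b := c • (1 : End ℝ ℝ)) (fun x => by simpa using hc x) w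
    rw [LinearMap.baseChange_smul, LinearMap.baseChange_one] at this
    exact this
  rw [hw.apply_eq_smul, map_smul, ← sub_eq_zero, ← sub_smul, smul_eq_zero] at h1
  have hμc : μ - c ≠ 0 := by
    intro h2
    have := congrArg Complex.re h2
    simp [hre] at this
    exact hc0 this
  have hs0 : s w = 0 := h1.resolve_left hμc
  have hdecomp : w = i (p w) := by
    have h3 : (LinearMap.id : E × ℝ →ₗ[ℝ] E × ℝ) = LinearMap.inl ℝ E ℝ ∘ₗ LinearMap.fst ℝ E ℝ +
        LinearMap.inr ℝ E ℝ ∘ₗ LinearMap.snd ℝ E ℝ := by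
      ext x <;> simp
    have h4 := congrArg (fun f => LinearMap.baseChange ℂ f w) h3
    simp only [LinearMap.baseChange_id, LinearMap.baseChange_add, LinearMap.baseChange_comp,
      LinearMap.add_apply, LinearMap.comp_apply, LinearMap.id_apply] at h4
    rw [← hs, ← hi, ← hp, hs0, map_zero, add_zero] at h4
    exact h4
  have hinj : Function.Injective i :=
    baseChange_injective_of_injective (LinearMap.inl ℝ E ℝ) LinearMap.inl_injective
  have hint : i (complexify A₀ (p w)) = complexify A (i (p w)) :=
    baseChange_intertwine (f := LinearMap.inl ℝ E ℝ) (a := (A₀ : E →ₗ[ℝ] E))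
      (b := (A : E × ℝ →ₗ[ℝ] E × ℝ)) (fun x => (hA₀ x).symm) (p w)
  refine h₀ μ (hasEigenvalue_of_hasEigenvector (x := p w) ⟨mem_eigenspace_iff.2 ?_, ?_⟩) hre
  · apply hinj
    rw [hint, ← hdecomp, hw.apply_eq_smul, map_smul, ← hdecomp]
  · intro h5
    rw [h5, map_zero] at hdecomp
    exact hw.2 hdecomp

/-- If the last row of `A` vanishes, then generalised eigenvectors that belong to nonzero eigenvalues
have last component `0`. -/
theorem snd_eq_zero_of_mem_spectralSubspace {A : E × ℝ →L[ℝ] E × ℝ} (hA : ∀ q, (A q).2 = 0)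
    {Λ : Set ℂ} (hΛ : (0 : ℂ) ∉ Λ) {q : E × ℝ} (hq : q ∈ spectralSubspace A Λ) : q.2 = 0 := by
  set s := (LinearMap.snd ℝ E ℝ).baseChange ℂ with hs
  have hsA : ∀ w, s (complexify A w) = 0 := by
    intro w
    have := baseChange_intertwine (f := LinearMap.snd ℝ E ℝ) (a := (A : E × ℝ →ₗ[ℝ] E × ℝ))
      (b := (0 : End ℝ ℝ)) (fun x => by simpa using hA x) w
    rw [LinearMap.baseChange_zero] at this
    exact this
  have hpow : ∀ (μ : ℂ) (k : ℕ) w, s (((complexify A - μ • 1) ^ k) w) = (-μ) ^ k • s w := by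
    intro μ k
    induction k with
    | zero => intro w; simp
    | succ k ih =>
      intro w
      rw [pow_succ, Module.End.mul_apply, ih]
      simp [hsA, pow_succ, mul_smul]
  have hle : complexSpectralSubspace A Λ ≤ LinearMap.ker s := by
    refine iSup₂_le fun μ hμ w hw => ?_
    rw [mem_maxGenEigenspace] at hw
    obtain ⟨k, hk⟩ := hw
    have h1 := hpow μ k w
    rw [hk, map_zero, eq_comm, smul_eq_zero] at h1
    have hμ0 : μ ≠ 0 := fun h => hΛ (h ▸ hμ)
    exact h1.resolve_left (pow_ne_zero _ (neg_ne_zero.2 hμ0))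
  have h2 : s ((1 : ℂ) ⊗ₜ[ℝ] q) = 0 := hle (mem_spectralSubspace.1 hq)
  rw [hs, LinearMap.baseChange_tmul] at h2
  exact tmul_one_injective (V := ℝ) (by simpa using h2)

variable [FiniteDimensional ℝ E]

/-- The centre space meets the slice `E × {0}` only in `0`, since `A` is hyperbolic on that slice; so
it is at most one-dimensional. -/
theorem eq_zero_of_mem_centreSpace {A : E × ℝ →L[ℝ] E × ℝ} {A₀ : E →L[ℝ] E}
    (hA₀ : ∀ v, A (v, 0) = (A₀ v, 0)) (hA : ∀ q, (A q).2 = 0) (h₀ : IsHyperbolicMap A₀)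
    {q : E × ℝ} (hq : q ∈ centreSpace A) (hq2 : q.2 = 0) : q = 0 := by
  by_contra hq0
  let K : Submodule ℝ (E × ℝ) := centreSpace A ⊓ LinearMap.ker (LinearMap.snd ℝ E ℝ)
  have hAK : ∀ x ∈ K, (A : E × ℝ →ₗ[ℝ] E × ℝ) x ∈ K := fun x hx =>
    ⟨map_mem_spectralSubspace A hx.1, hA x⟩
  let a : End ℝ K := (A : E × ℝ →ₗ[ℝ] E × ℝ).restrict hAK
  have hKnt : Nontrivial K := ⟨⟨⟨q, hq, hq2⟩, 0, fun h => hq0 (congrArg Subtype.val h)⟩⟩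
  have : Nontrivial (ℂ ⊗[ℝ] K) := (tmul_one_injective (V := K)).nontrivial
  obtain ⟨μ, hμ⟩ := exists_eigenvalue (a.baseChange ℂ)
  have hre : μ ∈ {μ : ℂ | μ.re = 0} :=
    mem_of_hasEigenvalue_restrict A (K := K) inf_le_left (a := a) (fun x => rfl) hμ
  obtain ⟨w, hw⟩ := hμ.exists_hasEigenvector
  let f : K →ₗ[ℝ] E := LinearMap.fst ℝ E ℝ ∘ₗ K.subtype
  have hf : Function.Injective f := by
    rw [← LinearMap.ker_eq_bot, LinearMap.ker_eq_bot']
    rintro ⟨⟨v, t⟩, hx⟩ hv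
    have ht : t = 0 := hx.2
    have hv' : v = 0 := hv
    subst ht hv'
    rfl
  have hint : ∀ x, f (a x) = (A₀ : E →ₗ[ℝ] E) (f x) := by
    rintro ⟨⟨v, t⟩, hx⟩
    have ht : t = 0 := hx.2
    subst ht
    change (A (v, 0)).1 = A₀ v
    rw [hA₀]
  exact h₀ μ (hasEigenvalue_of_hasEigenvector (baseChange_hasEigenvector hf hint hw)) hre

/-- Coordinates `(y, z, σ)` adapted to the splitting of `E × ℝ` into the stable, unstable and centre
space, in Euclidean norms for which the two hyperbolic parts contract and expand. The centre
coordinate is the last component of `E × ℝ`. -/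
theorem exists_splitting_coordinates {A : E × ℝ →L[ℝ] E × ℝ} {A₀ : E →L[ℝ] E}
    (hA₀ : ∀ v, A (v, 0) = (A₀ v, 0)) (hA : ∀ q, (A q).2 = 0) (h₀ : IsHyperbolicMap A₀) :
    ∃ (k m : ℕ)
      (Θ : (EuclideanSpace ℝ (Fin k) × EuclideanSpace ℝ (Fin m) × ℝ) ≃L[ℝ] E × ℝ)
      (S : EuclideanSpace ℝ (Fin k) →L[ℝ] EuclideanSpace ℝ (Fin k))
      (T : EuclideanSpace ℝ (Fin m) →L[ℝ] EuclideanSpace ℝ (Fin m)) (l : ℝ), 0 < l ∧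
      (∀ y, inner ℝ (S y) y ≤ -l * ‖y‖ ^ 2) ∧ (∀ z, l * ‖z‖ ^ 2 ≤ inner ℝ (T z) z) ∧
      (∀ q, A (Θ q) = Θ (S q.1, T q.2.1, 0)) ∧ (∀ q, (Θ q).2 = q.2.2) ∧
      (∀ q, Θ q ∈ centreStableSpace A ↔ q.2.1 = 0) ∧
      (∀ q, Θ q ∈ unstableSpace A ↔ q.1 = 0 ∧ q.2.2 = 0) := by
  let as : End ℝ (stableSpace A) := (A : E × ℝ →ₗ[ℝ] E × ℝ).restrict
    (fun x hx => map_mem_spectralSubspace A hx)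
  let au : End ℝ (unstableSpace A) := (A : E × ℝ →ₗ[ℝ] E × ℝ).restrict
    (fun x hx => map_mem_spectralSubspace A hx)
  obtain ⟨k, es, ls, hls, hes⟩ := exists_adapted_coordinates as (fun μ hμ =>
    mem_of_hasEigenvalue_restrict (Λ := {μ | μ.re < 0}) A le_rfl (a := as) (fun x => rfl) hμ)
  obtain ⟨m, eu, lu, hlu, heu⟩ := exists_adapted_coordinates (-au) (fun μ hμ => by
    have hμ' : HasEigenvalue (au.baseChange ℂ) (-μ) := by
      obtain ⟨w, hw⟩ := hμ.exists_hasEigenvector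
      refine hasEigenvalue_of_hasEigenvector (x := w) ⟨mem_eigenspace_iff.2 ?_, hw.2⟩
      have := hw.apply_eq_smul
      rw [LinearMap.baseChange_neg, LinearMap.neg_apply] at this
      rw [neg_smul, ← this, neg_neg]
    have : -μ ∈ {μ : ℂ | 0 < μ.re} :=
      mem_of_hasEigenvalue_restrict A le_rfl (a := au) (fun x => rfl) hμ'
    simpa using this)
  have hs2 : ∀ x ∈ stableSpace A, x.2 = 0 := fun x hx =>
    snd_eq_zero_of_mem_spectralSubspace hA (by simp) hx
  have hu2 : ∀ x ∈ unstableSpace A, x.2 = 0 := fun x hx =>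
    snd_eq_zero_of_mem_spectralSubspace hA (by simp) hx
  obtain ⟨c₀, hc₀, hc₀2⟩ : ∃ c₀ ∈ centreSpace A, c₀.2 = 1 := by
    obtain ⟨s, hs, c, hc, u, hu, h⟩ := exists_add_spectral A ((0, 1) : E × ℝ)
    refine ⟨c, hc, ?_⟩
    have := congrArg Prod.snd h
    simpa [hs2 s hs, hu2 u hu] using this.symm
  have hcs : ∀ c ∈ centreSpace A, c = c.2 • c₀ := by
    intro c hc
    rw [← sub_eq_zero]
    exact eq_zero_of_mem_centreSpace hA₀ hA h₀ (sub_mem hc (Submodule.smul_mem _ _ hc₀))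
      (by simp [hc₀2])
  have hAc₀ : A c₀ = 0 :=
    eq_zero_of_mem_centreSpace hA₀ hA h₀ (map_mem_spectralSubspace A hc₀) (hA _)
  have hle : centreStableSpace A ≤ spectralSubspace A {μ | μ.re ≤ 0} :=
    sup_le (spectralSubspace_mono A fun μ (h : μ.re = 0) => h.le)
      (spectralSubspace_mono A fun μ (h : μ.re < 0) => h.le)
  have hdisj : ∀ x ∈ centreStableSpace A, x ∈ unstableSpace A → x = 0 := by
    intro x hx hx'
    refine Submodule.disjoint_def.1 (disjoint_spectralSubspace A ?_) x (hle hx) hx'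
    rw [Set.disjoint_left]
    exact fun μ (h : μ.re ≤ 0) (h' : 0 < μ.re) => absurd h (not_le.2 h')
  -- `c₀` spans the centre space
  let Θ₀ : (EuclideanSpace ℝ (Fin k) × EuclideanSpace ℝ (Fin m) × ℝ) →ₗ[ℝ] E × ℝ :=
    ((stableSpace A).subtype ∘ₗ es.symm.toLinearMap).coprod
      (((unstableSpace A).subtype ∘ₗ eu.symm.toLinearMap).coprod (LinearMap.toSpanSingleton ℝ _ c₀))
  have hΘ₀ : ∀ q, Θ₀ q = (es.symm q.1 : E × ℝ) + ((eu.symm q.2.1 : E × ℝ) + q.2.2 • c₀) :=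
    fun q => rfl
  have hΘ2 : ∀ q, (Θ₀ q).2 = q.2.2 := by
    intro q
    rw [hΘ₀]
    simp [hs2 _ (es.symm q.1).2, hu2 _ (eu.symm q.2.1).2, hc₀2]
  have hcsmem : ∀ y σ, Θ₀ (y, 0, σ) ∈ centreStableSpace A := by
    intro y σ
    rw [hΘ₀]
    refine add_mem (Submodule.mem_sup_right (es.symm y).2) ?_
    have h1 : σ • c₀ ∈ centreStableSpace A := Submodule.mem_sup_left (Submodule.smul_mem _ σ hc₀)
    simpa using h1
  have humem : ∀ z, Θ₀ (0, z, 0) ∈ unstableSpace A := by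
    intro z
    rw [hΘ₀]
    simp
  have hsplit : ∀ q, Θ₀ q = Θ₀ (q.1, 0, q.2.2) + Θ₀ (0, q.2.1, 0) := by
    intro q
    rw [← map_add]
    simp
  have hzinj : ∀ z, Θ₀ (0, z, 0) = 0 → z = 0 := by
    intro z hz
    rw [hΘ₀] at hz
    simpa using hz
  have hyinj : ∀ y σ, Θ₀ (y, 0, σ) = 0 → y = 0 ∧ σ = 0 := by
    intro y σ h
    have hσ : σ = 0 := by
      have := hΘ2 (y, 0, σ)
      rw [h] at this
      exact this.symm
    subst hσ
    rw [hΘ₀] at h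
    exact ⟨by simpa using h, rfl⟩
  have hcsiff : ∀ q, Θ₀ q ∈ centreStableSpace A ↔ q.2.1 = 0 := by
    intro q
    constructor
    · intro h
      refine hzinj _ (hdisj _ ?_ (humem _))
      have := sub_mem h (hcsmem q.1 q.2.2)
      rwa [hsplit q, add_sub_cancel_left] at this
    · intro h
      have := hcsmem q.1 q.2.2
      rwa [← h] at this
  have huiff : ∀ q, Θ₀ q ∈ unstableSpace A ↔ q.1 = 0 ∧ q.2.2 = 0 := by
    intro q
    constructor
    · intro h
      refine hyinj _ _ (hdisj _ (hcsmem _ _) ?_)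
      have := sub_mem h (humem q.2.1)
      rwa [hsplit q, add_sub_cancel_right] at this
    · rintro ⟨h1, h2⟩
      have := humem q.2.1
      rw [hsplit q, h1, h2]
      have h0 : Θ₀ (0, 0, 0) = 0 := map_zero Θ₀
      rwa [h0, zero_add]
  have hbij : Function.Bijective Θ₀ := by
    constructor
    · rw [← LinearMap.ker_eq_bot, LinearMap.ker_eq_bot']
      intro q hq
      have h1 := (hcsiff q).1 (hq ▸ zero_mem _)
      have h2 := (huiff q).1 (hq ▸ zero_mem _)
      exact Prod.ext h2.1 (Prod.ext h1 h2.2)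
    · intro x
      obtain ⟨s, hs, c, hc, u, hu, h⟩ := exists_add_spectral A x
      refine ⟨(es ⟨s, hs⟩, eu ⟨u, hu⟩, c.2), ?_⟩
      rw [hΘ₀, h]
      simp only [LinearEquiv.symm_apply_apply]
      rw [← hcs c hc]
      abel
  let Θ := (LinearEquiv.ofBijective Θ₀ hbij).toContinuousLinearEquiv
  have hΘ : ∀ q, Θ q = Θ₀ q := fun q => rfl
  refine ⟨k, m, Θ, LinearMap.toContinuousLinearMap (es.toLinearMap ∘ₗ as ∘ₗ es.symm.toLinearMap),
    LinearMap.toContinuousLinearMap (eu.toLinearMap ∘ₗ au ∘ₗ eu.symm.toLinearMap), min ls lu,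
    lt_min hls hlu, ?_, ?_, ?_, hΘ2, hcsiff, huiff⟩
  · intro y
    have h1 := hes (es.symm y)
    rw [LinearEquiv.apply_symm_apply] at h1
    refine h1.trans ?_
    have := min_le_left ls lu
    nlinarith [sq_nonneg ‖y‖]
  · intro z
    have h1 := heu (eu.symm z)
    rw [LinearMap.neg_apply, map_neg, inner_neg_left, LinearEquiv.apply_symm_apply] at h1
    have h2 : lu * ‖z‖ ^ 2 ≤ inner ℝ (eu (au (eu.symm z))) z := by linarith
    refine le_trans ?_ h2
    have := min_le_right ls lu
    gcongr
  · intro q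
    rw [hΘ, hΘ, hΘ₀, hΘ₀, map_add, map_add, map_smul, hAc₀]
    simp only [LinearMap.coe_toContinuousLinearMap', LinearMap.comp_apply, LinearEquiv.coe_coe,
      LinearEquiv.symm_apply_apply, smul_zero, zero_smul]
    rfl

end Coordinates

/-! ### Differential inequalities and linear equations with a dichotomy -/

section Energy

theorem sub_le_exp_mul_of_deriv_le {φ φ' : ℝ → ℝ} {a b k β : ℝ} (hab : a ≤ b)
    (h : ∀ t ∈ Icc a b, HasDerivWithinAt φ (φ' t) (Icc a b) t)
    (hle : ∀ t ∈ Icc a b, φ' t ≤ -k * (φ t - β)) :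
    φ b - β ≤ Real.exp (-k * (b - a)) * (φ a - β) := by
  have hderiv : ∀ t ∈ Icc a b, HasDerivWithinAt (fun t => Real.exp (k * t) * (φ t - β))
      (Real.exp (k * t) * (k * (φ t - β) + φ' t)) (Icc a b) t := by
    intro t ht
    have h1 : HasDerivWithinAt (fun t => Real.exp (k * t)) (Real.exp (k * t) * (k * 1)) (Icc a b) t :=
      (((hasDerivAt_id t).const_mul k).exp).hasDerivWithinAt
    exact (h1.mul ((h t ht).sub_const β)).congr_deriv (by ring)
  have hanti : AntitoneOn (fun t => Real.exp (k * t) * (φ t - β)) (Icc a b) := by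
    refine antitoneOn_of_hasDerivWithinAt_nonpos (convex_Icc a b)
      (fun t ht => (hderiv t ht).continuousWithinAt)
      (fun t ht => (hderiv t (interior_subset ht)).mono interior_subset) ?_
    intro t ht
    have := hle t (interior_subset ht)
    exact mul_nonpos_of_nonneg_of_nonpos (Real.exp_pos _).le (by linarith)
  have h1 := hanti (left_mem_Icc.2 hab) (right_mem_Icc.2 hab) hab
  simp only at h1
  have h2 : Real.exp (-k * (b - a)) = Real.exp (k * a) * Real.exp (-(k * b)) := by
    rw [← Real.exp_add]
    ring_nf
  have h3 : Real.exp (-(k * b)) * Real.exp (k * b) = 1 := by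
    rw [← Real.exp_add]
    simp
  calc φ b - β = Real.exp (-(k * b)) * (Real.exp (k * b) * (φ b - β)) := by
        rw [← mul_assoc, h3, one_mul]
    _ ≤ Real.exp (-(k * b)) * (Real.exp (k * a) * (φ a - β)) := by gcongr
    _ = _ := by rw [h2]; ring

theorem exp_mul_le_sub_of_le_deriv {φ φ' : ℝ → ℝ} {a b k β : ℝ} (hab : a ≤ b)
    (h : ∀ t ∈ Icc a b, HasDerivWithinAt φ (φ' t) (Icc a b) t)
    (hle : ∀ t ∈ Icc a b, k * (φ t - β) ≤ φ' t) :
    Real.exp (k * (b - a)) * (φ a - β) ≤ φ b - β := by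
  have := sub_le_exp_mul_of_deriv_le (φ := fun t => -φ t) (φ' := fun t => -φ' t) (k := -k)
    (β := -β) hab (fun t ht => (h t ht).neg) (fun t ht => by linarith [hle t ht])
  rw [neg_neg] at this
  linarith

/-- A quantity that grows exponentially and stays bounded above is not positive. -/
theorem nonpos_of_forall_exp_mul_le {a C k : ℝ} (hk : 0 < k)
    (h : ∀ T, 0 ≤ T → Real.exp (k * T) * a ≤ C) : a ≤ 0 := by
  by_contra! ha
  have h1 := h (|C| / (k * a)) (by positivity)
  have h2 := Real.add_one_le_exp (k * (|C| / (k * a)))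
  have h3 : k * (|C| / (k * a)) * a = |C| := by field_simp
  nlinarith [le_abs_self C]

end Energy

section LinearEquations

variable {Y : Type*} [NormedAddCommGroup Y] [NormedSpace ℝ Y] [CompleteSpace Y]

theorem exp_smul_mul_exp_smul (A : Y →L[ℝ] Y) (s t : ℝ) :
    NormedSpace.exp (s • A) * NormedSpace.exp (t • A) = NormedSpace.exp ((s + t) • A) := by
  let _ : NormedAlgebra ℚ (Y →L[ℝ] Y) := NormedAlgebra.restrictScalars ℚ ℝ _
  rw [add_smul, NormedSpace.exp_add_of_commute]
  exact ((Commute.refl A).smul_left s).smul_right t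

theorem continuous_exp_smul (A : Y →L[ℝ] Y) :
    Continuous fun t : ℝ => NormedSpace.exp (t • A) :=
  continuous_iff_continuousAt.2 fun t => (hasDerivAt_exp_smul_const A t).continuousAt

theorem continuous_exp_neg_smul_apply (A : Y →L[ℝ] Y) {a : ℝ → Y} (ha : Continuous a) :
    Continuous fun t : ℝ => NormedSpace.exp ((-t) • A) (a t) :=
  ((continuous_exp_smul A).comp continuous_neg).clm_apply ha

/-- Variation of constants. -/
theorem hasDerivAt_variation_of_constants (A : Y →L[ℝ] Y) {a : ℝ → Y} (ha : Continuous a) (y₀ : Y)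
    (t : ℝ) :
    HasDerivAt (fun t : ℝ => NormedSpace.exp (t • A)
        (y₀ + ∫ τ in (0 : ℝ)..t, NormedSpace.exp ((-τ) • A) (a τ)))
      (A (NormedSpace.exp (t • A) (y₀ + ∫ τ in (0 : ℝ)..t, NormedSpace.exp ((-τ) • A) (a τ)))
        + a t) t := by
  have hcont := continuous_exp_neg_smul_apply A ha
  have h1 : HasDerivAt (fun t : ℝ => y₀ + ∫ τ in (0 : ℝ)..t, NormedSpace.exp ((-τ) • A) (a τ))
      (NormedSpace.exp ((-t) • A) (a t)) t :=
    (intervalIntegral.integral_hasDerivAt_right (hcont.intervalIntegrable _ _)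
      hcont.aestronglyMeasurable.stronglyMeasurableAtFilter hcont.continuousAt).const_add y₀
  refine ((hasDerivAt_exp_smul_const' A t).clm_apply h1).congr_deriv ?_
  congr 1
  rw [← mul_apply_eq_comp, exp_smul_mul_exp_smul]
  simp [NormedSpace.exp_zero]

end LinearEquations

section Dichotomy

variable {Y : Type*} [NormedAddCommGroup Y] [InnerProductSpace ℝ Y]

/-- Bounds for forced solutions of a contracting linear equation. The second bound, for zero initial
value, is the one that makes the Lyapunov–Perron operator a contraction. -/
theorem norm_sq_le_of_contracting {A : Y →L[ℝ] Y} {l : ℝ} (hl : 0 < l)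
    (hA : ∀ y, inner ℝ (A y) y ≤ -l * ‖y‖ ^ 2) {y a : ℝ → Y} {M : ℝ}
    (hy : ∀ t, 0 ≤ t → HasDerivWithinAt y (A (y t) + a t) (Ici 0) t)
    (ha : ∀ t, 0 ≤ t → ‖a t‖ ≤ M) {t : ℝ} (ht : 0 ≤ t) :
    ‖y t‖ ^ 2 ≤ ‖y 0‖ ^ 2 + (M / l) ^ 2 ∧ (y 0 = 0 → ‖y t‖ ≤ M / l) := by
  have hM : 0 ≤ M := (norm_nonneg _).trans (ha 0 le_rfl)
  have key := sub_le_exp_mul_of_deriv_le (φ := fun t => ‖y t‖ ^ 2) (k := l) (β := (M / l) ^ 2) ht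
    (fun s hs => ((hy s hs.1).mono (fun r hr => hr.1)).norm_sq) (fun s hs => by
      rw [inner_add_right, real_inner_comm]
      have h1 := hA (y s)
      have h2 := (real_inner_le_norm (y s) (a s)).trans
        (mul_le_mul_of_nonneg_left (ha s hs.1) (norm_nonneg _))
      have h3 : l * (M / l) = M := by field_simp
      generalize M / l = d at h3 ⊢
      rw [← h3] at h2
      nlinarith [mul_nonneg hl.le (sq_nonneg (‖y s‖ - d))])
  have he1 : Real.exp (-l * (t - 0)) ≤ 1 := Real.exp_le_one_iff.2 (by nlinarith)
  have he0 := Real.exp_pos (-l * (t - 0))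
  constructor
  · nlinarith [sq_nonneg ‖y 0‖, sq_nonneg (M / l)]
  · intro h0
    rw [h0, norm_zero] at key
    have : ‖y t‖ ^ 2 ≤ (M / l) ^ 2 := by nlinarith [sq_nonneg (M / l)]
    exact le_of_sq_le_sq this (by positivity)

/-- A forced solution of an expanding linear equation is controlled by its forcing as soon as it is
bounded, whatever the bound. -/
theorem norm_le_of_expanding {B : Y →L[ℝ] Y} {l : ℝ} (hl : 0 < l)
    (hB : ∀ y, l * ‖y‖ ^ 2 ≤ inner ℝ (B y) y) {z b : ℝ → Y} {M C : ℝ}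
    (hz : ∀ t, 0 ≤ t → HasDerivWithinAt z (B (z t) + b t) (Ici 0) t)
    (hb : ∀ t, 0 ≤ t → ‖b t‖ ≤ M) (hC : ∀ t, 0 ≤ t → ‖z t‖ ≤ C) {t : ℝ} (ht : 0 ≤ t) :
    ‖z t‖ ≤ M / l := by
  have hM : 0 ≤ M := (norm_nonneg _).trans (hb 0 le_rfl)
  have key : ‖z t‖ ^ 2 - (M / l) ^ 2 ≤ 0 := by
    refine nonpos_of_forall_exp_mul_le hl (C := C ^ 2) fun T hT => ?_
    have h1 := exp_mul_le_sub_of_le_deriv (φ := fun t => ‖z t‖ ^ 2) (k := l) (β := (M / l) ^ 2)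
      (le_add_of_nonneg_right hT : t ≤ t + T)
      (fun s hs => ((hz s (ht.trans hs.1)).mono (fun r hr => ht.trans hr.1)).norm_sq)
      (fun s hs => by
        rw [inner_add_right, real_inner_comm]
        have h1 := hB (z s)
        have h2 := (abs_le.1 (abs_real_inner_le_norm (z s) (b s))).1
        have h4 := mul_le_mul_of_nonneg_left (hb s (ht.trans hs.1)) (norm_nonneg (z s))
        have h3 : l * (M / l) = M := by field_simp
        generalize M / l = d at h3 ⊢
        rw [← h3] at h4
        nlinarith [mul_nonneg hl.le (sq_nonneg (‖z s‖ - d))])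
    rw [add_sub_cancel_left] at h1
    have h2 : ‖z (t + T)‖ ^ 2 ≤ C ^ 2 := by
      have := hC (t + T) (by linarith)
      gcongr
    nlinarith [sq_nonneg (M / l)]
  exact le_of_sq_le_sq (by linarith) (by positivity)

variable [CompleteSpace Y]

theorem norm_exp_neg_smul_apply_le {B : Y →L[ℝ] Y} {l : ℝ}
    (hB : ∀ y, l * ‖y‖ ^ 2 ≤ inner ℝ (B y) y) {s : ℝ} (hs : 0 ≤ s) (x : Y) :
    ‖NormedSpace.exp ((-s) • B) x‖ ≤ Real.exp (-l * s) * ‖x‖ := by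
  have hd : ∀ t : ℝ, HasDerivAt (fun t : ℝ => NormedSpace.exp ((-t) • B) x)
      (-(B (NormedSpace.exp ((-t) • B) x))) t := by
    intro t
    have h1 := ((hasDerivAt_exp_smul_const' B (-t)).scomp t (hasDerivAt_neg t)).clm_apply
      (hasDerivAt_const t x)
    refine h1.congr_deriv ?_
    simp
  have key := sub_le_exp_mul_of_deriv_le (φ := fun t => ‖NormedSpace.exp ((-t) • B) x‖ ^ 2)
    (k := 2 * l) (β := 0) hs (fun t _ => (hd t).hasDerivWithinAt.norm_sq) (fun t _ => by
      rw [inner_neg_right, real_inner_comm]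
      linarith [hB (NormedSpace.exp ((-t) • B) x)])
  simp only [sub_zero, neg_zero, zero_smul, NormedSpace.exp_zero] at key
  have h2 : Real.exp (-(2 * l) * s) = Real.exp (-l * s) ^ 2 := by
    rw [← Real.exp_nat_mul]
    congr 1
    push_cast
    ring
  rw [h2, ← mul_pow] at key
  exact le_of_sq_le_sq key (by positivity)

/-- The inhomogeneous equation of an expanding linear map has a bounded solution for every bounded
forcing term. -/
theorem exists_bounded_solution_of_expanding {B : Y →L[ℝ] Y} {l : ℝ} (hl : 0 < l)
    (hB : ∀ y, l * ‖y‖ ^ 2 ≤ inner ℝ (B y) y) {b : ℝ → Y} (hb : Continuous b) {M : ℝ}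
    (hM : ∀ t, ‖b t‖ ≤ M) :
    ∃ z : ℝ → Y, (∀ t, HasDerivAt z (B (z t) + b t) t) ∧ ∃ C, ∀ t, 0 ≤ t → ‖z t‖ ≤ C := by
  have hcont := continuous_exp_neg_smul_apply B hb
  have hdom : ∀ c τ : ℝ, 0 ≤ c → c < τ → ‖NormedSpace.exp ((c - τ) • B) (b τ)‖ ≤
      M * Real.exp (l * c) * Real.exp (-l * τ) := by
    intro c τ hc hτ
    have h1 := norm_exp_neg_smul_apply_le hB (sub_nonneg.2 hτ.le) (b τ)
    rw [neg_sub] at h1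
    have h2 : Real.exp (-l * (τ - c)) = Real.exp (l * c) * Real.exp (-l * τ) := by
      rw [← Real.exp_add]
      ring_nf
    rw [h2] at h1
    have h3 : 0 ≤ Real.exp (l * c) * Real.exp (-l * τ) := by positivity
    nlinarith [hM τ]
  have hgint : ∀ c c' : ℝ, MeasureTheory.IntegrableOn
      (fun τ => M * Real.exp (l * c) * Real.exp (-l * τ)) (Ioi c') := fun c c' =>
    (integrableOn_exp_mul_Ioi (by linarith) c').const_mul _
  have hint0 : MeasureTheory.IntegrableOn (fun τ : ℝ => NormedSpace.exp ((-τ) • B) (b τ)) (Ioi 0) := by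
    refine MeasureTheory.Integrable.mono' (hgint 0 0) hcont.aestronglyMeasurable ?_
    refine (MeasureTheory.ae_restrict_iff' measurableSet_Ioi).2 (Eventually.of_forall fun τ hτ => ?_)
    have := hdom 0 τ le_rfl hτ
    rwa [zero_sub] at this
  set J := ∫ τ in Ioi (0 : ℝ), NormedSpace.exp ((-τ) • B) (b τ) with hJ
  -- the initial value `-J` is the only one for which the expanding part cancels at infinity
  refine ⟨_, hasDerivAt_variation_of_constants B hb (-J), M / l, fun t ht => ?_⟩
  have hint : MeasureTheory.IntegrableOn (fun τ : ℝ => NormedSpace.exp ((-τ) • B) (b τ)) (Ioi t) :=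
    hint0.mono_set (Ioi_subset_Ioi ht)
  have h1 : (-J + ∫ τ in (0 : ℝ)..t, NormedSpace.exp ((-τ) • B) (b τ)) =
      -∫ τ in Ioi t, NormedSpace.exp ((-τ) • B) (b τ) := by
    rw [hJ, ← intervalIntegral.integral_interval_add_Ioi hint0 hint]
    abel
  rw [h1, map_neg, norm_neg, ← ContinuousLinearMap.integral_comp_comm _ hint]
  have h2 : ∀ τ : ℝ, NormedSpace.exp (t • B) (NormedSpace.exp ((-τ) • B) (b τ)) =
      NormedSpace.exp ((t - τ) • B) (b τ) := by
    intro τ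
    rw [← mul_apply_eq_comp, exp_smul_mul_exp_smul, sub_eq_add_neg]
  simp only [h2]
  refine (MeasureTheory.norm_integral_le_of_norm_le (hgint t t)
    ((MeasureTheory.ae_restrict_iff' measurableSet_Ioi).2
      (Eventually.of_forall fun τ hτ => hdom t τ ht hτ))).trans ?_
  rw [MeasureTheory.integral_const_mul, integral_exp_mul_Ioi (by linarith)]
  have h3 : Real.exp (l * t) * Real.exp (-l * t) = 1 := by
    rw [← Real.exp_add]
    simp
  have h4 : M * Real.exp (l * t) * (-Real.exp (-l * t) / -l) =
      M / l * (Real.exp (l * t) * Real.exp (-l * t)) := by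
    field_simp
  rw [h4, h3, mul_one]

end Dichotomy

/-! ### Global existence and the Lyapunov–Perron method -/

section Existence

open scoped NNReal BoundedContinuousFunction

theorem norm_integral_le_of_norm_le_exp {Q : Type*} [NormedAddCommGroup Q] [NormedSpace ℝ Q]
    {a : ℝ → Q} {c μ t : ℝ} (hμ : 0 < μ) (hc : 0 ≤ c) (ht : 0 ≤ t)
    (ha : ∀ τ, 0 ≤ τ → ‖a τ‖ ≤ c * Real.exp (μ * τ)) :
    ‖∫ τ in (0 : ℝ)..t, a τ‖ ≤ c / μ * Real.exp (μ * t) := by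
  have hcont : Continuous fun τ : ℝ => c * Real.exp (μ * τ) := by fun_prop
  have h1 := intervalIntegral.norm_integral_le_of_norm_le ht (f := a) (g := fun τ => c * Real.exp (μ * τ))
    (μ := MeasureTheory.volume)
    (Eventually.of_forall fun τ hτ => ha τ hτ.1.le) (hcont.intervalIntegrable _ _)
  have h2 : ∫ τ in (0 : ℝ)..t, c * Real.exp (μ * τ) =
      c / μ * Real.exp (μ * t) - c / μ * Real.exp (μ * 0) := by
    refine intervalIntegral.integral_eq_sub_of_hasDerivAt
      (f := fun τ => c / μ * Real.exp (μ * τ)) (fun τ _ => ?_) (hcont.intervalIntegrable _ _)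
    have h3 := (((hasDerivAt_id τ).const_mul μ).exp).const_mul (c / μ)
    refine h3.congr_deriv ?_
    simp only [id]
    field_simp
  rw [h2] at h1
  have : 0 ≤ c / μ * Real.exp (μ * 0) := by positivity
  linarith

/-- A globally Lipschitz vector field has a forward solution for all times through every point. The
integral equation is solved by contraction in an exponentially weighted sup norm; the assumption
`v 0 = 0` makes the weighted norm of the iterates finite. -/
theorem exists_forward_solution_of_lipschitz {Q : Type*} [NormedAddCommGroup Q] [NormedSpace ℝ Q]
    [CompleteSpace Q] {v : Q → Q} {K : ℝ≥0} (hv : LipschitzWith K v) (hv0 : v 0 = 0) (q₀ : Q) :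
    ∃ q : ℝ → Q, q 0 = q₀ ∧ ∀ t, 0 ≤ t → HasDerivWithinAt q (v (q t)) (Ici 0) t := by
  -- with the weight `exp (-μ t)` the integral operator has Lipschitz constant `K / μ`
  set μ : ℝ := 2 * K + 1 with hμ
  have hK0 : (0 : ℝ) ≤ K := K.2
  have hμ0 : 0 < μ := by positivity
  have hKμ : (K : ℝ) / μ ≤ 1 / 2 := by
    rw [div_le_iff₀ hμ0]
    linarith
  let a : (ℝ≥0 →ᵇ Q) → ℝ → Q := fun φ τ => v (Real.exp (μ * τ) • φ τ.toNNReal)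
  have ha : ∀ φ, Continuous (a φ) := fun φ => hv.continuous.comp
    ((by fun_prop : Continuous fun τ : ℝ => Real.exp (μ * τ)).smul
      (φ.continuous.comp continuous_real_toNNReal))
  let q : (ℝ≥0 →ᵇ Q) → ℝ → Q := fun φ t => q₀ + ∫ τ in (0 : ℝ)..t, a φ τ
  have hq : ∀ φ t, HasDerivAt (q φ) (a φ t) t := fun φ t =>
    (intervalIntegral.integral_hasDerivAt_right ((ha φ).intervalIntegrable _ _)
      (ha φ).aestronglyMeasurable.stronglyMeasurableAtFilter (ha φ).continuousAt).const_add q₀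
  have hexp : ∀ t : ℝ, Real.exp (-(μ * t)) * Real.exp (μ * t) = 1 := by
    intro t
    rw [← Real.exp_add]
    simp
  have hdiff : ∀ φ ψ (t : ℝ), 0 ≤ t →
      ‖Real.exp (-(μ * t)) • (q φ t - q ψ t)‖ ≤ 1 / 2 * dist φ ψ := by
    intro φ ψ t ht
    have h1 : q φ t - q ψ t = ∫ τ in (0 : ℝ)..t, (a φ τ - a ψ τ) := by
      rw [intervalIntegral.integral_sub ((ha φ).intervalIntegrable _ _)
        ((ha ψ).intervalIntegrable _ _)]
      simp [q]
    have h2 := norm_integral_le_of_norm_le_exp (a := fun τ => a φ τ - a ψ τ)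
      (c := K * dist φ ψ) hμ0 (by positivity) ht (fun τ _ => by
        rw [← dist_eq_norm]
        refine (hv.dist_le_mul _ _).trans ?_
        rw [dist_smul₀, Real.norm_eq_abs, abs_of_pos (Real.exp_pos _)]
        have := BoundedContinuousFunction.dist_coe_le_dist (f := φ) (g := ψ) τ.toNNReal
        have h3 : 0 ≤ K * Real.exp (μ * τ) := by positivity
        nlinarith)
    rw [norm_smul, Real.norm_eq_abs, abs_of_pos (Real.exp_pos _), h1]
    calc Real.exp (-(μ * t)) * ‖∫ τ in (0 : ℝ)..t, (a φ τ - a ψ τ)‖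
        ≤ Real.exp (-(μ * t)) * (K * dist φ ψ / μ * Real.exp (μ * t)) := by gcongr
      _ = (Real.exp (-(μ * t)) * Real.exp (μ * t)) * (K / μ * dist φ ψ) := by ring
      _ ≤ 1 / 2 * dist φ ψ := by
        rw [hexp, one_mul]
        gcongr
  have hq0 : ∀ t, q 0 t = q₀ := by
    intro t
    simp [q, a, hv0]
  have hbound : ∀ φ (t : ℝ≥0), ‖Real.exp (-(μ * t)) • q φ t‖ ≤ ‖q₀‖ + 1 / 2 * dist φ 0 := by
    intro φ t
    have h1 := hdiff φ 0 t t.2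
    have h2 : Real.exp (-(μ * t)) • q φ t =
        Real.exp (-(μ * t)) • q₀ + Real.exp (-(μ * t)) • (q φ t - q 0 t) := by
      rw [hq0, ← smul_add]
      congr 1
      abel
    rw [h2]
    refine (norm_add_le _ _).trans (add_le_add ?_ h1)
    rw [norm_smul, Real.norm_eq_abs, abs_of_pos (Real.exp_pos _)]
    refine mul_le_of_le_one_left (norm_nonneg _) (Real.exp_le_one_iff.2 ?_)
    have : 0 ≤ μ * t := by positivity
    linarith
  let T : (ℝ≥0 →ᵇ Q) → (ℝ≥0 →ᵇ Q) := fun φ =>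
    BoundedContinuousFunction.ofNormedAddCommGroup (fun t : ℝ≥0 => Real.exp (-(μ * t)) • q φ t)
      ((by fun_prop : Continuous fun t : ℝ≥0 => Real.exp (-(μ * t))).smul
        ((continuous_iff_continuousAt.2 fun t => (hq φ t).continuousAt).comp
          NNReal.continuous_coe)) _ (hbound φ)
  have hT : ContractingWith (1 / 2) T := by
    refine ⟨by norm_num, LipschitzWith.of_dist_le_mul fun φ ψ => ?_⟩
    refine (BoundedContinuousFunction.dist_le (by positivity)).2 fun t => ?_
    have := hdiff φ ψ t t.2
    rw [smul_sub, ← dist_eq_norm] at this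
    have h1 : ∀ χ, T χ t = Real.exp (-(μ * t)) • q χ t := fun χ => rfl
    rw [h1, h1]
    simpa using this
  obtain ⟨φ, hφ⟩ : ∃ φ, T φ = φ := ⟨_, hT.fixedPoint_isFixedPt⟩
  refine ⟨q φ, by simp [q], fun t ht => ?_⟩
  refine (hq φ t).hasDerivWithinAt.congr_deriv ?_
  have h1 : φ t.toNNReal = Real.exp (-(μ * t)) • q φ t := by
    have := congrArg (fun f : ℝ≥0 →ᵇ Q => f t.toNNReal) hφ
    simp only [T, BoundedContinuousFunction.coe_ofNormedAddCommGroup,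
      Real.coe_toNNReal _ ht] at this
    exact this.symm
  change v (Real.exp (μ * t) • φ t.toNNReal) = v (q φ t)
  rw [h1, smul_smul, mul_comm, hexp, one_smul]

variable {Y Z : Type*} [NormedAddCommGroup Y] [InnerProductSpace ℝ Y] [CompleteSpace Y]
  [NormedAddCommGroup Z] [InnerProductSpace ℝ Z] [CompleteSpace Z]

/-- The Lyapunov–Perron method: a nonautonomous perturbation with small Lipschitz constant of a
linear system with an exponential dichotomy has a bounded forward solution with prescribed
initial value of the contracting component. -/
theorem exists_bounded_solution_of_dichotomy {A : Y →L[ℝ] Y} {B : Z →L[ℝ] Z} {l : ℝ} (hl : 0 < l)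
    (hA : ∀ y, inner ℝ (A y) y ≤ -l * ‖y‖ ^ 2) (hB : ∀ z, l * ‖z‖ ^ 2 ≤ inner ℝ (B z) z)
    {R : ℝ → Y × Z → Y × Z} (hR : Continuous (Function.uncurry R)) {K : ℝ≥0} (hKl : (K : ℝ) < l)
    (hRK : ∀ t, LipschitzWith K (R t)) {M : ℝ} (hM : ∀ t, ‖R t 0‖ ≤ M) (y₀ : Y) :
    ∃ q : ℝ → Y × Z, (q 0).1 = y₀ ∧
      (∀ t, 0 ≤ t → HasDerivWithinAt q
        (A (q t).1 + (R t (q t)).1, B (q t).2 + (R t (q t)).2) (Ici 0) t) ∧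
      ∃ C, ∀ t, 0 ≤ t → ‖q t‖ ≤ C := by
  let a : (ℝ≥0 →ᵇ Y × Z) → ℝ → Y × Z := fun φ τ => R τ (φ τ.toNNReal)
  have ha : ∀ φ, Continuous (a φ) := fun φ =>
    hR.comp (continuous_id.prodMk (φ.continuous.comp continuous_real_toNNReal))
  have habound : ∀ φ τ, ‖a φ τ‖ ≤ M + K * ‖φ‖ := by
    intro φ τ
    have h1 := (hRK τ).dist_le_mul (φ τ.toNNReal) 0
    rw [dist_eq_norm, dist_zero_right] at h1
    have h2 := φ.norm_coe_le_norm τ.toNNReal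
    have h3 : ‖R τ (φ τ.toNNReal)‖ ≤ ‖R τ (φ τ.toNNReal) - R τ 0‖ + ‖R τ 0‖ := by
      simpa using norm_add_le (R τ (φ τ.toNNReal) - R τ 0) (R τ 0)
    have h4 : (K : ℝ) * ‖φ τ.toNNReal‖ ≤ K * ‖φ‖ := by gcongr
    have := hM τ
    change ‖R τ (φ τ.toNNReal)‖ ≤ _
    linarith
  have hstep : ∀ φ : ℝ≥0 →ᵇ Y × Z, ∃ (y : ℝ → Y) (z : ℝ → Z) (ψ : ℝ≥0 →ᵇ Y × Z), y 0 = y₀ ∧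
      (∀ t, HasDerivAt y (A (y t) + (a φ t).1) t) ∧ (∀ t, HasDerivAt z (B (z t) + (a φ t).2) t) ∧
      ∀ t : ℝ≥0, ψ t = (y t, z t) := by
    intro φ
    set y : ℝ → Y := fun t => NormedSpace.exp (t • A)
        (y₀ + ∫ τ in (0 : ℝ)..t, NormedSpace.exp ((-τ) • A) (a φ τ).1) with hydef
    have hy : ∀ t, HasDerivAt y (A (y t) + (a φ t).1) t :=
      hasDerivAt_variation_of_constants A (continuous_fst.comp (ha φ)) y₀
    have hy0 : y 0 = y₀ := by simp [hydef, NormedSpace.exp_zero]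
    obtain ⟨z, hz, C, hC⟩ := exists_bounded_solution_of_expanding hl hB
      (continuous_snd.comp (ha φ)) (fun t => (norm_snd_le _).trans (habound φ t))
    have hyb : ∀ t, 0 ≤ t → ‖y t‖ ≤ ‖y₀‖ ^ 2 + ((M + K * ‖φ‖) / l) ^ 2 + 1 := by
      intro t ht
      have := (norm_sq_le_of_contracting hl hA (fun t _ => (hy t).hasDerivWithinAt)
        (fun t _ => (norm_fst_le _).trans (habound φ t)) ht).1
      rw [hy0] at this
      nlinarith [sq_nonneg (‖y t‖ - 1)]
    refine ⟨y, z, BoundedContinuousFunction.ofNormedAddCommGroup (fun t : ℝ≥0 => (y t, z t))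
      (((continuous_iff_continuousAt.2 fun t => (hy t).continuousAt).comp NNReal.continuous_coe).prodMk
        ((continuous_iff_continuousAt.2 fun t => (hz t).continuousAt).comp NNReal.continuous_coe))
      (max (‖y₀‖ ^ 2 + ((M + K * ‖φ‖) / l) ^ 2 + 1) C) fun t => ?_, hy0, hy, hz, fun t => rfl⟩
    exact max_le_max (hyb t t.2) (hC t t.2)
  choose y z T hy0 hy hz hT using hstep
  have hzb : ∀ φ t, 0 ≤ t → ‖z φ t‖ ≤ ‖T φ‖ := by
    intro φ t ht
    have h1 := (T φ).norm_coe_le_norm t.toNNReal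
    rw [hT, Real.coe_toNNReal _ ht] at h1
    exact (norm_snd_le _).trans h1
  have hdist : ∀ φ ψ τ, ‖a φ τ - a ψ τ‖ ≤ K * dist φ ψ := by
    intro φ ψ τ
    rw [← dist_eq_norm]
    refine ((hRK τ).dist_le_mul _ _).trans ?_
    gcongr
    exact BoundedContinuousFunction.dist_coe_le_dist _
  have hcontr : ContractingWith (K / l.toNNReal) T := by
    have hl' : 0 < l.toNNReal := Real.toNNReal_pos.2 hl
    refine ⟨?_, LipschitzWith.of_dist_le_mul fun φ ψ => ?_⟩
    · rw [div_lt_one hl']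
      exact NNReal.coe_lt_coe.1 (by rwa [Real.coe_toNNReal _ hl.le])
    · rw [NNReal.coe_div, Real.coe_toNNReal _ hl.le, div_mul_eq_mul_div]
      refine (BoundedContinuousFunction.dist_le (by positivity)).2 fun t => ?_
      rw [hT, hT, Prod.dist_eq, dist_eq_norm, dist_eq_norm]
      refine max_le ?_ ?_
      · refine (norm_sq_le_of_contracting hl hA (y := fun t => y φ t - y ψ t)
          (a := fun t => (a φ t).1 - (a ψ t).1) (fun t _ => ?_)
          (fun t _ => (norm_fst_le (a φ t - a ψ t)).trans (hdist φ ψ t)) t.2).2 ?_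
        · refine ((hy φ t).sub (hy ψ t)).hasDerivWithinAt.congr_deriv ?_
          rw [map_sub]
          abel
        · simp [hy0]
      · refine norm_le_of_expanding hl hB (z := fun t => z φ t - z ψ t)
          (b := fun t => (a φ t).2 - (a ψ t).2) (C := ‖T φ‖ + ‖T ψ‖) (fun t _ => ?_)
          (fun t _ => (norm_snd_le (a φ t - a ψ t)).trans (hdist φ ψ t)) (fun t ht => ?_) t.2
        · refine ((hz φ t).sub (hz ψ t)).hasDerivWithinAt.congr_deriv ?_
          rw [map_sub]
          abel
        · exact (norm_sub_le _ _).trans (add_le_add (hzb φ t ht) (hzb ψ t ht))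
  obtain ⟨φ, hφ⟩ : ∃ φ, T φ = φ := ⟨_, hcontr.fixedPoint_isFixedPt⟩
  have hval : ∀ t, 0 ≤ t → φ t.toNNReal = (y φ t, z φ t) := by
    intro t ht
    have := hT φ t.toNNReal
    rwa [hφ, Real.coe_toNNReal _ ht] at this
  refine ⟨fun t => (y φ t, z φ t), hy0 φ, fun t ht => ?_, ‖φ‖, fun t ht => ?_⟩
  · have := ((hy φ t).hasDerivWithinAt (s := Ici 0)).prodMk ((hz φ t).hasDerivWithinAt (s := Ici 0))
    have ha' : a φ t = R t (y φ t, z φ t) := by rw [← hval t ht]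
    rwa [ha'] at this
  · have := φ.norm_coe_le_norm t.toNNReal
    rwa [hval t ht] at this

end Existence

/-! ### The model system and its cone estimates -/

section Products

variable {Y Z : Type*} [NormedAddCommGroup Y] [NormedAddCommGroup Z]

theorem _root_.HasDerivWithinAt.prod_fst [NormedSpace ℝ Y] [NormedSpace ℝ Z] {f : ℝ → Y × Z}
    {f' : Y × Z} {s : Set ℝ} {t : ℝ} (h : HasDerivWithinAt f f' s t) :
    HasDerivWithinAt (fun t => (f t).1) f'.1 s t :=
  (ContinuousLinearMap.fst ℝ Y Z).hasFDerivAt.comp_hasDerivWithinAt t h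

theorem _root_.HasDerivWithinAt.prod_snd [NormedSpace ℝ Y] [NormedSpace ℝ Z] {f : ℝ → Y × Z}
    {f' : Y × Z} {s : Set ℝ} {t : ℝ} (h : HasDerivWithinAt f f' s t) :
    HasDerivWithinAt (fun t => (f t).2) f'.2 s t :=
  (ContinuousLinearMap.snd ℝ Y Z).hasFDerivAt.comp_hasDerivWithinAt t h

theorem norm_sq_le_sum (q : Y × Z × ℝ) : ‖q‖ ^ 2 ≤ ‖q.1‖ ^ 2 + ‖q.2.1‖ ^ 2 + q.2.2 ^ 2 := by
  have h : ‖q‖ = max ‖q.1‖ (max ‖q.2.1‖ |q.2.2|) := rfl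
  rw [h]
  have h3 := sq_abs q.2.2
  rcases max_choice ‖q.1‖ (max ‖q.2.1‖ |q.2.2|) with h1 | h1 <;> rw [h1]
  · nlinarith [sq_nonneg ‖q.2.1‖, sq_nonneg q.2.2]
  · rcases max_choice ‖q.2.1‖ |q.2.2| with h2 | h2 <;> rw [h2]
    · nlinarith [sq_nonneg ‖q.1‖, sq_nonneg q.2.2]
    · nlinarith [sq_nonneg ‖q.1‖, sq_nonneg ‖q.2.1‖]

theorem norm_mid_le (q : Y × Z × ℝ) : ‖q.2.1‖ ≤ ‖q‖ := (norm_fst_le q.2).trans (norm_snd_le q)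

theorem abs_last_le (q : Y × Z × ℝ) : |q.2.2| ≤ ‖q‖ := (norm_snd_le q.2).trans (norm_snd_le q)

/-- The box of size `δ` about `0`, intersected with the half-space `σ ≤ 0`, which is where the phase
space lies: the boundary face `σ = 0` belongs to it, the other faces do not. -/
def halfBox (Y Z : Type*) [NormedAddCommGroup Y] [NormedAddCommGroup Z] (δ : ℝ) :
    Set (Y × Z × ℝ) :=
  {q | ‖q.1‖ < δ ∧ ‖q.2.1‖ < δ ∧ -δ < q.2.2 ∧ q.2.2 ≤ 0}

theorem norm_le_of_mem_halfBox {δ : ℝ} {q : Y × Z × ℝ} (hq : q ∈ halfBox Y Z δ) : ‖q‖ ≤ δ := by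
  refine max_le hq.1.le (max_le hq.2.1.le ?_)
  rw [Real.norm_eq_abs, abs_of_nonpos hq.2.2.2]
  linarith [hq.2.2.1]

end Products

section Model

open scoped NNReal

variable {Y Z : Type*} [NormedAddCommGroup Y] [InnerProductSpace ℝ Y]
  [NormedAddCommGroup Z] [InnerProductSpace ℝ Z]

/-- The vector field `(y, z, σ) ↦ (A y + ρ₁, B z + ρ₂, γ σ)` with a linear part that has a stable
component `y`, an unstable component `z` and a one-dimensional centre component `σ`. -/
def modelField (A : Y →L[ℝ] Y) (B : Z →L[ℝ] Z) (ρ : Y × Z × ℝ → Y × Z) (γ : ℝ → ℝ)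
    (q : Y × Z × ℝ) : Y × Z × ℝ :=
  (A q.1 + (ρ q).1, B q.2.1 + (ρ q).2, γ q.2.2)

/-- The standing assumptions on the model field: a spectral gap `l` in the adapted norms, a
perturbation with Lipschitz constant `ε` small compared to `l`, and a decoupled centre equation for
which `0` attracts all `σ < 0`. They hold globally and not just in a box, so that solutions exist for
all time; the values `γ σ = 0` for `σ ≥ 0` are a choice made for that purpose. -/
structure IsSaddleModel (A : Y →L[ℝ] Y) (B : Z →L[ℝ] Z) (ρ : Y × Z × ℝ → Y × Z) (γ : ℝ → ℝ)
    (l ε : ℝ) : Prop where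
  gap_pos : 0 < l
  inner_le : ∀ y, inner ℝ (A y) y ≤ -l * ‖y‖ ^ 2
  le_inner : ∀ z, l * ‖z‖ ^ 2 ≤ inner ℝ (B z) z
  eps_nonneg : 0 ≤ ε
  eps_le : 24 * ε ≤ l
  norm_sub_le : ∀ p q, ‖ρ p - ρ q‖ ≤ ε * ‖p - q‖
  map_zero : ρ 0 = 0
  abs_sub_le : ∀ s t, |γ s - γ t| ≤ ε * |s - t|
  eq_zero : ∀ s, 0 ≤ s → γ s = 0
  pos : ∀ s, s < 0 → 0 < γ s

/-- `q` is a forward solution, on `[0, ∞)`, of the vector field `v`. -/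
def IsForwardSolution {Q : Type*} [NormedAddCommGroup Q] [NormedSpace ℝ Q] (v : Q → Q)
    (q : ℝ → Q) : Prop :=
  ∀ t, 0 ≤ t → HasDerivWithinAt q (v (q t)) (Ici 0) t

theorem IsForwardSolution.continuousOn {Q : Type*} [NormedAddCommGroup Q] [NormedSpace ℝ Q]
    {v : Q → Q} {q : ℝ → Q} (h : IsForwardSolution v q) : ContinuousOn q (Ici 0) :=
  fun t ht => (h t ht).continuousWithinAt

/-- The indefinite quadratic form of the cone with slope `κ` about the unstable directions. -/
def coneForm (κ : ℝ) (q : Y × Z × ℝ) : ℝ := ‖q.2.1‖ ^ 2 - κ ^ 2 * (‖q.1‖ ^ 2 + q.2.2 ^ 2)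

variable {A : Y →L[ℝ] Y} {B : Z →L[ℝ] Z} {ρ : Y × Z × ℝ → Y × Z} {γ : ℝ → ℝ} {l ε : ℝ}

/-- Along the difference of two solutions the cone form grows exponentially. -/
theorem IsSaddleModel.exp_mul_coneForm_le (h : IsSaddleModel A B ρ γ l ε) {q₁ q₂ : ℝ → Y × Z × ℝ}
    (h₁ : IsForwardSolution (modelField A B ρ γ) q₁)
    (h₂ : IsForwardSolution (modelField A B ρ γ) q₂) {κ ε' a b : ℝ} (hκ : κ ^ 2 ≤ 1)
    (hε' : 6 * ε' ≤ l * κ ^ 2) (ha : 0 ≤ a) (hab : a ≤ b)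
    (hρ : ∀ t ∈ Icc a b, ‖ρ (q₁ t) - ρ (q₂ t)‖ ≤ ε' * ‖q₁ t - q₂ t‖)
    (hγ : ∀ t ∈ Icc a b, |γ (q₁ t).2.2 - γ (q₂ t).2.2| ≤ ε' * ‖q₁ t - q₂ t‖) :
    Real.exp (l * (b - a)) * coneForm κ (q₁ a - q₂ a) ≤ coneForm κ (q₁ b - q₂ b) := by
  have hd : ∀ t ∈ Icc a b, HasDerivWithinAt (fun t => q₁ t - q₂ t)
      (modelField A B ρ γ (q₁ t) - modelField A B ρ γ (q₂ t)) (Icc a b) t := fun t ht =>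
    ((h₁ t (ha.trans ht.1)).sub (h₂ t (ha.trans ht.1))).mono (fun s hs => ha.trans hs.1)
  have key := exp_mul_le_sub_of_le_deriv (φ := fun t => coneForm κ (q₁ t - q₂ t)) (k := l) (β := 0)
    hab (fun t ht => ((hd t ht).prod_snd.prod_fst.norm_sq).sub
      (((hd t ht).prod_fst.norm_sq.add ((hd t ht).prod_snd.prod_snd.pow 2)).const_mul (κ ^ 2))) ?_
  · simpa using key
  intro t ht
  have hρt := hρ t ht
  have hγt := hγ t ht
  set D := q₁ t - q₂ t with hD
  have e1 : (modelField A B ρ γ (q₁ t) - modelField A B ρ γ (q₂ t)).1 =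
      A D.1 + (ρ (q₁ t) - ρ (q₂ t)).1 := by
    simp only [modelField, hD, Prod.fst_sub, map_sub]
    abel
  have e2 : (modelField A B ρ γ (q₁ t) - modelField A B ρ γ (q₂ t)).2.1 =
      B D.2.1 + (ρ (q₁ t) - ρ (q₂ t)).2 := by
    simp only [modelField, hD, Prod.fst_sub, Prod.snd_sub, map_sub]
    abel
  have e3 : (modelField A B ρ γ (q₁ t) - modelField A B ρ γ (q₂ t)).2.2 =
      γ (q₁ t).2.2 - γ (q₂ t).2.2 := rfl
  simp only [e1, e2, e3]
  set r := ρ (q₁ t) - ρ (q₂ t) with hr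
  set g := γ (q₁ t).2.2 - γ (q₂ t).2.2 with hg
  rw [inner_add_right, inner_add_right, real_inner_comm _ D.2.1, real_inner_comm _ D.1]
  have hm0 : 0 ≤ ‖D‖ := norm_nonneg D
  have b1 := h.le_inner D.2.1
  have b2 := h.inner_le D.1
  have b3 : -(ε' * ‖D‖ ^ 2) ≤ inner ℝ D.2.1 r.2 := by
    have c1 := (abs_le.1 (abs_real_inner_le_norm D.2.1 r.2)).1
    have c2 : ‖D.2.1‖ * ‖r.2‖ ≤ ‖D‖ * (ε' * ‖D‖) :=
      mul_le_mul (norm_mid_le D) ((norm_snd_le r).trans hρt) (norm_nonneg _) hm0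
    nlinarith
  have b4 : inner ℝ D.1 r.1 ≤ ε' * ‖D‖ ^ 2 := by
    have c1 := real_inner_le_norm D.1 r.1
    have c2 : ‖D.1‖ * ‖r.1‖ ≤ ‖D‖ * (ε' * ‖D‖) :=
      mul_le_mul (norm_fst_le D) ((norm_fst_le r).trans hρt) (norm_nonneg _) hm0
    nlinarith
  have b5 : D.2.2 * g ≤ ε' * ‖D‖ ^ 2 := by
    have c1 : D.2.2 * g ≤ |D.2.2| * |g| := by rw [← abs_mul]; exact le_abs_self _
    have c2 : |D.2.2| * |g| ≤ ‖D‖ * (ε' * ‖D‖) :=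
      mul_le_mul (abs_last_le D) hγt (abs_nonneg _) hm0
    nlinarith
  have b6 := norm_sq_le_sum D
  have hl := h.gap_pos
  have hκ0 : 0 ≤ κ ^ 2 := sq_nonneg κ
  have hκ4 : κ ^ 2 * (inner ℝ (A D.1) D.1 + inner ℝ D.1 r.1 + D.2.2 * g) ≤
      κ ^ 2 * (-l * ‖D.1‖ ^ 2 + 2 * (ε' * ‖D‖ ^ 2)) :=
    mul_le_mul_of_nonneg_left (by linarith) hκ0
  have hεm : 6 * (ε' * ‖D‖ ^ 2) ≤ l * κ ^ 2 * (‖D.1‖ ^ 2 + ‖D.2.1‖ ^ 2 + D.2.2 ^ 2) := by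
    calc 6 * (ε' * ‖D‖ ^ 2) = (6 * ε') * ‖D‖ ^ 2 := by ring
      _ ≤ (l * κ ^ 2) * ‖D‖ ^ 2 := by gcongr
      _ ≤ _ := by gcongr
  have hε0 : 0 ≤ ε' * ‖D‖ ^ 2 := by
    have := (norm_nonneg _).trans hρt
    nlinarith
  have hlκ : κ ^ 2 * (ε' * ‖D‖ ^ 2) ≤ ε' * ‖D‖ ^ 2 := mul_le_of_le_one_left hε0 hκ
  have hlb : l * κ ^ 2 * ‖D.2.1‖ ^ 2 ≤ l * ‖D.2.1‖ ^ 2 := by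
    have : l * κ ^ 2 ≤ l * 1 := by gcongr
    nlinarith [sq_nonneg ‖D.2.1‖]
  have hla : 0 ≤ l * κ ^ 2 * ‖D.1‖ ^ 2 := by positivity
  simp only [coneForm]
  norm_num
  nlinarith

/-- If the unstable components of two forward solutions stay close, then the cone form of their
difference, which would grow exponentially where it is positive, is never positive. -/
theorem IsSaddleModel.coneForm_nonpos (h : IsSaddleModel A B ρ γ l ε) {q₁ q₂ : ℝ → Y × Z × ℝ}
    (h₁ : IsForwardSolution (modelField A B ρ γ) q₁)
    (h₂ : IsForwardSolution (modelField A B ρ γ) q₂) {κ ε' C t : ℝ} (hκ : κ ^ 2 ≤ 1)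
    (hε' : 6 * ε' ≤ l * κ ^ 2)
    (hρ : ∀ t, 0 ≤ t → ‖ρ (q₁ t) - ρ (q₂ t)‖ ≤ ε' * ‖q₁ t - q₂ t‖)
    (hγ : ∀ t, 0 ≤ t → |γ (q₁ t).2.2 - γ (q₂ t).2.2| ≤ ε' * ‖q₁ t - q₂ t‖)
    (hC : ∀ t, 0 ≤ t → ‖(q₁ t).2.1 - (q₂ t).2.1‖ ≤ C) (ht : 0 ≤ t) :
    coneForm κ (q₁ t - q₂ t) ≤ 0 := by
  refine nonpos_of_forall_exp_mul_le h.gap_pos (C := C ^ 2) fun T hT => ?_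
  have h1 := h.exp_mul_coneForm_le h₁ h₂ hκ hε' ht (le_add_of_nonneg_right hT : t ≤ t + T)
    (fun s hs => hρ s (ht.trans hs.1)) (fun s hs => hγ s (ht.trans hs.1))
  rw [add_sub_cancel_left] at h1
  refine h1.trans ?_
  have h2 : ‖(q₁ (t + T) - q₂ (t + T)).2.1‖ ^ 2 ≤ C ^ 2 := by
    have := hC (t + T) (by linarith)
    exact pow_le_pow_left₀ (norm_nonneg _) this 2
  have h3 : 0 ≤ κ ^ 2 * (‖(q₁ (t + T) - q₂ (t + T)).1‖ ^ 2 + (q₁ (t + T) - q₂ (t + T)).2.2 ^ 2) := by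
    positivity
  simp only [coneForm]
  linarith

theorem IsSaddleModel.abs_sub_le_norm (h : IsSaddleModel A B ρ γ l ε) (p q : Y × Z × ℝ) :
    |γ p.2.2 - γ q.2.2| ≤ ε * ‖p - q‖ :=
  (h.abs_sub_le _ _).trans (mul_le_mul_of_nonneg_left (abs_last_le (p - q)) h.eps_nonneg)

theorem IsSaddleModel.modelField_zero (h : IsSaddleModel A B ρ γ l ε) :
    modelField A B ρ γ 0 = 0 := by
  simp [modelField, h.map_zero, h.eq_zero]

theorem IsSaddleModel.isForwardSolution_zero (h : IsSaddleModel A B ρ γ l ε) :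
    IsForwardSolution (modelField A B ρ γ) (fun _ => 0) := by
  intro t _
  rw [h.modelField_zero]
  exact hasDerivWithinAt_const t (Ici 0) (0 : Y × Z × ℝ)

/-- Two forward solutions whose unstable components stay close differ mostly in the centre-stable
directions. -/
theorem IsSaddleModel.norm_sq_sub_le (h : IsSaddleModel A B ρ γ l ε) {q₁ q₂ : ℝ → Y × Z × ℝ}
    (h₁ : IsForwardSolution (modelField A B ρ γ) q₁)
    (h₂ : IsForwardSolution (modelField A B ρ γ) q₂) {C t : ℝ}
    (hC : ∀ t, 0 ≤ t → ‖(q₁ t).2.1 - (q₂ t).2.1‖ ≤ C) (ht : 0 ≤ t) :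
    4 * ‖(q₁ t).2.1 - (q₂ t).2.1‖ ^ 2 ≤
      ‖(q₁ t).1 - (q₂ t).1‖ ^ 2 + ((q₁ t).2.2 - (q₂ t).2.2) ^ 2 := by
  have := h.coneForm_nonpos h₁ h₂ (κ := 1 / 2) (ε' := ε) (by norm_num) (by linarith [h.eps_le])
    (fun t _ => h.norm_sub_le _ _) (fun t _ => h.abs_sub_le_norm _ _) hC ht
  simp only [coneForm, Prod.fst_sub, Prod.snd_sub] at this
  linarith

theorem IsSaddleModel.unstable_le (h : IsSaddleModel A B ρ γ l ε) {q : ℝ → Y × Z × ℝ}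
    (hq : IsForwardSolution (modelField A B ρ γ) q) {C t : ℝ}
    (hC : ∀ t, 0 ≤ t → ‖(q t).2.1‖ ≤ C) (ht : 0 ≤ t) :
    4 * ‖(q t).2.1‖ ^ 2 ≤ ‖(q t).1‖ ^ 2 + (q t).2.2 ^ 2 := by
  simpa using h.norm_sq_sub_le hq h.isForwardSolution_zero (C := C) (by simpa using hC) ht

theorem IsSaddleModel.gamma_nonneg (h : IsSaddleModel A B ρ γ l ε) (s : ℝ) : 0 ≤ γ s := by
  rcases lt_or_ge s 0 with hs | hs
  · exact (h.pos s hs).le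
  · exact (h.eq_zero s hs).ge

theorem IsSaddleModel.centre_monotoneOn (h : IsSaddleModel A B ρ γ l ε) {q : ℝ → Y × Z × ℝ}
    (hq : IsForwardSolution (modelField A B ρ γ) q) :
    MonotoneOn (fun t => (q t).2.2) (Ici 0) :=
  monotoneOn_of_hasDerivWithinAt_nonneg (convex_Ici 0)
    (fun t ht => (hq t ht).prod_snd.prod_snd.continuousWithinAt)
    (fun t ht => (hq t (interior_subset ht)).prod_snd.prod_snd.mono interior_subset)
    (fun _ _ => h.gamma_nonneg _)

theorem IsSaddleModel.centre_nonpos (h : IsSaddleModel A B ρ γ l ε) {q : ℝ → Y × Z × ℝ}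
    (hq : IsForwardSolution (modelField A B ρ γ) q) (h0 : (q 0).2.2 ≤ 0) {t : ℝ} (ht : 0 ≤ t) :
    (q t).2.2 ≤ 0 := by
  -- `γ` vanishes along the strictly increasing barriers `η (1 + s)`, so they cannot be crossed
  have hb : ∀ η : ℝ, 0 < η → (q t).2.2 ≤ η * (1 + t) := by
    intro η hη
    refine image_le_of_deriv_right_lt_deriv_boundary' (f := fun t => (q t).2.2)
      (f' := fun t => γ (q t).2.2) (B := fun t => η * (1 + t)) (B' := fun _ => η) (a := 0) (b := t)
      (fun s hs => (hq s hs.1).prod_snd.prod_snd.continuousWithinAt.mono (fun r hr => hr.1))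
      (fun s hs => (hq s hs.1).prod_snd.prod_snd.mono (fun r hr => hs.1.trans hr)) ?_ (by fun_prop)
      (fun s _ => ?_) (fun s hs heq => ?_) ⟨ht, le_rfl⟩
    · have : (q 0).2.2 ≤ η * (1 + 0) := by linarith
      exact this
    · exact ((((hasDerivAt_id s).const_add 1).const_mul η).congr_deriv (mul_one η)).hasDerivWithinAt
    · have : 0 ≤ η * (1 + s) := mul_nonneg hη.le (by linarith [hs.1])
      rw [heq, h.eq_zero _ this]
      exact hη
  by_contra! hpos
  have h1 := hb ((q t).2.2 / (2 * (1 + t))) (by positivity)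
  have h2 : (q t).2.2 / (2 * (1 + t)) * (1 + t) = (q t).2.2 / 2 := by
    have : 1 + t ≠ 0 := by linarith
    field_simp
  linarith

/-- Decay of the stable component while the other components are under control. -/
theorem IsSaddleModel.stable_sub_le (h : IsSaddleModel A B ρ γ l ε) {q : ℝ → Y × Z × ℝ}
    (hq : IsForwardSolution (modelField A B ρ γ) q) {a b d : ℝ} (ha : 0 ≤ a) (hab : a ≤ b)
    (hσ : ∀ t ∈ Icc a b, (q t).2.2 ^ 2 ≤ d ^ 2)
    (hz : ∀ t ∈ Icc a b, ‖(q t).2.1‖ ^ 2 ≤ ‖(q t).1‖ ^ 2 + d ^ 2) :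
    ‖(q b).1‖ ^ 2 - d ^ 2 / 4 ≤ Real.exp (-l * (b - a)) * (‖(q a).1‖ ^ 2 - d ^ 2 / 4) := by
  refine sub_le_exp_mul_of_deriv_le (φ := fun t => ‖(q t).1‖ ^ 2) (k := l) hab (fun t ht =>
    ((hq t (ha.trans ht.1)).mono (fun s hs => ha.trans hs.1)).prod_fst.norm_sq) fun t ht => ?_
  have e1 : (modelField A B ρ γ (q t)).1 = A (q t).1 + (ρ (q t)).1 := rfl
  rw [e1, inner_add_right, real_inner_comm]
  have hl := h.gap_pos
  have h1 := h.inner_le (q t).1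
  have h2 : ‖(ρ (q t)).1‖ ≤ ε * ‖q t‖ := by
    have := h.norm_sub_le (q t) 0
    rw [h.map_zero, sub_zero, sub_zero] at this
    exact (norm_fst_le _).trans this
  have h3 := real_inner_le_norm (q t).1 (ρ (q t)).1
  have h4 : ‖(q t).1‖ * ‖(ρ (q t)).1‖ ≤ ‖q t‖ * (ε * ‖q t‖) :=
    mul_le_mul (norm_fst_le _) h2 (norm_nonneg _) (norm_nonneg _)
  have h5 : ‖q t‖ ^ 2 ≤ ‖(q t).1‖ ^ 2 + d ^ 2 := by
    have h : ‖q t‖ = max ‖(q t).1‖ (max ‖(q t).2.1‖ |(q t).2.2|) := rfl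
    have h6 := hσ t ht
    have h7 := hz t ht
    rw [h]
    rcases max_choice ‖(q t).1‖ (max ‖(q t).2.1‖ |(q t).2.2|) with h1 | h1 <;> rw [h1]
    · nlinarith [sq_nonneg d]
    · rcases max_choice ‖(q t).2.1‖ |(q t).2.2| with h2 | h2 <;> rw [h2]
      · exact h7
      · rw [sq_abs]
        nlinarith [sq_nonneg ‖(q t).1‖]
  have h6 : ε * ‖q t‖ ^ 2 ≤ ε * (‖(q t).1‖ ^ 2 + d ^ 2) :=
    mul_le_mul_of_nonneg_left h5 h.eps_nonneg
  have h7 : 24 * ε * (‖(q t).1‖ ^ 2 + d ^ 2) ≤ l * (‖(q t).1‖ ^ 2 + d ^ 2) :=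
    mul_le_mul_of_nonneg_right h.eps_le (by positivity)
  nlinarith [mul_nonneg hl.le (sq_nonneg ‖(q t).1‖), mul_nonneg hl.le (sq_nonneg d)]

theorem IsSaddleModel.stable_le_max (h : IsSaddleModel A B ρ γ l ε) {q : ℝ → Y × Z × ℝ}
    (hq : IsForwardSolution (modelField A B ρ γ) q) {b d : ℝ} (hb : 0 ≤ b)
    (hσ : ∀ t ∈ Icc 0 b, (q t).2.2 ^ 2 ≤ d ^ 2)
    (hz : ∀ t ∈ Icc 0 b, ‖(q t).2.1‖ ^ 2 ≤ ‖(q t).1‖ ^ 2 + d ^ 2) :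
    ‖(q b).1‖ ^ 2 ≤ max (‖(q 0).1‖ ^ 2) (d ^ 2 / 4) := by
  have h1 := h.stable_sub_le hq le_rfl hb hσ hz
  have he0 := Real.exp_pos (-l * (b - 0))
  have he1 : Real.exp (-l * (b - 0)) ≤ 1 :=
    Real.exp_le_one_iff.2 (by nlinarith [h.gap_pos])
  rcases le_total (‖(q 0).1‖ ^ 2) (d ^ 2 / 4) with h2 | h2
  · rw [max_eq_right h2]
    nlinarith
  · rw [max_eq_left h2]
    nlinarith

theorem IsSaddleModel.centre_sq_le (h : IsSaddleModel A B ρ γ l ε) {q : ℝ → Y × Z × ℝ}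
    (hq : IsForwardSolution (modelField A B ρ γ) q) (h0 : (q 0).2.2 ≤ 0) {s t : ℝ} (hs : 0 ≤ s)
    (hst : s ≤ t) : (q t).2.2 ^ 2 ≤ (q s).2.2 ^ 2 := by
  have h1 := h.centre_monotoneOn hq hs (hs.trans hst) hst
  have h2 := h.centre_nonpos hq h0 (hs.trans hst)
  simp only at h1
  nlinarith

theorem IsSaddleModel.lipschitzWith_gamma (h : IsSaddleModel A B ρ γ l ε) :
    LipschitzWith ⟨ε, h.eps_nonneg⟩ γ :=
  LipschitzWith.of_dist_le_mul fun s t => h.abs_sub_le s t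

/-- The centre component comes arbitrarily close to `0`. -/
theorem IsSaddleModel.exists_centre_sq_le (h : IsSaddleModel A B ρ γ l ε) {q : ℝ → Y × Z × ℝ}
    (hq : IsForwardSolution (modelField A B ρ γ) q) (h0 : (q 0).2.2 ≤ 0) {η : ℝ} (hη : 0 < η) :
    ∃ s, 0 ≤ s ∧ (q s).2.2 ^ 2 ≤ η ^ 2 := by
  by_contra! hcon
  have hlt : ∀ s, 0 ≤ s → (q s).2.2 ∈ Icc (q 0).2.2 (-η) := by
    intro s hs
    refine ⟨h.centre_monotoneOn hq self_mem_Ici hs hs, ?_⟩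
    have h1 := hcon s hs
    have h2 := h.centre_nonpos hq h0 hs
    nlinarith
  -- on the compact interval that contains the centre component its speed is bounded below
  obtain ⟨s₀, hs₀, hmin⟩ := isCompact_Icc.exists_isMinOn ⟨_, hlt 0 le_rfl⟩
    h.lipschitzWith_gamma.continuous.continuousOn
  have hm : 0 < γ s₀ := h.pos _ (by linarith [hs₀.2])
  have hmono : MonotoneOn (fun t => (q t).2.2 - γ s₀ * t) (Ici 0) := by
    refine monotoneOn_of_hasDerivWithinAt_nonneg (f' := fun t => γ (q t).2.2 - γ s₀) (convex_Ici 0)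
      ?_ (fun t ht => ?_) (fun t ht => ?_)
    · exact fun t ht => ((hq t ht).prod_snd.prod_snd.continuousWithinAt).sub
        (by fun_prop : Continuous fun t => γ s₀ * t).continuousWithinAt
    · have h1 := ((hq t (interior_subset ht)).prod_snd.prod_snd.mono interior_subset)
      have h2 := ((hasDerivAt_id t).const_mul (γ s₀)).hasDerivWithinAt (s := interior (Ici (0 : ℝ)))
      exact (h1.sub h2).congr_deriv (by simp [modelField])
    · exact sub_nonneg.2 (hmin (hlt t (interior_subset ht)))
  have hT : 0 ≤ -(q 0).2.2 / γ s₀ := div_nonneg (by linarith) hm.le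
  have h1 := hmono self_mem_Ici hT hT
  simp only [mul_zero, sub_zero] at h1
  rw [mul_div_cancel₀ _ hm.ne'] at h1
  have h2 := (hlt _ hT).2
  linarith

/-- A forward solution that stays bounded converges to the equilibrium. -/
theorem IsSaddleModel.tendsto_zero (h : IsSaddleModel A B ρ γ l ε) {q : ℝ → Y × Z × ℝ}
    (hq : IsForwardSolution (modelField A B ρ γ) q) (h0 : (q 0).2.2 ≤ 0) {C : ℝ}
    (hC : ∀ t, 0 ≤ t → ‖q t‖ ≤ C) : Tendsto q atTop (𝓝 0) := by
  rw [Metric.tendsto_atTop]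
  intro ζ hζ
  obtain ⟨η, hη, hηζ⟩ : ∃ η, 0 < η ∧ 2 * η < ζ := ⟨ζ / 4, by linarith, by linarith⟩
  obtain ⟨s, hs, hσs⟩ := h.exists_centre_sq_le hq h0 hη
  have hσ : ∀ t, s ≤ t → (q t).2.2 ^ 2 ≤ η ^ 2 := fun t ht =>
    (h.centre_sq_le hq h0 hs ht).trans hσs
  have hz : ∀ t, 0 ≤ t → 4 * ‖(q t).2.1‖ ^ 2 ≤ ‖(q t).1‖ ^ 2 + (q t).2.2 ^ 2 := fun t ht =>
    h.unstable_le hq (fun t ht => (norm_mid_le _).trans (hC t ht)) ht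
  have hlim : Tendsto (fun t => Real.exp (-l * (t - s)) * C ^ 2) atTop (𝓝 0) := by
    have h1 : Tendsto (fun t => -l * (t - s)) atTop atBot :=
      (tendsto_atTop_add_const_right _ (-s) tendsto_id).const_mul_atTop_of_neg
        (neg_lt_zero.2 h.gap_pos)
    simpa using (Real.tendsto_exp_atBot.comp h1).mul_const (C ^ 2)
  obtain ⟨T, hT⟩ := eventually_atTop.1 (hlim.eventually (ge_mem_nhds (by positivity : 0 < η ^ 2)))
  refine ⟨max s T, fun t ht => ?_⟩
  have hst : s ≤ t := (le_max_left _ _).trans ht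
  have ht0 := hs.trans hst
  have h1 := h.stable_sub_le hq hs hst (d := η) (fun r hr => hσ r hr.1) (fun r hr => by
    have h2 := hz r (hs.trans hr.1)
    have h3 := hσ r hr.1
    nlinarith [sq_nonneg ‖(q r).1‖, sq_nonneg ‖(q r).2.1‖])
  have h2 := hT t ((le_max_right _ _).trans ht)
  have h3 : ‖(q s).1‖ ^ 2 ≤ C ^ 2 :=
    pow_le_pow_left₀ (norm_nonneg _) ((norm_fst_le _).trans (hC s hs)) 2
  have he := Real.exp_pos (-l * (t - s))
  have h4 : ‖(q t).1‖ ^ 2 ≤ 5 / 4 * η ^ 2 := by nlinarith [sq_nonneg η]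
  have h5 := hz t ht0
  have h6 := hσ t hst
  have h7 := norm_sq_le_sum (q t)
  rw [dist_zero_right]
  refine lt_of_le_of_lt ?_ hηζ
  refine le_of_sq_le_sq ?_ (by positivity)
  nlinarith

end Model

/-! ### Orbits that stay in the box -/

section Box

open scoped NNReal

variable {Y Z : Type*} [NormedAddCommGroup Y] [InnerProductSpace ℝ Y]
  [NormedAddCommGroup Z] [InnerProductSpace ℝ Z]
  {A : Y →L[ℝ] Y} {B : Z →L[ℝ] Z} {ρ : Y × Z × ℝ → Y × Z} {γ : ℝ → ℝ} {l ε δ : ℝ}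

theorem IsSaddleModel.lipschitzWith_rho (h : IsSaddleModel A B ρ γ l ε) :
    LipschitzWith ⟨ε, h.eps_nonneg⟩ ρ :=
  LipschitzWith.of_dist_le_mul fun p q => by
    rw [dist_eq_norm, dist_eq_norm]
    exact h.norm_sub_le p q

theorem IsSaddleModel.exists_lipschitzWith (h : IsSaddleModel A B ρ γ l ε) :
    ∃ K, LipschitzWith K (modelField A B ρ γ) := by
  have h1 := (A.lipschitz.comp (LipschitzWith.prod_fst (α := Y) (β := Z × ℝ))).add
    (LipschitzWith.prod_fst.comp h.lipschitzWith_rho)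
  have h2 := (B.lipschitz.comp (LipschitzWith.prod_fst.comp
    (LipschitzWith.prod_snd (α := Y) (β := Z × ℝ)))).add
    (LipschitzWith.prod_snd.comp h.lipschitzWith_rho)
  have h3 := h.lipschitzWith_gamma.comp (LipschitzWith.prod_snd.comp
    (LipschitzWith.prod_snd (α := Y) (β := Z × ℝ)))
  exact ⟨_, h1.prodMk (h2.prodMk h3)⟩

/-- A forward solution that starts in the box either stays there or leaves it through its
unstable faces. -/
theorem IsSaddleModel.forall_mem_halfBox_or_exit (h : IsSaddleModel A B ρ γ l ε)
    {q : ℝ → Y × Z × ℝ} (hq : IsForwardSolution (modelField A B ρ γ) q)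
    (h0 : q 0 ∈ halfBox Y Z δ) :
    (∀ t, 0 ≤ t → q t ∈ halfBox Y Z δ) ∨
      ∃ T, 0 < T ∧ (∀ t ∈ Ico 0 T, q t ∈ halfBox Y Z δ) ∧ ‖(q T).1‖ < δ ∧ -δ < (q T).2.2 ∧
        (q T).2.2 ≤ 0 ∧ δ ≤ ‖(q T).2.1‖ := by
  by_cases hall : ∀ t, 0 ≤ t → q t ∈ halfBox Y Z δ
  · exact Or.inl hall
  right
  push Not at hall
  have hδ : 0 < δ := (norm_nonneg _).trans_lt h0.1
  let O : Set (Y × Z × ℝ) := {q | ‖q.1‖ < δ ∧ ‖q.2.1‖ < δ ∧ -δ < q.2.2}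
  have hO : IsOpen O := by
    have h1 : IsOpen {q : Y × Z × ℝ | ‖q.1‖ < δ} := isOpen_lt (by fun_prop) continuous_const
    have h2 : IsOpen {q : Y × Z × ℝ | ‖q.2.1‖ < δ} := isOpen_lt (by fun_prop) continuous_const
    have h3 : IsOpen {q : Y × Z × ℝ | -δ < q.2.2} := isOpen_lt continuous_const (by fun_prop)
    exact h1.inter (h2.inter h3)
  have hmem : ∀ t, 0 ≤ t → (q t ∈ O ↔ q t ∈ halfBox Y Z δ) := fun t ht =>
    ⟨fun hm => ⟨hm.1, hm.2.1, hm.2.2, h.centre_nonpos hq h0.2.2.2 ht⟩,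
      fun hm => ⟨hm.1, hm.2.1, hm.2.2.1⟩⟩
  let S : Set ℝ := Ici 0 ∩ q ⁻¹' Oᶜ
  have hS : IsClosed S := hq.continuousOn.preimage_isClosed_of_isClosed isClosed_Ici hO.isClosed_compl
  have hSne : S.Nonempty := by
    obtain ⟨t, ht, hqt⟩ := hall
    exact ⟨t, ht, fun hO' => hqt ((hmem t ht).1 hO')⟩
  have hSbdd : BddBelow S := ⟨0, fun t ht => ht.1⟩
  obtain ⟨hT0, hTO⟩ := hS.csInf_mem hSne hSbdd
  set T := sInf S with hT
  have hT0' : 0 ≤ T := hT0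
  have hTpos : 0 < T := by
    rcases hT0'.eq_or_lt with h1 | h1
    · rw [← h1] at hTO
      exact absurd ((hmem 0 le_rfl).2 h0) hTO
    · exact h1
  have hbefore : ∀ t ∈ Ico 0 T, q t ∈ halfBox Y Z δ := by
    intro t ht
    refine (hmem t ht.1).1 ?_
    by_contra hcon
    exact absurd (csInf_le hSbdd (⟨ht.1, hcon⟩ : t ∈ S)) (not_le.2 ht.2)
  have hσT : -δ < (q T).2.2 :=
    h0.2.2.1.trans_le (h.centre_monotoneOn hq self_mem_Ici hT0 hT0')
  have hσ0 : (q T).2.2 ≤ 0 := h.centre_nonpos hq h0.2.2.2 hT0'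
  have hzT : ‖(q T).2.1‖ ≤ δ := by
    have hclos : T ∈ closure (Ico 0 T) := by
      rw [closure_Ico hTpos.ne]
      exact ⟨hT0', le_rfl⟩
    have hc : ContinuousWithinAt (fun t => ‖(q t).2.1‖) (Ico 0 T) T :=
      ((hq.continuousOn T hT0).mono (fun t ht => ht.1)).snd.fst.norm
    exact isClosed_Iic.closure_subset_iff.2 (by
      rintro _ ⟨t, ht, rfl⟩
      exact (hbefore t ht).2.1.le) (hc.mem_closure_image hclos)
  have hyT : ‖(q T).1‖ < δ := by
    have h1 := h.stable_le_max hq hT0' (d := δ) (fun t ht => by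
      have h2 := h.centre_monotoneOn hq self_mem_Ici ht.1 ht.1
      have h3 := h.centre_nonpos hq h0.2.2.2 ht.1
      simp only at h2
      nlinarith [h0.2.2.1]) (fun t ht => by
      have h2 : ‖(q t).2.1‖ ≤ δ := by
        rcases ht.2.eq_or_lt with h3 | h3
        · rw [h3]; exact hzT
        · exact (hbefore t ⟨ht.1, h3⟩).2.1.le
      nlinarith [norm_nonneg (q t).2.1, sq_nonneg ‖(q t).1‖])
    have h2 : max (‖(q 0).1‖ ^ 2) (δ ^ 2 / 4) < δ ^ 2 :=
      max_lt (by nlinarith [h0.1, norm_nonneg (q 0).1]) (by nlinarith)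
    exact lt_of_pow_lt_pow_left₀ 2 hδ.le (h1.trans_lt h2)
  refine ⟨T, hTpos, hbefore, hyT, hσT, hσ0, ?_⟩
  by_contra! hcon
  exact hTO ⟨hyT, hcon, hσT⟩

/-- The points of the box whose forward solution stays in the box. -/
def trappedSet (v : Y × Z × ℝ → Y × Z × ℝ) (δ : ℝ) : Set (Y × Z × ℝ) :=
  {q₀ | ∃ q : ℝ → Y × Z × ℝ, IsForwardSolution v q ∧ q 0 = q₀ ∧ ∀ t, 0 ≤ t → q t ∈ halfBox Y Z δ}

theorem trappedSet_subset (v : Y × Z × ℝ → Y × Z × ℝ) : trappedSet v δ ⊆ halfBox Y Z δ := by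
  rintro _ ⟨q, _, rfl, h⟩
  exact h 0 le_rfl

theorem IsSaddleModel.norm_sq_sub_le_of_mem_trappedSet (h : IsSaddleModel A B ρ γ l ε)
    {p q : Y × Z × ℝ} (hp : p ∈ trappedSet (modelField A B ρ γ) δ)
    (hq : q ∈ trappedSet (modelField A B ρ γ) δ) :
    4 * ‖p.2.1 - q.2.1‖ ^ 2 ≤ ‖p.1 - q.1‖ ^ 2 + (p.2.2 - q.2.2) ^ 2 := by
  obtain ⟨q₁, h1, rfl, h1'⟩ := hp
  obtain ⟨q₂, h2, rfl, h2'⟩ := hq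
  exact h.norm_sq_sub_le h1 h2 (C := δ + δ) (fun t ht => (_root_.norm_sub_le _ _).trans
    (add_le_add (h1' t ht).2.1.le (h2' t ht).2.1.le)) le_rfl

theorem IsSaddleModel.eq_of_mem_trappedSet (h : IsSaddleModel A B ρ γ l ε)
    {p q : Y × Z × ℝ} (hp : p ∈ trappedSet (modelField A B ρ γ) δ)
    (hq : q ∈ trappedSet (modelField A B ρ γ) δ) (h1 : p.1 = q.1) (h2 : p.2.2 = q.2.2) : p = q := by
  have h3 := h.norm_sq_sub_le_of_mem_trappedSet hp hq
  rw [h1, h2, sub_self, sub_self, norm_zero] at h3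
  have h4 : ‖p.2.1 - q.2.1‖ = 0 := by nlinarith [norm_nonneg (p.2.1 - q.2.1)]
  exact Prod.ext h1 (Prod.ext (sub_eq_zero.1 (norm_eq_zero.1 h4)) h2)

/-- The trapped set is tangent to the centre-stable directions at the equilibrium, since the
Lipschitz constants of the perturbation tend to `0` there. -/
theorem IsSaddleModel.exists_forall_trappedSet_norm_sq_le (h : IsSaddleModel A B ρ γ l ε)
    (hflat : ∀ ε' > 0, ∃ δ' > 0, ∀ q ∈ halfBox Y Z δ', ‖ρ q‖ ≤ ε' * ‖q‖ ∧ |γ q.2.2| ≤ ε' * ‖q‖)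
    {κ : ℝ} (hκ : 0 < κ) (hκ1 : κ ≤ 1) :
    ∃ δ' > 0, ∀ q ∈ trappedSet (modelField A B ρ γ) δ, ‖q.1‖ < δ' → -δ' < q.2.2 →
      ‖q.2.1‖ ^ 2 ≤ κ ^ 2 * (‖q.1‖ ^ 2 + q.2.2 ^ 2) := by
  have hl := h.gap_pos
  obtain ⟨δ', hδ', hfl⟩ := hflat (l * κ ^ 2 / 6) (by positivity)
  refine ⟨δ', hδ', ?_⟩
  rintro _ ⟨q, hq, rfl, hbox⟩ hy hσ
  have h0 := (hbox 0 le_rfl).2.2.2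
  have hz : ∀ t, 0 ≤ t → 4 * ‖(q t).2.1‖ ^ 2 ≤ ‖(q t).1‖ ^ 2 + (q t).2.2 ^ 2 := fun t ht =>
    h.unstable_le hq (fun t ht => (hbox t ht).2.1.le) ht
  have hsmall : ∀ t, 0 ≤ t → q t ∈ halfBox Y Z δ' := by
    intro t ht
    have hσt : ∀ s, 0 ≤ s → (q s).2.2 ^ 2 ≤ (q 0).2.2 ^ 2 := fun s hs =>
      h.centre_sq_le hq h0 le_rfl hs
    have h1 := h.stable_le_max hq ht (d := (q 0).2.2) (fun s hs => hσt s hs.1) (fun s hs => by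
      nlinarith [hz s hs.1, hσt s hs.1, sq_nonneg ‖(q s).2.1‖, sq_nonneg ‖(q s).1‖])
    have hσ2 : (q 0).2.2 ^ 2 < δ' ^ 2 := by nlinarith
    have h2 : max (‖(q 0).1‖ ^ 2) ((q 0).2.2 ^ 2 / 4) < δ' ^ 2 :=
      max_lt (by nlinarith [norm_nonneg (q 0).1]) (by nlinarith)
    have h3 := h1.trans_lt h2
    refine ⟨lt_of_pow_lt_pow_left₀ 2 hδ'.le h3, lt_of_pow_lt_pow_left₀ 2 hδ'.le ?_, ?_,
      h.centre_nonpos hq h0 ht⟩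
    · nlinarith [hz t ht, hσt t ht]
    · exact hσ.trans_le (h.centre_monotoneOn hq self_mem_Ici ht ht)
  have key := h.coneForm_nonpos hq h.isForwardSolution_zero (κ := κ) (ε' := l * κ ^ 2 / 6) (C := δ)
    (t := 0) (by nlinarith) (by linarith) (fun t ht => ?_) (fun t ht => ?_) (fun t ht => ?_) le_rfl
  · simp only [coneForm, sub_zero] at key
    linarith
  · rw [h.map_zero, sub_zero, sub_zero]
    exact (hfl _ (hsmall t ht)).1
  · have : γ (0 : Y × Z × ℝ).2.2 = 0 := h.eq_zero _ le_rfl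
    rw [this, sub_zero, sub_zero]
    exact (hfl _ (hsmall t ht)).2
  · simpa using (hbox t ht).2.1.le

variable [CompleteSpace Y] [CompleteSpace Z]

theorem IsSaddleModel.exists_isForwardSolution (h : IsSaddleModel A B ρ γ l ε) (q₀ : Y × Z × ℝ) :
    ∃ q, IsForwardSolution (modelField A B ρ γ) q ∧ q 0 = q₀ := by
  obtain ⟨K, hK⟩ := h.exists_lipschitzWith
  obtain ⟨q, hq0, hq⟩ := exists_forward_solution_of_lipschitz hK h.modelField_zero q₀
  exact ⟨q, hq, hq0⟩

/-- The trapped set contains a point over every centre-stable coordinate of the box: insert the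
solution of the decoupled centre equation, solve for a bounded orbit of the rest by the
Lyapunov–Perron method, and use the cone estimates to see that it does not leave the box. -/
theorem IsSaddleModel.exists_mem_trappedSet (h : IsSaddleModel A B ρ γ l ε) {y₀ : Y} {σ₀ : ℝ}
    (hy₀ : ‖y₀‖ < δ) (hσ₀ : -δ < σ₀) (hσ₀' : σ₀ ≤ 0) :
    ∃ z₀, (y₀, z₀, σ₀) ∈ trappedSet (modelField A B ρ γ) δ := by
  have hl := h.gap_pos
  have hδ : 0 < δ := (norm_nonneg _).trans_lt hy₀
  obtain ⟨σ, hσ0, hσ⟩ := exists_forward_solution_of_lipschitz h.lipschitzWith_gamma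
    (h.eq_zero 0 le_rfl) σ₀
  -- the centre equation decouples, so its solution extends to one of the unperturbed model
  have h' : IsSaddleModel A B (fun _ => 0) γ l ε :=
    { h with
      norm_sub_le := fun p q => by
        rw [sub_self, norm_zero]
        exact mul_nonneg h.eps_nonneg (norm_nonneg _)
      map_zero := rfl }
  have hσ' : IsForwardSolution (modelField A B (fun _ => 0) γ) (fun t => (0, 0, σ t)) := by
    intro t ht
    have := (hasDerivWithinAt_const t (Ici (0 : ℝ)) (0 : Y)).prodMk
      ((hasDerivWithinAt_const t (Ici (0 : ℝ)) (0 : Z)).prodMk (hσ t ht))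
    simpa [modelField] using this
  have hσsq : ∀ t, 0 ≤ t → σ t ^ 2 ≤ σ₀ ^ 2 := by
    intro t ht
    have := h'.centre_sq_le hσ' (by simpa [hσ0] using hσ₀') le_rfl ht
    simpa [hσ0] using this
  let R : ℝ → Y × Z → Y × Z := fun t x => ρ (x.1, x.2, σ (max t 0))
  have hσc : Continuous fun t => σ (max t 0) := by
    have h1 : ContinuousOn σ (Ici 0) := fun t ht => (hσ t ht).continuousWithinAt
    exact h1.comp_continuous (by fun_prop) (fun t => le_max_right t 0)
  have hR : Continuous (Function.uncurry R) :=
    h.lipschitzWith_rho.continuous.comp ((continuous_fst.comp continuous_snd).prodMk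
      ((continuous_snd.comp continuous_snd).prodMk (hσc.comp continuous_fst)))
  have hRK : ∀ t, LipschitzWith ⟨ε, h.eps_nonneg⟩ (R t) := by
    intro t
    refine LipschitzWith.of_dist_le_mul fun x x' => ?_
    refine (h.lipschitzWith_rho.dist_le_mul _ _).trans (le_of_eq ?_)
    congr 1
    simp [Prod.dist_eq]
  obtain ⟨x, hx0, hx, C, hC⟩ := exists_bounded_solution_of_dichotomy hl h.inner_le h.le_inner hR
    (K := ⟨ε, h.eps_nonneg⟩) (by
      change ε < l
      linarith [h.eps_le, h.eps_nonneg]) hRK (M := ε * |σ₀|) (fun t => by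
      have h1 := h.norm_sub_le (0, 0, σ (max t 0)) 0
      rw [h.map_zero, sub_zero, sub_zero] at h1
      refine h1.trans (mul_le_mul_of_nonneg_left ?_ h.eps_nonneg)
      have h2 := sq_le_sq.1 (hσsq (max t 0) (le_max_right _ _))
      simpa [Prod.norm_def] using h2) y₀
  let q : ℝ → Y × Z × ℝ := fun t => ((x t).1, (x t).2, σ t)
  have hq : IsForwardSolution (modelField A B ρ γ) q := by
    intro t ht
    have h1 := (hx t ht).prod_fst.prodMk ((hx t ht).prod_snd.prodMk (hσ t ht))
    have h2 : R t (x t) = ρ (q t) := by simp only [R, q, max_eq_left ht]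
    rw [h2] at h1
    exact h1
  have hq0 : (q 0).1 = y₀ := hx0
  have hz : ∀ t, 0 ≤ t → 4 * ‖(q t).2.1‖ ^ 2 ≤ ‖(q t).1‖ ^ 2 + (q t).2.2 ^ 2 := fun t ht =>
    h.unstable_le hq (fun t ht => (norm_snd_le (x t)).trans (hC t ht)) ht
  have hσ00 : (q 0).2.2 ≤ 0 := by
    change σ 0 ≤ 0
    rwa [hσ0]
  refine ⟨(q 0).2.1, q, hq, Prod.ext hq0 (Prod.ext rfl hσ0), fun t ht => ?_⟩
  have hσt : ∀ s, 0 ≤ s → (q s).2.2 ^ 2 ≤ σ₀ ^ 2 := hσsq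
  have h1 := h.stable_le_max hq ht (d := σ₀) (fun s hs => hσt s hs.1) (fun s hs => by
    nlinarith [hz s hs.1, hσt s hs.1, sq_nonneg ‖(q s).2.1‖, sq_nonneg ‖(q s).1‖])
  have hσ2 : σ₀ ^ 2 < δ ^ 2 := by nlinarith
  rw [hq0] at h1
  have h2 : max (‖y₀‖ ^ 2) (σ₀ ^ 2 / 4) < δ ^ 2 :=
    max_lt (by nlinarith [norm_nonneg y₀]) (by nlinarith)
  have h3 := h1.trans_lt h2
  refine ⟨lt_of_pow_lt_pow_left₀ 2 hδ.le h3, lt_of_pow_lt_pow_left₀ 2 hδ.le ?_, ?_,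
    h.centre_nonpos hq hσ00 ht⟩
  · nlinarith [hz t ht, hσt t ht]
  · have h4 := h.centre_monotoneOn hq self_mem_Ici ht ht
    have h5 : (q 0).2.2 = σ₀ := hσ0
    simp only [h5] at h4
    linarith

end Box

/-! ### Gluing solutions -/

section Flow

open scoped NNReal

variable {Q : Type*} [NormedAddCommGroup Q] [NormedSpace ℝ Q] {v : Q → Q}

theorem hasDerivWithinAt_comp_const_add {q : ℝ → Q} {q' : Q} {I J : Set ℝ} {a s : ℝ}
    (h : HasDerivWithinAt q q' I (a + s)) (hJ : ∀ r ∈ J, a + r ∈ I) :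
    HasDerivWithinAt (fun r => q (a + r)) q' J s := by
  have h1 : HasDerivWithinAt (fun r : ℝ => a + r) 1 J s :=
    ((hasDerivAt_id s).const_add a).hasDerivWithinAt
  simpa [Function.comp_def] using HasDerivWithinAt.scomp s h h1 hJ

theorem IsForwardSolution.shift {q : ℝ → Q} (hq : IsForwardSolution v q) {a : ℝ} (ha : 0 ≤ a) :
    IsForwardSolution v (fun s => q (a + s)) := fun s hs =>
  hasDerivWithinAt_comp_const_add (hq (a + s) (add_nonneg ha hs)) fun _ hr => add_nonneg ha hr

/-- Following an orbit segment by a forward solution from its end point gives a forward solution. -/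
theorem IsForwardSolution.concat {q ψ : ℝ → Q} {τ : ℝ}
    (hq : ∀ s ∈ Icc 0 τ, HasDerivWithinAt q (v (q s)) (Icc 0 τ) s) (hψ : IsForwardSolution v ψ)
    (hj : q τ = ψ 0) : IsForwardSolution v (fun s => if s ≤ τ then q s else ψ (s - τ)) := by
  set φ : ℝ → Q := fun s => if s ≤ τ then q s else ψ (s - τ) with hφ
  have hleft : ∀ s, s ≤ τ → φ s = q s := fun s hs => if_pos hs
  have hright : ∀ s, τ ≤ s → φ s = ψ (-τ + s) := by
    intro s hs
    rcases hs.eq_or_lt with h | h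
    · rw [← h, hleft τ le_rfl, hj, neg_add_cancel]
    · rw [neg_add_eq_sub]
      exact if_neg (not_le.2 h)
  have hl : ∀ s ∈ Icc 0 τ, HasDerivWithinAt φ (v (φ s)) (Icc 0 τ) s := by
    intro s hs
    rw [hleft s hs.2]
    exact (hq s hs).congr (fun r hr => hleft r hr.2) (hleft s hs.2)
  have hr : ∀ s, τ ≤ s → HasDerivWithinAt φ (v (φ s)) (Ici τ) s := by
    intro s hs
    rw [hright s hs]
    have h0 : 0 ≤ -τ + s := by linarith
    refine (hasDerivWithinAt_comp_const_add (hψ _ h0) fun r hr => ?_).congr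
      (fun r hr => hright r hr) (hright s hs)
    have : τ ≤ r := hr
    change 0 ≤ -τ + r
    linarith
  intro s hs
  rcases lt_trichotomy s τ with h | h | h
  · refine (hl s ⟨hs, h.le⟩).mono_of_mem_nhdsWithin ?_
    exact mem_nhdsWithin.2 ⟨Iio τ, isOpen_Iio, h, fun r hr => ⟨hr.2, hr.1.le⟩⟩
  · refine ((hl s ⟨hs, h.le⟩).union (hr s h.ge)).mono fun r hr => ?_
    rcases le_total r τ with h' | h'
    · exact Or.inl ⟨hr, h'⟩
    · exact Or.inr h'
  · refine (hr s h.le).mono_of_mem_nhdsWithin ?_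
    exact mem_nhdsWithin.2 ⟨Ioi τ, isOpen_Ioi, h, fun r hr => mem_Ici.2 (le_of_lt (mem_Ioi.1 hr.1))⟩

theorem IsForwardSolution.eq_of_eq_zero {K : ℝ≥0} (hv : LipschitzWith K v) {q ψ : ℝ → Q} {τ : ℝ}
    (hτ : 0 ≤ τ) (hq : ∀ s ∈ Icc 0 τ, HasDerivWithinAt q (v (q s)) (Icc 0 τ) s)
    (hψ : IsForwardSolution v ψ) (hj : q 0 = ψ 0) : q τ = ψ τ := by
  refine ODE_solution_unique (v := fun _ => v) (K := K) (fun _ => hv)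
    (fun s hs => (hq s hs).continuousWithinAt) (fun s hs => ?_)
    (hψ.continuousOn.mono fun s hs => hs.1) (fun s hs => ?_) hj (right_mem_Icc.2 hτ)
  · refine (hq s ⟨hs.1, hs.2.le⟩).mono_of_mem_nhdsWithin ?_
    exact mem_nhdsWithin.2 ⟨Iio τ, isOpen_Iio, hs.2, fun r hr => ⟨hs.1.trans hr.2, hr.1.le⟩⟩
  · exact (hψ s hs.1).mono fun r hr => hs.1.trans hr

theorem omegaSet_subset_of_tendsto {X : Type*} [NormedAddCommGroup X] {c : ℝ → X} {p : X}
    (h : Tendsto c atTop (𝓝 p)) : omegaSet c ⊆ {p} := by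
  intro x hx
  by_contra hne
  have hpos : 0 < dist x p := dist_pos.2 hne
  obtain ⟨T, hT⟩ := Metric.tendsto_atTop.1 h (dist x p / 2) (by linarith)
  have h1 : x ∈ closure (c '' Ioi (max T 1)) :=
    mem_iInter.1 hx ⟨max T 1, lt_of_lt_of_le one_pos (le_max_right _ _)⟩
  have h2 : x ∈ Metric.closedBall p (dist x p / 2) := by
    refine Metric.isClosed_closedBall.closure_subset_iff.2 ?_ h1
    rintro _ ⟨t, ht, rfl⟩
    exact (hT t ((le_max_left _ _).trans (le_of_lt ht))).le
  have := Metric.mem_closedBall.1 h2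
  linarith

end Flow

/-! ### Centre-stable manifolds and the local stable set -/

section Chart

open scoped NNReal

variable {X Y Z : Type*} [NormedAddCommGroup X] [NormedSpace ℝ X]
  [NormedAddCommGroup Y] [InnerProductSpace ℝ Y] [NormedAddCommGroup Z] [InnerProductSpace ℝ Z]

/-- The linear chart `Θ` centred at `p` identifies the neighbourhood `N` of `p` in the phase space
with the half-open box of size `δ`, and the vector field `F` on `N` with `v`. -/
structure IsBoxChart (F : X → X) (P : Set X) (p : X) (N : Set X) (Θ : (Y × Z × ℝ) ≃L[ℝ] X)
    (v : Y × Z × ℝ → Y × Z × ℝ) (δ : ℝ) : Prop where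
  mem_iff : ∀ x, x ∈ N ↔ Θ.symm (x - p) ∈ halfBox Y Z δ
  subset : N ⊆ P
  conj : ∀ x ∈ N, Θ.symm (F x) = v (Θ.symm (x - p))

variable {F : X → X} {P : Set X} {p : X} {N : Set X} {Θ : (Y × Z × ℝ) ≃L[ℝ] X} {δ : ℝ}
  {A : Y →L[ℝ] Y} {B : Z →L[ℝ] Z} {ρ : Y × Z × ℝ → Y × Z} {γ : ℝ → ℝ} {l ε : ℝ}

theorem IsBoxChart.hasDerivWithinAt {v : Y × Z × ℝ → Y × Z × ℝ}
    (hc : IsBoxChart F P p N Θ v δ) {I : Set ℝ} {c : ℝ → X} (h : IsSolutionOn F P I c)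
    (hN : ∀ t ∈ I, c t ∈ N) {t : ℝ} (ht : t ∈ I) :
    HasDerivWithinAt (fun t => Θ.symm (c t - p)) (v (Θ.symm (c t - p))) I t := by
  rw [← hc.conj _ (hN t ht)]
  exact Θ.symm.hasFDerivAt.comp_hasDerivWithinAt t ((h t ht).2.sub_const p)

theorem IsBoxChart.add_mem_iff {v : Y × Z × ℝ → Y × Z × ℝ} (hc : IsBoxChart F P p N Θ v δ)
    (q : Y × Z × ℝ) : p + Θ q ∈ N ↔ q ∈ halfBox Y Z δ := by
  rw [hc.mem_iff, add_sub_cancel_left, Θ.symm_apply_apply]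

theorem IsBoxChart.isSolutionOn {v : Y × Z × ℝ → Y × Z × ℝ} (hc : IsBoxChart F P p N Θ v δ)
    {I : Set ℝ} {q : ℝ → Y × Z × ℝ} (h : ∀ t ∈ I, HasDerivWithinAt q (v (q t)) I t)
    (hq : ∀ t ∈ I, q t ∈ halfBox Y Z δ) : IsSolutionOn F P I (fun t => p + Θ (q t)) := by
  intro t ht
  have hN := (hc.add_mem_iff (q t)).2 (hq t ht)
  refine ⟨hc.subset hN, ?_⟩
  have h1 := hc.conj _ hN
  rw [add_sub_cancel_left, Θ.symm_apply_apply] at h1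
  have h2 : F (p + Θ (q t)) = Θ (v (q t)) := by rw [← h1, Θ.apply_symm_apply]
  rw [h2]
  exact (Θ.hasFDerivAt.comp_hasDerivWithinAt t (h t ht)).const_add p

/-- The local stable set is the trapped set: an orbit that stays in the box converges to the
equilibrium, so the condition on its limit set is automatic. -/
theorem IsBoxChart.mem_localStableSet_iff (hc : IsBoxChart F P p N Θ (modelField A B ρ γ) δ)
    (h : IsSaddleModel A B ρ γ l ε) (x : X) :
    x ∈ localStableSet F P {p} N ↔ Θ.symm (x - p) ∈ trappedSet (modelField A B ρ γ) δ := by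
  constructor
  · rintro ⟨c, hsol, rfl, -, hN⟩
    exact ⟨fun t => Θ.symm (c t - p), fun t ht => hc.hasDerivWithinAt hsol hN ht, rfl,
      fun t ht => (hc.mem_iff _).1 (hN t ht)⟩
  · rintro ⟨q, hq, hq0, hbox⟩
    refine ⟨fun t => p + Θ (q t), hc.isSolutionOn hq hbox, ?_, omegaSet_subset_of_tendsto ?_,
      fun t ht => (hc.add_mem_iff _).2 (hbox t ht)⟩
    · simp [hq0]
    · have h1 := h.tendsto_zero hq (hbox 0 le_rfl).2.2.2
        (fun t ht => norm_le_of_mem_halfBox (hbox t ht))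
      have h2 := ((Θ.continuous.tendsto 0).comp h1).const_add p
      simpa using h2

theorem IsBoxChart.isInvariantRel_localStableSet
    (hc : IsBoxChart F P p N Θ (modelField A B ρ γ) δ) (h : IsSaddleModel A B ρ γ l ε) :
    IsInvariantRel F P N (localStableSet F P {p} N) := by
  obtain ⟨K, hK⟩ := h.exists_lipschitzWith
  constructor
  · intro x hx
    exact (hc.mem_iff x).2 (trappedSet_subset _ ((hc.mem_localStableSet_iff h x).1 hx))
  · intro I c hI hsol hN t₀ ht₀ hmem t ht
    rw [hc.mem_localStableSet_iff h] at hmem ⊢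
    obtain ⟨ψ, hψ, hψ0, hbox⟩ := hmem
    have hd : ∀ s ∈ I, HasDerivWithinAt (fun t => Θ.symm (c t - p)) _ I s := fun s hs =>
      hc.hasDerivWithinAt hsol hN hs
    rcases le_total t₀ t with hle | hle
    · have hτ : 0 ≤ t - t₀ := sub_nonneg.2 hle
      have hmemI : ∀ r ∈ Icc 0 (t - t₀), t₀ + r ∈ I := fun r hr =>
        hI.out ht₀ ht ⟨by linarith [hr.1], by linarith [hr.2]⟩
      have heq := IsForwardSolution.eq_of_eq_zero hK hτ (q := fun s => Θ.symm (c (t₀ + s) - p))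
        (fun s hs => hasDerivWithinAt_comp_const_add (hd _ (hmemI s hs)) hmemI) hψ
        (by simp [hψ0])
      simp only [add_sub_cancel] at heq
      refine ⟨_, hψ.shift hτ, by simp [heq], fun s hs => hbox _ (add_nonneg hτ hs)⟩
    · have hτ : 0 ≤ t₀ - t := sub_nonneg.2 hle
      have hmemI : ∀ r ∈ Icc 0 (t₀ - t), t + r ∈ I := fun r hr =>
        hI.out ht ht₀ ⟨by linarith [hr.1], by linarith [hr.2]⟩
      refine ⟨_, IsForwardSolution.concat (q := fun s => Θ.symm (c (t + s) - p))
        (fun s hs => hasDerivWithinAt_comp_const_add (hd _ (hmemI s hs)) hmemI) hψ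
        (by simp [hψ0]), by simp [hτ], fun s hs => ?_⟩
      by_cases hs' : s ≤ t₀ - t
      · rw [if_pos hs']
        exact (hc.mem_iff _).1 (hN _ (hmemI s ⟨hs, hs'⟩))
      · rw [if_neg hs']
        exact hbox _ (by linarith)

variable {S T : Submodule ℝ X}

/-- An orbit that starts on a centre-stable manifold cannot leave the box. It could leave only through
an unstable face, but until then it is on the graph, over centre-stable coordinates that stay in the
interior of the box; by continuity the exit point would be on the graph, hence in the box. -/
theorem IsBoxChart.subset_localStableSet [CompleteSpace Y] [CompleteSpace Z]
    (hc : IsBoxChart F P p N Θ (modelField A B ρ γ) δ) (h : IsSaddleModel A B ρ γ l ε)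
    (hS : ∀ q, Θ q ∈ S ↔ q.2.1 = 0) (hT : ∀ q, Θ q ∈ T ↔ q.1 = 0 ∧ q.2.2 = 0) {W : Set X}
    (hW : IsTangentLipschitzGraph p S T N W) (hinv : IsInvariantRel F P N W) :
    W ⊆ localStableSet F P {p} N := by
  obtain ⟨g, ⟨K, hK⟩, -, -, hWg⟩ := hW
  intro x hx
  rw [hc.mem_localStableSet_iff h]
  have hx0 := (hc.mem_iff x).1 (hinv.1 hx)
  obtain ⟨q, hq, hq0⟩ := h.exists_isForwardSolution (Θ.symm (x - p))
  rw [← hq0] at hx0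
  rcases h.forall_mem_halfBox_or_exit hq hx0 with hstay | ⟨τ, hτ, hbox, hy, hσ, hσ', hz⟩
  · exact ⟨q, hq, hq0, hstay⟩
  exfalso
  have hδ : 0 < δ := (norm_nonneg _).trans_lt hy
  have hWt : ∀ t ∈ Ico 0 τ, p + Θ (q t) ∈ W := by
    refine hinv.2 (Ico 0 τ) (fun t => p + Θ (q t)) ordConnected_Ico
      (hc.isSolutionOn (fun t ht => (hq t ht.1).mono fun s hs => hs.1) hbox)
      (fun t ht => (hc.add_mem_iff _).2 (hbox t ht)) 0 ⟨le_rfl, hτ⟩ ?_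
    rw [hq0, Θ.apply_symm_apply, add_sub_cancel]
    exact hx
  -- the centre-stable part of the orbit, as a curve in the domain of the graph
  let ω : ℝ → S := fun t => ⟨Θ ((q t).1, 0, (q t).2.2), (hS _).2 rfl⟩
  have hωD : ∀ t ∈ Icc 0 τ, p + (ω t : X) ∈ N := by
    intro t ht
    refine (hc.add_mem_iff _).2 ?_
    rcases ht.2.eq_or_lt with h1 | h1
    · rw [h1]
      exact ⟨hy, by simpa using hδ, hσ, hσ'⟩
    · have := hbox t ⟨ht.1, h1⟩
      exact ⟨this.1, by simpa using hδ, this.2.2⟩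
  have hgω : ∀ t ∈ Ico 0 τ, (g (ω t) : X) = Θ (0, (q t).2.1, 0) := by
    intro t ht
    obtain ⟨w, hw, hweq⟩ := hWg ▸ hWt t ht
    simp only [add_assoc, add_right_inj] at hweq
    have h1 : (Θ.symm w).2.1 = 0 := (hS _).1 (by simp)
    have h2 := (hT (Θ.symm (g w))).1 (by simp)
    have h3 : q t = Θ.symm w + Θ.symm (g w) := by
      rw [← map_add, hweq, Θ.symm_apply_apply]
    have h4 : ω t = w := by
      apply Subtype.ext
      change Θ ((q t).1, 0, (q t).2.2) = w
      rw [← Θ.symm_apply_eq.trans eq_comm]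
      rw [h3]
      refine Prod.ext ?_ (Prod.ext h1 ?_) <;> simp [h2.1, h2.2]
    rw [h4, ← Θ.apply_symm_apply (g w : X)]
    congr 1
    refine Prod.ext h2.1 (Prod.ext ?_ h2.2)
    rw [h3]
    simp [h1]
  have hτI : τ ∈ Icc 0 τ := ⟨hτ.le, le_rfl⟩
  have hqc : ContinuousWithinAt q (Ico 0 τ) τ := (hq.continuousOn τ hτ.le).mono fun t ht => ht.1
  have hωc : ContinuousWithinAt ω (Ico 0 τ) τ :=
    tendsto_subtype_rng.2 (Θ.continuous.continuousAt.comp_continuousWithinAt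
      (hqc.fst.prodMk (continuousWithinAt_const.prodMk hqc.snd.snd)))
  have hlim1 : Tendsto (fun t => (g (ω t) : X)) (𝓝[Ico 0 τ] τ) (𝓝 (g (ω τ) : X)) :=
    (continuous_subtype_val.tendsto _).comp ((hK.continuousOn (ω τ) (hωD τ hτI)).comp hωc
      fun t ht => hωD t ⟨ht.1, ht.2.le⟩)
  have hlim2 : Tendsto (fun t => (g (ω t) : X)) (𝓝[Ico 0 τ] τ) (𝓝 (Θ (0, (q τ).2.1, 0))) := by
    have h1 : ContinuousWithinAt (fun t => Θ (0, (q t).2.1, 0)) (Ico 0 τ) τ :=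
      Θ.continuous.continuousAt.comp_continuousWithinAt
        (continuousWithinAt_const.prodMk (hqc.snd.fst.prodMk continuousWithinAt_const))
    exact h1.congr' (eventually_nhdsWithin_of_forall fun t ht => (hgω t ht).symm)
  have hne : (𝓝[Ico 0 τ] τ).NeBot := by
    rw [← mem_closure_iff_nhdsWithin_neBot, closure_Ico hτ.ne]
    exact hτI
  have hgτ := tendsto_nhds_unique hlim1 hlim2
  have hmem : p + (ω τ : X) + (g (ω τ) : X) ∈ W := by
    rw [hWg]
    exact ⟨ω τ, hωD τ hτI, rfl⟩
  have h1 := hinv.1 hmem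
  have h2 : p + (ω τ : X) + (g (ω τ) : X) = p + Θ (q τ) := by
    rw [hgτ, add_assoc, add_right_inj]
    change Θ _ + Θ _ = _
    rw [← map_add]
    congr 1
    simp
  rw [h2, hc.add_mem_iff] at h1
  exact absurd h1.2.1 (not_lt.2 hz)

/-- A centre-stable manifold is the whole local stable set, as it has a point over every centre-stable
coordinate and the trapped set has at most one. -/
theorem IsBoxChart.eq_localStableSet [CompleteSpace Y] [CompleteSpace Z]
    (hc : IsBoxChart F P p N Θ (modelField A B ρ γ) δ) (h : IsSaddleModel A B ρ γ l ε)
    (hS : ∀ q, Θ q ∈ S ↔ q.2.1 = 0) (hT : ∀ q, Θ q ∈ T ↔ q.1 = 0 ∧ q.2.2 = 0) {W : Set X}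
    (hW : IsTangentLipschitzGraph p S T N W) (hinv : IsInvariantRel F P N W) :
    W = localStableSet F P {p} N := by
  have hsub := hc.subset_localStableSet h hS hT hW hinv
  refine hsub.antisymm fun x hx => ?_
  obtain ⟨g, -, -, -, hWg⟩ := hW
  have hx' := (hc.mem_localStableSet_iff h x).1 hx
  set q := Θ.symm (x - p) with hq
  have hbox := trappedSet_subset _ hx'
  have hδ : 0 < δ := (norm_nonneg _).trans_lt hbox.1
  let w : S := ⟨Θ (q.1, 0, q.2.2), (hS _).2 rfl⟩
  have hmem : p + (w : X) + (g w : X) ∈ W := by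
    rw [hWg]
    exact ⟨w, (hc.add_mem_iff _).2 ⟨hbox.1, by simpa using hδ, hbox.2.2⟩, rfl⟩
  have h1 := (hc.mem_localStableSet_iff h _).1 (hsub hmem)
  have h2 := (hT (Θ.symm (g w))).1 (by simp)
  have h3 : Θ.symm (p + (w : X) + (g w : X) - p) = (q.1, 0, q.2.2) + Θ.symm (g w) := by
    rw [add_assoc, add_sub_cancel_left, map_add, Θ.symm_apply_apply]
  have h4 := h.eq_of_mem_trappedSet h1 hx' (by rw [h3]; simp [h2.1]) (by rw [h3]; simp [h2.2])
  have h5 := Θ.symm.injective h4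
  rw [sub_left_inj] at h5
  rwa [← h5]

/-- The local stable set is itself a Lipschitz graph, tangent to the centre-stable space. -/
theorem IsBoxChart.isTangentLipschitzGraph [CompleteSpace Y] [CompleteSpace Z]
    (hc : IsBoxChart F P p N Θ (modelField A B ρ γ) δ) (h : IsSaddleModel A B ρ γ l ε)
    (hδ : 0 < δ)
    (hflat : ∀ ε' > 0, ∃ δ' > 0, ∀ q ∈ halfBox Y Z δ', ‖ρ q‖ ≤ ε' * ‖q‖ ∧ |γ q.2.2| ≤ ε' * ‖q‖)
    (hS : ∀ q, Θ q ∈ S ↔ q.2.1 = 0) (hT : ∀ q, Θ q ∈ T ↔ q.1 = 0 ∧ q.2.2 = 0) :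
    IsTangentLipschitzGraph p S T N (localStableSet F P {p} N) := by
  have hex : ∀ w : S, ∃ z, p + (w : X) ∈ N →
      ((Θ.symm w).1, z, (Θ.symm w).2.2) ∈ trappedSet (modelField A B ρ γ) δ := by
    intro w
    by_cases hw : p + (w : X) ∈ N
    · have h1 := (hc.mem_iff _).1 hw
      rw [add_sub_cancel_left] at h1
      obtain ⟨z, hz⟩ := h.exists_mem_trappedSet h1.1 h1.2.2.1 h1.2.2.2
      exact ⟨z, fun _ => hz⟩
    · exact ⟨0, fun hw' => absurd hw' hw⟩
  choose z hz using hex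
  let g : S → T := fun w => ⟨Θ (0, z w, 0), (hT _).2 ⟨rfl, rfl⟩⟩
  have hgval : ∀ w, (g w : X) = Θ (0, z w, 0) := fun w => rfl
  have hcoord : ∀ w : S, (Θ.symm (w : X)).2.1 = 0 := fun w => (hS _).1 (by simp)
  have h0N : p + ((0 : S) : X) ∈ N := by
    rw [hc.mem_iff]
    simp only [ZeroMemClass.coe_zero, add_zero, sub_self, map_zero]
    exact ⟨by simpa using hδ, by simpa using hδ, by simpa using hδ, le_rfl⟩
  have hz0 : z 0 = 0 := by
    have h1 : (0 : Y × Z × ℝ) ∈ trappedSet (modelField A B ρ γ) δ :=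
      ⟨fun _ => 0, h.isForwardSolution_zero, rfl, fun _ _ =>
        ⟨by simpa using hδ, by simpa using hδ, by simpa using hδ, le_rfl⟩⟩
    have h2 := h.eq_of_mem_trappedSet (hz 0 h0N) h1 (by simp) (by simp)
    exact congrArg (fun q => q.2.1) h2
  have hg0 : g 0 = 0 := by
    apply Subtype.ext
    rw [hgval, hz0]
    exact map_zero Θ
  set M := ‖(Θ : (Y × Z × ℝ) →L[ℝ] X)‖ with hM
  set M' := ‖(Θ.symm : X →L[ℝ] (Y × Z × ℝ))‖ with hM'
  have hMz : ∀ z₁ : Z, ‖Θ (0, z₁, 0)‖ ≤ M * ‖z₁‖ := by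
    intro z₁
    have h1 := (Θ : (Y × Z × ℝ) →L[ℝ] X).le_opNorm (0, z₁, 0)
    simpa [Prod.norm_def] using h1
  have hM'w : ∀ x : X, ‖Θ.symm x‖ ≤ M' * ‖x‖ := fun x =>
    (Θ.symm : X →L[ℝ] (Y × Z × ℝ)).le_opNorm x
  have hsq : ∀ q : Y × Z × ℝ, ‖q.1‖ ^ 2 + q.2.2 ^ 2 ≤ 2 * ‖q‖ ^ 2 := by
    intro q
    have h1 : ‖q.1‖ ^ 2 ≤ ‖q‖ ^ 2 := pow_le_pow_left₀ (norm_nonneg _) (norm_fst_le q) 2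
    have h2 : |q.2.2| ^ 2 ≤ ‖q‖ ^ 2 := pow_le_pow_left₀ (abs_nonneg _) (abs_last_le q) 2
    rw [sq_abs] at h2
    linarith
  refine ⟨g, ⟨(M * M').toNNReal, LipschitzOnWith.of_dist_le_mul fun w hw w' hw' => ?_⟩, hg0,
    ?_, ?_⟩
  · have h1 := h.norm_sq_sub_le_of_mem_trappedSet (hz w hw) (hz w' hw')
    have h2 := hsq (Θ.symm ((w : X) - w'))
    simp only [map_sub, Prod.fst_sub, Prod.snd_sub] at h2
    simp only at h1
    have h3 : ‖z w - z w'‖ ≤ ‖Θ.symm (w : X) - Θ.symm (w' : X)‖ := by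
      refine le_of_sq_le_sq ?_ (norm_nonneg _)
      nlinarith [norm_nonneg (Θ.symm (w : X) - Θ.symm (w' : X))]
    rw [← map_sub] at h3
    have h4 : dist (g w) (g w') = ‖Θ (0, z w - z w', 0)‖ := by
      rw [Subtype.dist_eq, dist_eq_norm, hgval, hgval, ← map_sub]
      congr 2
      simp
    rw [h4, Subtype.dist_eq, dist_eq_norm]
    calc ‖Θ (0, z w - z w', 0)‖ ≤ M * ‖z w - z w'‖ := hMz _
      _ ≤ M * (M' * ‖(w : X) - w'‖) := by
        have := h3.trans (hM'w _)
        gcongr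
      _ = _ := by rw [Real.coe_toNNReal _ (by positivity), mul_assoc]
  · rw [hasFDerivWithinAt_iff_isLittleO, Asymptotics.isLittleO_iff]
    intro c hcpos
    -- a cone slope for which the bound in the chart gives the constant `c` in the original norms
    obtain ⟨κ, hκ, hκ1, hκc⟩ : ∃ κ : ℝ, 0 < κ ∧ κ ≤ 1 ∧ M * (2 * κ * M') ≤ c := by
      refine ⟨min 1 (c / (2 * (M + 1) * (M' + 1))), by positivity, min_le_left _ _, ?_⟩
      have h1 : min 1 (c / (2 * (M + 1) * (M' + 1))) * (2 * (M + 1) * (M' + 1)) ≤ c := by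
        rw [← le_div_iff₀ (by positivity)]
        exact min_le_right _ _
      refine le_trans ?_ h1
      have h2 : 0 < min 1 (c / (2 * (M + 1) * (M' + 1))) := by positivity
      have h3 : M * M' ≤ (M + 1) * (M' + 1) := by
        have := norm_nonneg (Θ : (Y × Z × ℝ) →L[ℝ] X)
        have := norm_nonneg (Θ.symm : X →L[ℝ] (Y × Z × ℝ))
        gcongr <;> linarith
      nlinarith
    obtain ⟨δ', hδ', hsmall⟩ := h.exists_forall_trappedSet_norm_sq_le (δ := δ) hflat hκ hκ1
    have hnear : ∀ᶠ w : S in 𝓝 0, ‖Θ.symm (w : X)‖ < δ' := by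
      have h1 : Continuous fun w : S => ‖Θ.symm (w : X)‖ := by fun_prop
      have h2 := h1.tendsto 0
      simp only [ZeroMemClass.coe_zero, map_zero, norm_zero] at h2
      exact h2.eventually (gt_mem_nhds hδ')
    filter_upwards [mem_nhdsWithin_of_mem_nhds hnear, self_mem_nhdsWithin] with w hw hwN
    have h1 := hsmall _ (hz w hwN) ((norm_fst_le (Θ.symm (w : X))).trans_lt hw)
      (abs_lt.1 ((abs_last_le (Θ.symm (w : X))).trans_lt hw)).1
    simp only at h1
    have h2 := hsq (Θ.symm (w : X))
    have h3 : ‖z w‖ ≤ 2 * κ * ‖Θ.symm (w : X)‖ := by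
      refine le_of_sq_le_sq ?_ (by positivity)
      have h4 : κ ^ 2 * (‖(Θ.symm (w : X)).1‖ ^ 2 + (Θ.symm (w : X)).2.2 ^ 2) ≤
          κ ^ 2 * (2 * ‖Θ.symm (w : X)‖ ^ 2) := by gcongr
      nlinarith [sq_nonneg (κ * ‖Θ.symm (w : X)‖)]
    rw [hg0]
    simp only [zero_apply, sub_zero]
    calc ‖g w‖ = ‖Θ (0, z w, 0)‖ := rfl
      _ ≤ M * ‖z w‖ := hMz _
      _ ≤ M * (2 * κ * (M' * ‖(w : X)‖)) := by
        have := hM'w (w : X)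
        have h5 : 2 * κ * ‖Θ.symm (w : X)‖ ≤ 2 * κ * (M' * ‖(w : X)‖) := by gcongr
        have := h3.trans h5
        gcongr
      _ = M * (2 * κ * M') * ‖w‖ := by rw [Submodule.coe_norm]; ring
      _ ≤ c * ‖w‖ := by gcongr
  · ext x
    rw [hc.mem_localStableSet_iff h]
    constructor
    · intro hx
      set q := Θ.symm (x - p) with hq
      have hbox := trappedSet_subset _ hx
      let w : S := ⟨Θ (q.1, 0, q.2.2), (hS _).2 rfl⟩
      have hwN : p + (w : X) ∈ N :=
        (hc.add_mem_iff _).2 ⟨hbox.1, by simpa using hδ, hbox.2.2⟩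
      refine ⟨w, hwN, ?_⟩
      have hw : Θ.symm (w : X) = (q.1, 0, q.2.2) := Θ.symm_apply_apply _
      have h1 := hz w hwN
      have h2 := h.eq_of_mem_trappedSet h1 hx (by rw [hw]) (by rw [hw])
      have h3 : (w : X) + Θ (0, z w, 0) = x - p := by
        rw [← Θ.apply_symm_apply (x - p), ← hq, ← h2, hw]
        change Θ _ + Θ _ = _
        rw [← map_add]
        congr 1
        simp
      simp only [hgval, add_assoc]
      rw [h3, add_sub_cancel]
    · rintro ⟨w, hw, rfl⟩
      have h1 : Θ.symm (p + (w : X) + (g w : X) - p) =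
          ((Θ.symm w).1, z w, (Θ.symm w).2.2) := by
        rw [add_assoc, add_sub_cancel_left, map_add, hgval, Θ.symm_apply_apply]
        refine Prod.ext ?_ (Prod.ext ?_ ?_) <;> simp [hcoord w]
      rw [h1]
      exact hz w hw

end Chart

/-! ### Localisation near the equilibrium -/

section Localisation

open scoped NNReal

theorem halfBox_eq_prod (Y Z : Type*) [NormedAddCommGroup Y] [NormedAddCommGroup Z] (δ : ℝ) :
    halfBox Y Z δ = Metric.ball 0 δ ×ˢ Metric.ball 0 δ ×ˢ Ioc (-δ) 0 := by
  ext q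
  simp [halfBox]

theorem convex_halfBox (Y Z : Type*) [NormedAddCommGroup Y] [NormedSpace ℝ Y]
    [NormedAddCommGroup Z] [NormedSpace ℝ Z] (δ : ℝ) : Convex ℝ (halfBox Y Z δ) := by
  rw [halfBox_eq_prod]
  exact (convex_ball 0 δ).prod ((convex_ball 0 δ).prod (convex_Ioc _ _))

theorem halfBox_mono {Y Z : Type*} [NormedAddCommGroup Y] [NormedAddCommGroup Z] {δ δ' : ℝ}
    (h : δ ≤ δ') : halfBox Y Z δ ⊆ halfBox Y Z δ' := fun _ hq =>
  ⟨hq.1.trans_le h, hq.2.1.trans_le h, by linarith [hq.2.2.1], hq.2.2.2⟩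

/-- Strict differentiability at a point of a domain with boundary: near `p`, a `C^1` map is a
Lipschitz-small perturbation of its linear part on convex subsets of its domain. -/
theorem _root_.ContDiffOn.exists_norm_image_sub_sub_le {X X' : Type*} [NormedAddCommGroup X]
    [NormedSpace ℝ X] [NormedAddCommGroup X'] [NormedSpace ℝ X'] {F : X → X'} {P : Set X} {p : X}
    (hF : ContDiffOn ℝ 1 F P) (hP : UniqueDiffOn ℝ P) (hp : p ∈ P) {c : ℝ} (hc : 0 < c) :
    ∃ r > 0, ∀ s ⊆ P ∩ Metric.ball p r, Convex ℝ s → ∀ x ∈ s, ∀ y ∈ s,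
      ‖F y - F x - fderivWithin ℝ F P p (y - x)‖ ≤ c * ‖y - x‖ := by
  have h1 := (hF.continuousOn_fderivWithin hP le_rfl) p hp
  obtain ⟨r, hr, h2⟩ := Metric.continuousWithinAt_iff.1 h1 c hc
  refine ⟨r, hr, fun s hs hconv x hx y hy => ?_⟩
  refine hconv.norm_image_sub_le_of_norm_hasFDerivWithin_le' (f' := fderivWithin ℝ F P)
    (fun z hz => ((hF.differentiableOn one_ne_zero z (hs hz).1).hasFDerivWithinAt).mono
      fun w hw => (hs hw).1) (fun z hz => ?_) hx hy
  have h3 := h2 (hs hz).1 (hs hz).2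
  rw [dist_eq_norm] at h3
  exact h3.le

variable {E Y Z : Type*} [NormedAddCommGroup E] [NormedSpace ℝ E]
  [NormedAddCommGroup Y] [InnerProductSpace ℝ Y] [NormedAddCommGroup Z] [InnerProductSpace ℝ Z]
  {U : Set E} {η : E} {F : E × ℝ → E × ℝ} {Θ : (Y × Z × ℝ) ≃L[ℝ] E × ℝ}
  {A : Y →L[ℝ] Y} {B : Z →L[ℝ] Z}

theorem uniqueDiffOn_extPhaseSpace (hU : IsOpen U) : UniqueDiffOn ℝ (extPhaseSpace U) :=
  hU.uniqueDiffOn.prod (uniqueDiffOn_Icc (by norm_num))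

/-- In adapted coordinates, the remainder of the vector field is Lipschitz-small on small boxes. -/
theorem exists_halfBox_norm_remainder_sub_le (hU : IsOpen U) (hη : η ∈ U)
    (hF : ContDiffOn ℝ 1 F (extPhaseSpace U))
    (hlin : ∀ q, fderivWithin ℝ F (extPhaseSpace U) (η, 1) (Θ q) = Θ (A q.1, B q.2.1, 0))
    (hlast : ∀ q, (Θ q).2 = q.2.2) {O : Set (E × ℝ)} (hO : O ∈ 𝓝 (η, (1 : ℝ))) {c : ℝ}
    (hc : 0 < c) :
    ∃ δ, 0 < δ ∧ δ < 1 ∧ (∀ q ∈ halfBox Y Z δ, (η, (1 : ℝ)) + Θ q ∈ extPhaseSpace U ∩ O) ∧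
      ∀ q ∈ halfBox Y Z δ, ∀ q' ∈ halfBox Y Z δ,
        ‖(Θ.symm (F ((η, 1) + Θ q)) - (A q.1, B q.2.1, 0)) -
          (Θ.symm (F ((η, 1) + Θ q')) - (A q'.1, B q'.2.1, 0))‖ ≤ c * ‖q - q'‖ := by
  set P := extPhaseSpace U with hP
  set p : E × ℝ := (η, 1) with hp
  have hpP : p ∈ P := ⟨hη, by simp [p]⟩
  set M := ‖(Θ : (Y × Z × ℝ) →L[ℝ] E × ℝ)‖ with hM
  set M' := ‖(Θ.symm : E × ℝ →L[ℝ] (Y × Z × ℝ))‖ with hM'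
  have hM0 : 0 ≤ M := norm_nonneg (Θ : (Y × Z × ℝ) →L[ℝ] E × ℝ)
  have hM'0 : 0 ≤ M' := norm_nonneg (Θ.symm : E × ℝ →L[ℝ] (Y × Z × ℝ))
  obtain ⟨r, hr, hrem⟩ := hF.exists_norm_image_sub_sub_le (uniqueDiffOn_extPhaseSpace hU) hpP
    (c := c / ((M + 1) * (M' + 1))) (by positivity)
  have hnear : ∀ᶠ q in 𝓝 (0 : Y × Z × ℝ),
      (p + Θ q).1 ∈ U ∧ p + Θ q ∈ O ∧ p + Θ q ∈ Metric.ball p r := by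
    have h1 : Tendsto (fun q => p + Θ q) (𝓝 0) (𝓝 p) := by
      have : Continuous fun q => p + Θ q := by fun_prop
      simpa using this.tendsto 0
    have h2 : Tendsto (fun q => (p + Θ q).1) (𝓝 0) (𝓝 η) := (continuous_fst.tendsto p).comp h1
    exact (h2.eventually (hU.mem_nhds hη)).and
      ((h1.eventually hO).and (h1.eventually (Metric.ball_mem_nhds p hr)))
  obtain ⟨d, hd, hball⟩ := Metric.eventually_nhds_iff_ball.1 hnear
  set δ := min (d / 2) (1 / 2) with hδdef
  have hδ : 0 < δ := by positivity
  have hδd : δ < d := (min_le_left _ _).trans_lt (by linarith)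
  have hδ1 : δ < 1 := (min_le_right _ _).trans_lt (by norm_num)
  have hin : ∀ q ∈ halfBox Y Z δ, (p + Θ q).1 ∈ U ∧ p + Θ q ∈ O ∧ p + Θ q ∈ Metric.ball p r :=
    fun q hq => hball q (mem_ball_zero_iff.2 ((norm_le_of_mem_halfBox hq).trans_lt hδd))
  have hinP : ∀ q ∈ halfBox Y Z δ, p + Θ q ∈ P := by
    intro q hq
    refine ⟨(hin q hq).1, ?_⟩
    have h1 : (p + Θ q).2 = 1 + q.2.2 := by rw [Prod.snd_add, hlast]
    rw [h1]
    exact ⟨by linarith [hq.2.2.1], by linarith [hq.2.2.2]⟩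
  refine ⟨δ, hδ, hδ1, fun q hq => ⟨hinP q hq, (hin q hq).2.1⟩, fun q hq q' hq' => ?_⟩
  have hconv : Convex ℝ ((fun q => p + Θ q) '' halfBox Y Z δ) := by
    have h1 := ((convex_halfBox Y Z δ).is_linear_image Θ.toLinearEquiv.toLinearMap.isLinear)
    have h2 := h1.translate p
    rw [image_image] at h2
    exact h2
  have h1 := hrem _ (by
    rintro _ ⟨q, hq, rfl⟩
    exact ⟨hinP q hq, (hin q hq).2.2⟩) hconv _ (mem_image_of_mem _ hq') _ (mem_image_of_mem _ hq)
  have h2 : (Θ.symm (F (p + Θ q)) - (A q.1, B q.2.1, (0 : ℝ))) -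
      (Θ.symm (F (p + Θ q')) - (A q'.1, B q'.2.1, 0)) =
      Θ.symm (F (p + Θ q) - F (p + Θ q') - fderivWithin ℝ F P p (p + Θ q - (p + Θ q'))) := by
    rw [add_sub_add_left_eq_sub, map_sub (fderivWithin ℝ F P p), hlin, hlin]
    simp only [map_sub, Θ.symm_apply_apply]
    abel
  rw [h2]
  have h3 : ‖p + Θ q - (p + Θ q')‖ ≤ M * ‖q - q'‖ := by
    rw [add_sub_add_left_eq_sub, ← map_sub]
    exact (Θ : (Y × Z × ℝ) →L[ℝ] E × ℝ).le_opNorm _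
  set D := ‖q - q'‖ with hD
  have hD0 : 0 ≤ D := norm_nonneg _
  refine ((Θ.symm : E × ℝ →L[ℝ] (Y × Z × ℝ)).le_opNorm _).trans ?_
  calc M' * _ ≤ M' * (c / ((M + 1) * (M' + 1)) * (M * D)) := by
        refine mul_le_mul_of_nonneg_left (h1.trans ?_) hM'0
        gcongr
    _ = (M * M') / ((M + 1) * (M' + 1)) * (c * D) := by ring
    _ ≤ 1 * (c * D) := by
        refine mul_le_mul_of_nonneg_right ?_ (by positivity)
        rw [div_le_one (by positivity)]
        gcongr <;> linarith
    _ = _ := one_mul _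

theorem abs_clamp_sub_le (δ s t : ℝ) :
    |max (-δ) (min s 0) - max (-δ) (min t 0)| ≤ |s - t| := by
  have h1 := abs_max_sub_max_le_abs (min s 0) (min t 0) (-δ)
  have h2 := abs_min_sub_min_le_max s 0 t 0
  rw [max_comm (-δ), max_comm (-δ)]
  refine h1.trans (h2.trans ?_)
  simp

/-- Near the equilibrium, the compactified system is a saddle model in a linear chart: the remainder
is cut down to a small box, and extended to the whole space with a small Lipschitz constant. -/
theorem exists_isBoxChart [FiniteDimensional ℝ Y] [FiniteDimensional ℝ Z] (hU : IsOpen U)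
    (hη : η ∈ U) (hF : ContDiffOn ℝ 1 F (extPhaseSpace U)) (hF0 : F (η, 1) = 0) {a : ℝ → ℝ}
    (ha : ∀ x s, (F (x, s)).2 = a s) (ha1 : a 1 = 0) (hapos : ∀ s ∈ Ioo (-1) 1, 0 < a s)
    (hlin : ∀ q, fderivWithin ℝ F (extPhaseSpace U) (η, 1) (Θ q) = Θ (A q.1, B q.2.1, 0))
    (hlast : ∀ q, (Θ q).2 = q.2.2) {l : ℝ} (hl : 0 < l) (hA : ∀ y, inner ℝ (A y) y ≤ -l * ‖y‖ ^ 2)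
    (hB : ∀ z, l * ‖z‖ ^ 2 ≤ inner ℝ (B z) z) {O : Set (E × ℝ)} (hO : O ∈ 𝓝 (η, (1 : ℝ))) :
    ∃ N ⊆ O, ∃ (ρ : Y × Z × ℝ → Y × Z) (γ : ℝ → ℝ) (ε δ : ℝ), 0 < δ ∧
      IsOpenNhdIn (extPhaseSpace U) (η, 1) N ∧ IsSaddleModel A B ρ γ l ε ∧
      IsBoxChart F (extPhaseSpace U) (η, 1) N Θ (modelField A B ρ γ) δ ∧
      ∀ ε' > 0, ∃ δ' > 0, ∀ q ∈ halfBox Y Z δ', ‖ρ q‖ ≤ ε' * ‖q‖ ∧ |γ q.2.2| ≤ ε' * ‖q‖ := by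
  set P := extPhaseSpace U with hP
  set p : E × ℝ := (η, 1) with hp
  have hsymm : ∀ w, (Θ.symm w).2.2 = w.2 := fun w => by
    rw [← hlast (Θ.symm w), Θ.apply_symm_apply]
  set R : Y × Z × ℝ → Y × Z × ℝ := fun q =>
    Θ.symm (F (p + Θ q)) - (A q.1, B q.2.1, 0) with hR
  have hR0 : R 0 = 0 := by
    simp only [hR, map_zero, add_zero, hF0, Prod.fst_zero, Prod.snd_zero]
    exact sub_self 0
  have hRlast : ∀ q, (R q).2.2 = a (1 + q.2.2) := by
    intro q
    simp only [hR, Prod.snd_sub, sub_zero, hsymm]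
    rw [show p + Θ q = (η + (Θ q).1, 1 + q.2.2) from Prod.ext rfl (by simp [hp, hlast]), ha]
  set C : ℝ := (lipschitzExtensionConstant (Y × Z) : ℝ) with hC
  have hC0 : 0 < C := lipschitzExtensionConstant_pos (Y × Z)
  -- extending the remainder to the whole space costs a factor `C` in its Lipschitz constant
  set c := min (l / 24) (l / 24 / C) with hcdef
  have hc : 0 < c := by positivity
  obtain ⟨Δ, hΔ, hΔ1, hΔP, hΔR⟩ := exists_halfBox_norm_remainder_sub_le hU hη hF hlin hlast hO hc
  have hzero : ∀ {d : ℝ}, 0 < d → (0 : Y × Z × ℝ) ∈ halfBox Y Z d := fun hd =>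
    ⟨by simpa using hd, by simpa using hd, by simpa using hd, le_rfl⟩
  have hlip : LipschitzOnWith c.toNNReal (fun q => ((R q).1, (R q).2.1)) (halfBox Y Z Δ) := by
    refine LipschitzOnWith.of_dist_le_mul fun q hq q' hq' => ?_
    rw [Real.coe_toNNReal _ hc.le, dist_eq_norm, dist_eq_norm]
    refine le_trans ?_ (hΔR q hq q' hq')
    exact max_le (norm_fst_le (R q - R q')) (norm_mid_le (R q - R q'))
  obtain ⟨ρ, hρlip, hρeq⟩ := hlip.extend_finite_dimension
  have hρ0 : ρ 0 = 0 := by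
    rw [← hρeq (hzero hΔ)]
    simp only [hR0]
    rfl
  set δ := Δ / 2 with hδ
  have hδ0 : 0 < δ := by positivity
  have hδΔ : halfBox Y Z δ ⊆ halfBox Y Z Δ := halfBox_mono (by linarith)
  have hbox : ∀ s, ((0, 0, max (-δ) (min s 0)) : Y × Z × ℝ) ∈ halfBox Y Z Δ := fun s =>
    ⟨by simpa using hΔ, by simpa using hΔ, lt_max_of_lt_left (by linarith),
      max_le (by linarith) (min_le_right _ _)⟩
  -- `γ` is constant to the left of `-δ`, inside the larger box on which its size is controlled
  set γ : ℝ → ℝ := fun s => a (1 + max (-δ) (min s 0)) with hγ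
  have hγeq : ∀ s, -δ ≤ s → s ≤ 0 → γ s = a (1 + s) := fun s h1 h2 => by
    simp only [hγ]
    rw [min_eq_left h2, max_eq_right h1]
  have hmodel : IsSaddleModel A B ρ γ l (l / 24) :=
    { gap_pos := hl
      inner_le := hA
      le_inner := hB
      eps_nonneg := by positivity
      eps_le := by linarith
      norm_sub_le := fun q q' => by
        have h1 := hρlip.dist_le_mul q q'
        rw [dist_eq_norm, dist_eq_norm, NNReal.coe_mul, Real.coe_toNNReal _ hc.le] at h1
        refine h1.trans (mul_le_mul_of_nonneg_right ?_ (norm_nonneg _))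
        rw [← le_div_iff₀' hC0]
        exact min_le_right _ _
      map_zero := hρ0
      abs_sub_le := fun s t => by
        have h1 := hΔR _ (hbox s) _ (hbox t)
        have h2 := (abs_last_le (R (0, 0, max (-δ) (min s 0)) - R (0, 0, max (-δ) (min t 0)))).trans
          h1
        rw [Prod.snd_sub, Prod.snd_sub, hRlast, hRlast] at h2
        have h3 : ‖((0, 0, max (-δ) (min s 0)) : Y × Z × ℝ) - (0, 0, max (-δ) (min t 0))‖ =
            |max (-δ) (min s 0) - max (-δ) (min t 0)| := by
          simp [Prod.norm_def]
        rw [h3] at h2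
        refine h2.trans (mul_le_mul (min_le_left _ _) (abs_clamp_sub_le δ s t) (abs_nonneg _)
          (by positivity))
      eq_zero := fun s hs => by
        simp only [hγ]
        rw [min_eq_right hs, max_eq_right (by linarith), add_zero, ha1]
      pos := fun s hs => by
        refine hapos _ ⟨?_, ?_⟩
        · linarith [le_max_left (-δ) (min s 0)]
        · have : max (-δ) (min s 0) < 0 := max_lt (by linarith) (min_lt_of_left_lt hs)
          linarith }
  refine ⟨{x | Θ.symm (x - p) ∈ halfBox Y Z δ}, fun x hx => ?_, ρ, γ, l / 24, δ, hδ0, ⟨?_, ?_⟩,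
    hmodel, ⟨fun x => Iff.rfl, fun x hx => ?_, fun x hx => ?_⟩, fun ε' hε' => ?_⟩
  · have := (hΔP _ (hδΔ hx)).2
    rwa [Θ.apply_symm_apply, add_sub_cancel] at this
  · change Θ.symm (p - p) ∈ halfBox Y Z δ
    rw [sub_self, map_zero]
    exact hzero hδ0
  · refine ⟨{x : E × ℝ | ‖(Θ.symm (x - p)).1‖ < δ ∧ ‖(Θ.symm (x - p)).2.1‖ < δ ∧
      -δ < (Θ.symm (x - p)).2.2}, ?_, ?_⟩
    · have hcont : Continuous fun x : E × ℝ => Θ.symm (x - p) := by fun_prop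
      exact (isOpen_lt hcont.fst.norm continuous_const).inter
        ((isOpen_lt hcont.snd.fst.norm continuous_const).inter
          (isOpen_lt continuous_const hcont.snd.snd))
    · ext x
      constructor
      · intro hx
        refine ⟨⟨hx.1, hx.2.1, hx.2.2.1⟩, ?_⟩
        have := (hΔP _ (hδΔ hx)).1
        rwa [Θ.apply_symm_apply, add_sub_cancel] at this
      · rintro ⟨⟨h1, h2, h3⟩, hxP⟩
        refine ⟨h1, h2, h3, ?_⟩
        rw [hsymm]
        have := hxP.2.2
        simpa [hp] using this
  · have := (hΔP _ (hδΔ hx)).1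
    rwa [Θ.apply_symm_apply, add_sub_cancel] at this
  · set q := Θ.symm (x - p) with hq
    have hqbox : q ∈ halfBox Y Z δ := hx
    have h1 : p + Θ q = x := by rw [hq, Θ.apply_symm_apply, add_sub_cancel]
    have h2 : Θ.symm (F x) = R q + (A q.1, B q.2.1, 0) := by
      simp only [hR, h1, sub_add_cancel]
    have h3 := hρeq (hδΔ hqbox)
    simp only at h3
    have h4 : γ q.2.2 = (R q).2.2 := by
      rw [hγeq _ hqbox.2.2.1.le hqbox.2.2.2, hRlast]
    rw [h2, modelField, ← h3, h4]
    refine Prod.ext (add_comm _ _) (Prod.ext (add_comm _ _) (add_zero _))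
  · obtain ⟨d, hd, -, -, hdR⟩ := exists_halfBox_norm_remainder_sub_le hU hη hF hlin hlast hO hε'
    refine ⟨min d δ, by positivity, fun q hq => ?_⟩
    have hqδ := halfBox_mono (min_le_right d δ) hq
    have h1 := hdR q (halfBox_mono (min_le_left d δ) hq) 0 (hzero hd)
    change ‖R q - R 0‖ ≤ _ at h1
    rw [hR0, sub_zero, sub_zero] at h1
    constructor
    · rw [← hρeq (hδΔ hqδ)]
      exact (max_le (norm_fst_le (R q)) (norm_mid_le (R q))).trans h1
    · rw [hγeq _ hqδ.2.2.1.le hqδ.2.2.2, ← hRlast]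
      exact (abs_last_le (R q)).trans h1

end Localisation

/-! ### The compactified system -/

section Compactified

variable {E G : Type*} [NormedAddCommGroup E] [NormedSpace ℝ E] {f : E × G → E} {Γ : ℝ → G} {Γm Γp : G} {g : ℝ → ℝ}
  {U : Set E} {η : E}

theorem augField_one : augField g 1 = 0 := by simp [augField]

theorem IsCoordTransformation.augField_pos (hg : IsCoordTransformation g) {s : ℝ}
    (hs : s ∈ Ioo (-1 : ℝ) 1) : 0 < augField g s := by
  rw [augField, if_neg (by rintro (h | h) <;> linarith [hs.1, hs.2])]
  exact hg.deriv_pos _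

theorem compactField_apply_one {E G : Type*} {f : E × G → E} {Γ : ℝ → G} {Γm Γp : G} {g : ℝ → ℝ}
    (x : E) : compactField f Γ Γm Γp g (x, 1) = (f (x, Γp), 0) := by
  simp [compactField, extTerm, augField]

/-- The slice `s = 1` is invariant and carries the future limit system, so the linearisation of that
system is the restriction of the one of the compactified system. -/
theorem fderivWithin_compactField_apply_inl (hU : IsOpen U) (hη : η ∈ U)
    (hF : ContDiffOn ℝ 1 (compactField f Γ Γm Γp g) (extPhaseSpace U)) (v : E) :
    fderivWithin ℝ (compactField f Γ Γm Γp g) (extPhaseSpace U) (η, 1) (v, 0) =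
      (fderivWithin ℝ (fun x => f (x, Γp)) U η v, 0) := by
  set A := fderivWithin ℝ (compactField f Γ Γm Γp g) (extPhaseSpace U) (η, 1)
  have h1 : HasFDerivWithinAt (compactField f Γ Γm Γp g) A (extPhaseSpace U) (η, 1) :=
    (hF.differentiableOn one_ne_zero _ ⟨hη, by simp⟩).hasFDerivWithinAt
  have h2 : HasFDerivWithinAt (fun x : E => (x, (1 : ℝ))) (ContinuousLinearMap.inl ℝ E ℝ) U η :=
    (hasFDerivWithinAt_id η U).prodMk (hasFDerivWithinAt_const _ _ _)
  have h3 := h1.comp η h2 (t := extPhaseSpace U) fun x hx => ⟨hx, by simp⟩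
  have h4 : compactField f Γ Γm Γp g ∘ (fun x : E => (x, (1 : ℝ))) = fun x => (f (x, Γp), 0) :=
    funext compactField_apply_one
  rw [h4] at h3
  have h5 := h3.fst
  have h6 := h3.snd
  rw [h5.fderivWithin (hU.uniqueDiffOn η hη)]
  have h7 := (hU.uniqueDiffOn η hη).eq h6 (hasFDerivWithinAt_const (0 : ℝ) η U)
  exact Prod.ext rfl (congrArg (fun L : E →L[ℝ] ℝ => L v) h7)

end Compactified

end AsympAuto

theorem theorem3p1 {n d : ℕ}
    (U : Set (EuclideanSpace ℝ (Fin n))) (V : Set (EuclideanSpace ℝ (Fin d)))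
    (hU : IsOpen U) (hV : IsOpen V)
    (f : EuclideanSpace ℝ (Fin n) × EuclideanSpace ℝ (Fin d) → EuclideanSpace ℝ (Fin n))
    (hf : ContDiffOn ℝ 1 f (U ×ˢ V))
    (Γ : ℝ → EuclideanSpace ℝ (Fin d)) (hΓ : ContDiff ℝ 1 Γ) (hΓV : ∀ t, Γ t ∈ V)
    (Γm Γp : EuclideanSpace ℝ (Fin d)) (hΓmV : Γm ∈ V) (hΓpV : Γp ∈ V)
    (hΓm : Filter.Tendsto Γ Filter.atBot (nhds Γm))
    (hΓp : Filter.Tendsto Γ Filter.atTop (nhds Γp))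
    (g : ℝ → ℝ) (hg : AsympAuto.IsCoordTransformation g)
    -- the compactified system is `C^1`-smooth on the extended phase space
    (hF : ContDiffOn ℝ 1 (AsympAuto.compactField f Γ Γm Γp g) (AsympAuto.extPhaseSpace U))
    (η : EuclideanSpace ℝ (Fin n))
    (hη : AsympAuto.IsHyperbolicSaddle (fun x => f (x, Γp)) U η)
    (hη' : AsympAuto.IsNonhyperbolicSaddle
      (AsympAuto.compactField f Γ Γm Γp g) (AsympAuto.extPhaseSpace U) (η, 1)) :
    ∀ O ∈ nhds ((η, 1) : EuclideanSpace ℝ (Fin n) × ℝ), ∃ N ⊆ O,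
      AsympAuto.IsOpenNhdIn (AsympAuto.extPhaseSpace U) (η, 1) N ∧
      (∃! W, AsympAuto.IsLocalCentreStableManifold
        (AsympAuto.compactField f Γ Γm Γp g) (AsympAuto.extPhaseSpace U) (η, 1) N W) ∧
      ∀ W, AsympAuto.IsLocalCentreStableManifold
          (AsympAuto.compactField f Γ Γm Γp g) (AsympAuto.extPhaseSpace U) (η, 1) N W →
        W = AsympAuto.localStableSet
          (AsympAuto.compactField f Γ Γm Γp g) (AsympAuto.extPhaseSpace U) {(η, 1)} N := by
  open AsympAuto in
  intro O hO
  have hslice := fderivWithin_compactField_apply_inl hU hη.1 hF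
  set A := fderivWithin ℝ (compactField f Γ Γm Γp g) (extPhaseSpace U) (η, 1) with hA
  -- in the last row of the linearisation only the diagonal entry `(A (0, 1)).2` can be nonzero; it is
  -- the eigenvalue that non-hyperbolicity forces to be zero
  have hsnd : ∀ q, (A q).2 = (A (0, 1)).2 * q.2 := by
    intro q
    have h1 : q = (q.1, 0) + q.2 • ((0, 1) : EuclideanSpace ℝ (Fin n) × ℝ) := by
      refine Prod.ext ?_ ?_ <;> simp
    conv_lhs => rw [h1]
    rw [map_add, map_smul, hslice, Prod.snd_add, Prod.smul_snd, smul_eq_mul, zero_add, mul_comm]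
  have hc := eq_zero_of_not_isHyperbolicMap hslice hsnd hη.2.2.2 hη'.2.2.2
  obtain ⟨k, m, Θ, S, T, l, hl, hS, hT, hlin, hlast, hcs, hu⟩ :=
    exists_splitting_coordinates hslice (fun q => by rw [hsnd, hc, zero_mul]) hη.2.2.2
  obtain ⟨N, hNO, ρ, γ, ε, δ, hδ, hN, hmodel, hchart, hflat⟩ :=
    exists_isBoxChart hU hη.1 hF hη'.2.1 (a := augField g) (fun _ _ => rfl) augField_one
      (fun s hs => hg.augField_pos hs) hlin hlast hl hS hT hO
  have huniq : ∀ W, IsLocalCentreStableManifold (compactField f Γ Γm Γp g) (extPhaseSpace U)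
      (η, 1) N W → W = localStableSet (compactField f Γ Γm Γp g) (extPhaseSpace U) {(η, 1)} N :=
    fun W hW => hchart.eq_localStableSet hmodel hcs hu hW.1 hW.2
  exact ⟨N, hNO, hN, ⟨_, ⟨hchart.isTangentLipschitzGraph hmodel hδ hflat hcs hu,
    hchart.isInvariantRel_localStableSet hmodel⟩, huniq⟩, huniq⟩
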